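/- Conventions. Let $\mathbf K$ be a (strict) $2$-category. For a bundle $q\colon E\to B$ in a category write $E_n$ for the $n$-fold pullback of $q$ along itself. An *additive bundle* $(q\colon E\to B,z_q,s_q)$ in a category consists of a morphism $q$ all of whose $n$-fold pullbacks $E_n$ ($n\geq 1$) exist, a section $z_q\colon B\to E$ of $q$ and a morphism $s_q\colon E_2\to E$ over $B$ that is associative, commutative and unital with unit $z_q$. An *abelian group bundle* is an additive bundle with a *negation*, i.e. a morphism $n_q\colon E\to E$ with $s_q\circ\langle n_q,\mathrm{id}_E\rangle=z_q\circ q$. A *tangentad* $(\mathbb X,\mathbb T)$ in $\mathbf K$ is an object $\mathbb X$ with a $1$-endomorphism $T$, $2$-morphisms $p\colon T\Rightarrow\mathrm{id}$, $z\colon\mathrm{id}\Rightarrow T$, $s\colon T_2\Rightarrow T$, $l\colon T\Rightarrow T^2$ and $c\colon T^2\Rightarrow T^2$ such that $p$ has all $n$-fold pullbacks $T_n$ along itself, pointwise (i.e. they are preserved by precomposition with each $1$-morphism $F\colon\mathbb X'\to\mathbb X$) and preserved by all iterates $T^k$; $\mathbf p=(p,z,s)$ is an additive bundle in $\mathrm{End}(\mathbb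 X)$; $(z,l)\colon\mathbf p\to T\mathbf p$ and $(\mathrm{id},c)\colon T\mathbf p\to\mathbf p_T$ are additive bundle morphisms; $Tl\circ l=l_T\circ l$, $c\circ l=l$, $c_T\circ Tc\circ l_T=Tl\circ c$, $c^2=\mathrm{id}$, $Tc\circ c_T\circ Tc=c_T\circ Tc\circ c_T$; and the square with sides $Ts\circ\langle l\pi_1,z_T\pi_2\rangle\colon T_2\Rightarrow T^2$, $p\pi_1\colon T_2\Rightarrow\mathrm{id}$, $Tp\colon T^2\Rightarrow T$ and $z\colon\mathrm{id}\Rightarrow T$ is a pointwise pullback. It *admits negatives* if there is $n\colon T\Rightarrow T$ with $s\circ\langle n,\mathrm{id}_T\rangle=z\circ p$. A *lax tangent morphism* $(F,\alpha)\colon(\mathbb X,\mathbb T)\to(\mathbb X',\mathbb T')$ is a $1$-morphism $F$ with a $2$-morphism $\alpha\colon F\circ T\Rightarrow T'\circ F$ such that $(\mathrm{id}_F,\alpha)\colon F\mathbf p\to\mathbf p'_F$ is additive, $T'\alpha\circ\alpha_T\circ Fl=l'_F\circ\alpha$ and $T'\alpha\circ\alpha_T\circ Fc=c'_F\circ T'\alpha\circ\alpha_T$;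 it is *strict* if $F\circ T=T'\circ F$ and $\alpha$ is the identity. A *tangent $2$-morphism* $(F,\alpha)\Rightarrow(G,\beta)$ is a $2$-morphism $\varphi\colon F\Rightarrow G$ with $T'\varphi\circ\alpha=\beta\circ\varphi_T$. Let $[\mathbb X',\mathbb T'\,|\,\mathbb X,\mathbb T]$ be the category of lax tangent morphisms $(\mathbb X',\mathbb T')\to(\mathbb X,\mathbb T)$ and tangent $2$-morphisms, and $\mathrm{Tng}_=(\mathbf K)$ the category of tangentads and strict tangent morphisms. A *vector field* on $(G,\beta)\in[\mathbb X',\mathbb T'\,|\,\mathbb X,\mathbb T]$ is a tangent $2$-morphism $u\colon(G,\beta)\Rightarrow(T,c)\circ(G,\beta)$ with $p_G\circ u=\mathrm{id}_G$; a morphism of vector fields $(G,\beta;u)\to(G',\beta';u')$ is a tangent $2$-morphism $\varphi$ with $T\varphi\circ u=u'\circ\varphi$. They form a category $\mathrm{VF}[\mathbb X',\mathbb T'\,|\,\mathbb X,\mathbb T]$. A *tangentad of vector fields* of $(\mathbb X,\mathbb T)$ is a tangentad $\mathrm{VF}(\mathbb X,\mathbb T)$ with a strict tangent morphism $U\colon\mathrm{VF}(\mathbb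 X,\mathbb T)\to(\mathbb X,\mathbb T)$ and a vector field $v\colon U\Rightarrow T\circ U$ such that, for each tangentad $(\mathbb X',\mathbb T')$, the functor $[\mathbb X',\mathbb T'\,|\,\mathrm{VF}(\mathbb X,\mathbb T)]\to\mathrm{VF}[\mathbb X',\mathbb T'\,|\,\mathbb X,\mathbb T]$, $H\mapsto(U\circ H,v_H)$, $\theta\mapsto U\theta$, is an isomorphism of categories. $\mathbf K$ *admits the construction of vector fields* if every tangentad of $\mathbf K$ has a tangentad of vector fields. Theorem. Let $\mathbf K$ be a $2$-category which admits the construction of vector fields and in which, for every tangentad $(\mathbb X,\mathbb T)$ and every $n\geq1$, the $n$-fold $2$-pullback of $U\colon\mathrm{VF}(\mathbb X,\mathbb T)\to(\mathbb X,\mathbb T)$ along itself exists. Let $(\mathbb X,\mathbb T)$ be a tangentad with negation $n$. Then: 1. the tangentad $\mathrm{VF}(\mathbb X,\mathbb T)$ admits negatives; 2. there are a tangentad $\mathrm{VF}_2(\mathbb X,\mathbb T)$ with strict tangent morphisms $\pi_1,\pi_2\colon\mathrm{VF}_2(\mathbb X,\mathbb T)\to\mathrm{VF}(\mathbb X,\mathbb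 T)$ exhibiting its underlying object as the $2$-pullback in $\mathbf K$ of $U$ along itself, and strict tangent morphisms $$0\colon(\mathbb X,\mathbb T)\to\mathrm{VF}(\mathbb X,\mathbb T),\qquad +\colon\mathrm{VF}_2(\mathbb X,\mathbb T)\to\mathrm{VF}(\mathbb X,\mathbb T),\qquad -\colon\mathrm{VF}(\mathbb X,\mathbb T)\to\mathrm{VF}(\mathbb X,\mathbb T)$$ which correspond, under the universal property of $v$, to the vector fields $z$ on $\mathrm{id}_{\mathbb X}$, $v_{\pi_1}+v_{\pi_2}=s\circ\langle v_{\pi_1},v_{\pi_2}\rangle$ on $U\circ\pi_1=U\circ\pi_2$, and $-v=n_U\circ v$ on $U$, respectively, such that $(U,0,+,-)$ is an abelian group bundle in $\mathrm{Tng}_=(\mathbf K)$ (with $\mathrm{VF}_2(\mathbb X,\mathbb T)$ as the $2$-fold pullback of $U$). -/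

import Mathlib

open CategoryTheory Bicategory

universe w v u

attribute [-instance] CategoryTheory.catToReflQuiver CategoryTheory.instCategoryEndMonoidal

namespace Tangentads

/-! ### Fibre powers, additive bundles and abelian group bundles in a category -/

section Bundles

variable {C : Type u} [Category.{v} C]

/-- `P`, with the projections `π i : P ⟶ E`, is the `n`-fold pullback of `q : E ⟶ B` along itself
(used for `0 < n` only). -/
structure IsFibrePower {E B : C} (q : E ⟶ B) {n : ℕ} {P : C} (π : Fin n → (P ⟶ E)) : Prop where
  comm : ∀ i j, π i ≫ q = π j ≫ q
  existsUnique_lift : ∀ {A : C} (f : Fin n → (A ⟶ E)), (∀ i j, f i ≫ q = f j ≫ q) →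
    ∃! h : A ⟶ P, ∀ i, h ≫ π i = f i

/-- The raw data of an additive bundle with projection `q : E ⟶ B`: an object `pow2` (which is
required to be `E ×_B E` below) with its two projections, a zero morphism and a sum morphism. -/
structure BundleData {E B : C} (q : E ⟶ B) where
  pow2 : C
  proj : Fin 2 → (pow2 ⟶ E)
  zero : B ⟶ E
  add : pow2 ⟶ E

namespace BundleData

/-- For generalized elements `x y r : A ⟶ E` of `E`: the pairing `⟨x, y⟩ : A ⟶ E ×_B E` exists
and its composite with the sum morphism is `r`, that is, `x + y = r`. -/
def IsSum {E B : C} {q : E ⟶ B} (b : BundleData q) {A : C} (x y r : A ⟶ E) : Prop :=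
  ∃ m : A ⟶ b.pow2, m ≫ b.proj 0 = x ∧ m ≫ b.proj 1 = y ∧ m ≫ b.add = r

/-- `b` is an additive bundle: all `n`-fold pullbacks (`n ≥ 1`) of the projection along itself
exist, `b.pow2` is the `2`-fold one, zero and sum are compatible with the projection, and the sum
is associative, unital and commutative (stated on generalized elements). -/
structure IsAdditiveBundle {E B : C} {q : E ⟶ B} (b : BundleData q) : Prop where
  exists_fibrePower : ∀ n : ℕ, 0 < n →
    ∃ (P : C) (π : Fin n → (P ⟶ E)), IsFibrePower q π
  isFibrePower : IsFibrePower q b.proj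
  zero_proj : b.zero ≫ q = 𝟙 B
  add_proj : b.add ≫ q = b.proj 0 ≫ q
  add_assoc : ∀ {A : C} (x y t xy yt r : A ⟶ E), b.IsSum x y xy → b.IsSum y t yt →
    b.IsSum xy t r → b.IsSum x yt r
  zero_add : b.IsSum (q ≫ b.zero) (𝟙 E) (𝟙 E)
  add_comm : ∀ {A : C} (x y r : A ⟶ E), b.IsSum x y r → b.IsSum y x r

/-- `neg` is a negation for the bundle: `add ∘ ⟨neg, id⟩ = zero ∘ q`. -/
def IsNegation {E B : C} {q : E ⟶ B} (b : BundleData q) (neg : E ⟶ E) : Prop :=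
  b.IsSum neg (𝟙 E) (q ≫ b.zero)

/-- `(b, neg)` is an abelian group bundle: an additive bundle with a negation. -/
structure IsAbelianGroupBundle {E B : C} {q : E ⟶ B} (b : BundleData q) (neg : E ⟶ E) : Prop where
  isAdditiveBundle : b.IsAdditiveBundle
  isNegation : b.IsNegation neg

/-- `(f, g)` is an additive bundle morphism, with `f` on the bases and `g` on the total objects.
The morphism `m` is `g ×_f g`. -/
structure IsAdditiveMorphism {E B E' B' : C} {q : E ⟶ B} {q' : E' ⟶ B'} (b : BundleData q)
    (b' : BundleData q') (f : B ⟶ B') (g : E ⟶ E') : Prop where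
  proj : g ≫ q' = q ≫ f
  zero : b.zero ≫ g = f ≫ b'.zero
  add : ∃ m : b.pow2 ⟶ b'.pow2, (∀ i, m ≫ b'.proj i = b.proj i ≫ g) ∧
    m ≫ b'.add = b.add ≫ g

end BundleData

end Bundles

/-! ### Tangentads in a 2-category

A 2-category is a strict bicategory. The composite `G ∘ F` is written `F ≫ G`; accordingly, for a
2-morphism `φ`, the whiskering `G φ` is `φ ▷ G` and `φ_F` is `F ◁ φ`. -/

variable {K : Type u} [Bicategory.{w, v} K]

namespace BundleData

variable {X Y Z : K} {E B : X ⟶ Y} {q : E ⟶ B}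

/-- The bundle `G 𝐪`, obtained from `𝐪` by postcomposition with `G`. -/
def post (b : BundleData q) (G : Y ⟶ Z) : BundleData (q ▷ G) where
  pow2 := b.pow2 ≫ G
  proj i := b.proj i ▷ G
  zero := b.zero ▷ G
  add := b.add ▷ G

/-- The bundle `𝐪_F`, obtained from `𝐪` by precomposition with `F`. -/
def pre (b : BundleData q) (F : Z ⟶ X) : BundleData (F ◁ q) where
  pow2 := F ≫ b.pow2
  proj i := F ◁ b.proj i
  zero := F ◁ b.zero
  add := F ◁ b.add

end BundleData

/-- The iterates of a 1-endomorphism. -/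
def iter {X : K} (T : X ⟶ X) : ℕ → (X ⟶ X)
  | 0 => 𝟙 X
  | k + 1 => iter T k ≫ T

variable (K) in
/-- A tangentad in `K`. -/
structure Tangentad where
  /-- the base object -/
  X : K
  /-- the tangent bundle 1-morphism -/
  T : X ⟶ X
  /-- the projection -/
  p : T ⟶ 𝟙 X
  /-- the `2`-fold pullback of the projection, the zero morphism and the sum morphism -/
  bundle : BundleData p
  /-- the vertical lift -/
  l : T ⟶ T ≫ T
  /-- the canonical flip -/
  c : T ≫ T ⟶ T ≫ T
  /-- the projection admits all pointwise `n`-fold pullbacks along itself, and these are preserved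
  by all iterates of `T` -/
  exists_fibrePower : ∀ n : ℕ, 0 < n → ∃ (Tn : X ⟶ X) (π : Fin n → (Tn ⟶ T)),
    ∀ {Y : K} (F : Y ⟶ X) (k : ℕ),
      IsFibrePower ((F ◁ p) ▷ iter T k) (fun i => (F ◁ π i) ▷ iter T k)
  /-- `(p, z, s)` is an additive bundle of the category of 1-endomorphisms of `X` -/
  isAdditiveBundle : bundle.IsAdditiveBundle
  /-- `(z, l) : 𝐩 ⟶ T 𝐩` is an additive bundle morphism -/
  lift_additive : bundle.IsAdditiveMorphism (bundle.post T)
    (bundle.zero ≫ (λ_ T).inv) l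
  /-- `(id, c) : T 𝐩 ⟶ 𝐩_T` is an additive bundle morphism -/
  flip_additive : (bundle.post T).IsAdditiveMorphism (bundle.pre T)
    ((λ_ T).hom ≫ (ρ_ T).inv) c
  /-- `T l ∘ l = l_T ∘ l` -/
  lift_coassoc : l ≫ l ▷ T ≫ (α_ T T T).hom = l ≫ T ◁ l
  /-- `c ∘ l = l` -/
  lift_flip : l ≫ c = l
  /-- `c_T ∘ T c ∘ l_T = T l ∘ c` -/
  lift_flip_flip : T ◁ l ≫ (α_ T T T).inv ≫ c ▷ T ≫ (α_ T T T).hom ≫ T ◁ c =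
    c ≫ l ▷ T ≫ (α_ T T T).hom
  /-- `c ∘ c = id` -/
  flip_flip : c ≫ c = 𝟙 (T ≫ T)
  /-- `T c ∘ c_T ∘ T c = c_T ∘ T c ∘ c_T` -/
  flip_braid : c ▷ T ≫ (α_ T T T).hom ≫ T ◁ c ≫ (α_ T T T).inv ≫ c ▷ T =
    (α_ T T T).hom ≫ T ◁ c ≫ (α_ T T T).inv ≫ c ▷ T ≫ (α_ T T T).hom ≫ T ◁ c ≫ (α_ T T T).inv
  /-- universality of the vertical lift: with `μ = T s ∘ ⟨l ∘ π₁, z_T ∘ π₂⟩ : T₂ ⟶ T²`, the square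
  with sides `μ`, `p ∘ π₁`, `T p` and `z` is a pointwise pullback -/
  lift_universal : ∃ μ : bundle.pow2 ⟶ T ≫ T,
    (bundle.post T).IsSum (bundle.proj 0 ≫ l)
      (bundle.proj 1 ≫ (ρ_ T).inv ≫ T ◁ bundle.zero) μ ∧
    ∀ {Y : K} (F : Y ⟶ X), IsPullback (F ◁ μ) (F ◁ (bundle.proj 0 ≫ p)) (F ◁ (p ▷ T))
      (F ◁ (bundle.zero ≫ (λ_ T).inv))

/-- `n : T ⟶ T` is a negation for the tangentad: `s ∘ ⟨n, id⟩ = z ∘ p`. -/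
def Tangentad.IsNegation (X : Tangentad K) (n : X.T ⟶ X.T) : Prop :=
  X.bundle.IsNegation n

/-! ### Tangent morphisms -/

/-- The composite distributive law of `H ∘ G`. -/
def compLaw {X Y Z : K} {T : X ⟶ X} {T' : Y ⟶ Y} {T'' : Z ⟶ Z} {G : X ⟶ Y} {H : Y ⟶ Z}
    (β : T ≫ G ⟶ G ≫ T') (γ : T' ≫ H ⟶ H ≫ T'') : T ≫ (G ≫ H) ⟶ (G ≫ H) ≫ T'' :=
  (α_ T G H).inv ≫ β ▷ H ≫ (α_ G T' H).hom ≫ G ◁ γ ≫ (α_ G H T'').inv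

/-- The 2-morphism `T' α ∘ α_T : F ∘ T² ⟶ T'² ∘ F`. -/
def sqLaw {X Y : K} {T : X ⟶ X} {T' : Y ⟶ Y} {F : X ⟶ Y} (a : T ≫ F ⟶ F ≫ T') :
    (T ≫ T) ≫ F ⟶ F ≫ (T' ≫ T') :=
  (α_ T T F).hom ≫ T ◁ a ≫ (α_ T F T').inv ≫ a ▷ T' ≫ (α_ F T' T').hom

/-- `a : F ∘ T ⟶ T' ∘ F` is a lax distributive law, i.e. `(F, a)` is a lax tangent 1-morphism. -/
structure IsLaxLaw (X Y : Tangentad K) (F : X.X ⟶ Y.X) (a : X.T ≫ F ⟶ F ≫ Y.T) : Prop where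
  additive : (X.bundle.post F).IsAdditiveMorphism (Y.bundle.pre F)
    ((λ_ F).hom ≫ (ρ_ F).inv) a
  lift : X.l ▷ F ≫ sqLaw a = a ≫ F ◁ Y.l
  flip : X.c ▷ F ≫ sqLaw a = sqLaw a ≫ F ◁ Y.c

/-- `φ` is compatible with `a` and `b`, i.e. `φ` is a tangent 2-morphism `(F, a) ⟶ (G, b)`. -/
def IsTangentTwoMorphism {X Y : K} {T : X ⟶ X} {T' : Y ⟶ Y} {F G : X ⟶ Y}
    (a : T ≫ F ⟶ F ≫ T') (b : T ≫ G ⟶ G ≫ T') (φ : F ⟶ G) : Prop :=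
  a ≫ φ ▷ T' = T ◁ φ ≫ b

theorem compLaw_natural {X Y Z : K} {S T : X ⟶ X} {S' T' : Y ⟶ Y} {S'' T'' : Z ⟶ Z} {F : X ⟶ Y}
    {G : Y ⟶ Z} {m : S ≫ F ⟶ F ≫ S'} {k : S' ≫ G ⟶ G ≫ S''} {a : T ≫ F ⟶ F ≫ T'}
    {b : T' ≫ G ⟶ G ≫ T''} {σ : S ⟶ T} {σ' : S' ⟶ T'} {σ'' : S'' ⟶ T''}
    (h : m ≫ F ◁ σ' = σ ▷ F ≫ a) (h' : k ≫ G ◁ σ'' = σ' ▷ G ≫ b) :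
    compLaw m k ≫ (F ≫ G) ◁ σ'' = σ ▷ (F ≫ G) ≫ compLaw a b := by
  have h1 := congrArg (· ▷ G) h
  have h2 := congrArg (F ◁ ·) h'
  simp only [comp_whiskerRight, whiskerLeft_comp, whisker_assoc] at h1 h2
  simp only [compLaw, comp_whiskerLeft, whiskerRight_comp, Category.assoc,
    Iso.inv_hom_id_assoc, Iso.hom_inv_id_assoc]
  rw [reassoc_of% h2, ← reassoc_of% h1]
  simp

theorem compLaw_unitors {X Y Z : K} (F : X ⟶ Y) (G : Y ⟶ Z) :
    compLaw ((λ_ F).hom ≫ (ρ_ F).inv) ((λ_ G).hom ≫ (ρ_ G).inv) =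
      (λ_ (F ≫ G)).hom ≫ (ρ_ (F ≫ G)).inv := by
  simp only [compLaw]
  bicategory

theorem sqLaw_compLaw {X Y Z : K} {T : X ⟶ X} {T' : Y ⟶ Y} {T'' : Z ⟶ Z} {F : X ⟶ Y}
    {G : Y ⟶ Z} (a : T ≫ F ⟶ F ≫ T') (b : T' ≫ G ⟶ G ≫ T'') :
    sqLaw (compLaw a b) = compLaw (sqLaw a) (sqLaw b) := by
  simp only [sqLaw, compLaw]
  calc
    _ = 𝟙 _ ⊗≫ T ◁ a ▷ G ⊗≫ ((T ≫ F) ◁ b ≫ a ▷ (G ≫ T'')) ⊗≫ F ◁ b ▷ T'' ⊗≫ 𝟙 _ := by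
      bicategory
    _ = _ := by
      rw [whisker_exchange]
      bicategory

theorem isLaxLaw_comp {X Y Z : Tangentad K} {F : X.X ⟶ Y.X} {G : Y.X ⟶ Z.X}
    {a : X.T ≫ F ⟶ F ≫ Y.T} {b : Y.T ≫ G ⟶ G ≫ Z.T} (ha : IsLaxLaw X Y F a)
    (hb : IsLaxLaw Y Z G b) : IsLaxLaw X Z (F ≫ G) (compLaw a b) := by
  refine ⟨⟨?_, ?_, ?_⟩, ?_, ?_⟩
  · rw [← compLaw_unitors]
    exact compLaw_natural ha.additive.proj hb.additive.proj
  · rw [← compLaw_unitors]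
    exact (compLaw_natural ha.additive.zero.symm hb.additive.zero.symm).symm
  · obtain ⟨m, hm, hm'⟩ := ha.additive.add
    obtain ⟨k, hk, hk'⟩ := hb.additive.add
    exact ⟨compLaw (T := X.bundle.pow2) (T' := Y.bundle.pow2) (T'' := Z.bundle.pow2) m k,
      fun i => compLaw_natural (hm i) (hk i), compLaw_natural hm' hk'⟩
  · rw [sqLaw_compLaw]
    exact (compLaw_natural ha.lift.symm hb.lift.symm).symm
  · rw [sqLaw_compLaw]
    exact (compLaw_natural ha.flip.symm hb.flip.symm).symm

theorem isLaxLaw_id (X : Tangentad K) :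
    IsLaxLaw X X (𝟙 X.X) ((ρ_ X.T).hom ≫ (λ_ X.T).inv) := by
  have hn : ∀ {S T : X.X ⟶ X.X} (σ : S ⟶ T), ((ρ_ S).hom ≫ (λ_ S).inv) ≫ 𝟙 X.X ◁ σ =
      σ ▷ 𝟙 X.X ≫ (ρ_ T).hom ≫ (λ_ T).inv := by
    intro S T σ
    simp
  have hsq : sqLaw ((ρ_ X.T).hom ≫ (λ_ X.T).inv) =
      (ρ_ (X.T ≫ X.T)).hom ≫ (λ_ (X.T ≫ X.T)).inv := by
    simp only [sqLaw]
    bicategory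
  have hu : (λ_ (𝟙 X.X)).hom ≫ (ρ_ (𝟙 X.X)).inv = (ρ_ (𝟙 X.X)).hom ≫ (λ_ (𝟙 X.X)).inv := by
    bicategory
  refine ⟨⟨?_, ?_, ?_⟩, ?_, ?_⟩
  · rw [hu]
    exact hn X.p
  · rw [hu]
    exact (hn X.bundle.zero).symm
  · exact ⟨(ρ_ X.bundle.pow2).hom ≫ (λ_ X.bundle.pow2).inv, fun i => hn _, hn _⟩
  · rw [hsq]
    exact (hn X.l).symm
  · rw [hsq]
    exact (hn X.c).symm

/-- A lax tangent 1-morphism. -/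
structure LaxMorphism (X Y : Tangentad K) where
  F : X.X ⟶ Y.X
  law : X.T ≫ F ⟶ F ≫ Y.T
  isLaxLaw : IsLaxLaw X Y F law

/-- A tangent 2-morphism between lax tangent 1-morphisms. -/
@[ext]
structure TangentTwoMorphism {X Y : Tangentad K} (F G : LaxMorphism X Y) where
  φ : F.F ⟶ G.F
  comm : IsTangentTwoMorphism F.law G.law φ

/-- The identity tangent 2-morphism. -/
@[simps]
def TangentTwoMorphism.id {X Y : Tangentad K} (F : LaxMorphism X Y) : TangentTwoMorphism F F where
  φ := 𝟙 F.F
  comm := by simp [IsTangentTwoMorphism]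

/-- The vertical composite of tangent 2-morphisms. -/
@[simps]
def TangentTwoMorphism.comp {X Y : Tangentad K} {F G H : LaxMorphism X Y}
    (f : TangentTwoMorphism F G) (g : TangentTwoMorphism G H) : TangentTwoMorphism F H where
  φ := f.φ ≫ g.φ
  comm := by
    have hf := f.comm
    have hg := g.comm
    simp only [IsTangentTwoMorphism] at *
    rw [comp_whiskerRight, reassoc_of% hf, hg, whiskerLeft_comp, Category.assoc]

/-- The category `[X | Y]` of lax tangent 1-morphisms and tangent 2-morphisms. -/
instance instCategoryLaxMorphism (X Y : Tangentad K) : Category (LaxMorphism X Y) where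
  Hom F G := TangentTwoMorphism F G
  id F := TangentTwoMorphism.id F
  comp f g := TangentTwoMorphism.comp f g
  id_comp f := TangentTwoMorphism.ext (Category.id_comp f.φ)
  comp_id f := TangentTwoMorphism.ext (Category.comp_id f.φ)
  assoc f g h := TangentTwoMorphism.ext (Category.assoc f.φ g.φ h.φ)

@[simp]
theorem LaxMorphism.id_φ {X Y : Tangentad K} (F : LaxMorphism X Y) :
    TangentTwoMorphism.φ (𝟙 F : F ⟶ F) = 𝟙 F.F := rfl

@[simp]
theorem LaxMorphism.comp_φ {X Y : Tangentad K} {F G H : LaxMorphism X Y} (f : F ⟶ G) (g : G ⟶ H) :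
    TangentTwoMorphism.φ (f ≫ g) = TangentTwoMorphism.φ f ≫ TangentTwoMorphism.φ g := rfl

/-- The composite `G ∘ F` of lax tangent 1-morphisms. -/
@[simps]
def LaxMorphism.comp {X Y Z : Tangentad K} (F : LaxMorphism X Y) (G : LaxMorphism Y Z) :
    LaxMorphism X Z where
  F := F.F ≫ G.F
  law := compLaw F.law G.law
  isLaxLaw := isLaxLaw_comp F.isLaxLaw G.isLaxLaw

/-- A strict tangent 1-morphism: a 1-morphism `F` with `F ∘ T = T' ∘ F`, for which the identity
2-morphism is a lax distributive law. -/
@[ext]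
structure StrictMorphism (X Y : Tangentad K) where
  F : X.X ⟶ Y.X
  eq : X.T ≫ F = F ≫ Y.T
  isLaxLaw : IsLaxLaw X Y F (eqToHom eq)

/-- A strict tangent 1-morphism as a lax one. -/
@[simps]
def StrictMorphism.toLax {X Y : Tangentad K} (F : StrictMorphism X Y) : LaxMorphism X Y where
  F := F.F
  law := eqToHom F.eq
  isLaxLaw := F.isLaxLaw

/-- The category `Tng₌(K)` of tangentads and strict tangent 1-morphisms. -/
instance instCategoryTangentad [Bicategory.Strict K] : Category (Tangentad K) where
  Hom X Y := StrictMorphism X Y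
  id X := ⟨𝟙 X.X, by rw [Bicategory.Strict.comp_id, Bicategory.Strict.id_comp], by
    have h := isLaxLaw_id X
    simpa only [Bicategory.Strict.leftUnitor_eqToIso, Bicategory.Strict.rightUnitor_eqToIso,
      eqToIso.hom, eqToIso.inv, eqToHom_trans] using h⟩
  comp {X Y Z} F G := ⟨F.F ≫ G.F, by
    rw [← Bicategory.Strict.assoc, F.eq, Bicategory.Strict.assoc, G.eq,
      Bicategory.Strict.assoc], by
    have h := isLaxLaw_comp F.isLaxLaw G.isLaxLaw
    simpa only [compLaw, Bicategory.Strict.associator_eqToIso, eqToHom_whiskerRight,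
      whiskerLeft_eqToHom, eqToIso.hom, eqToIso.inv, eqToHom_trans] using h⟩
  id_comp F := StrictMorphism.ext (Bicategory.Strict.id_comp F.F)
  comp_id F := StrictMorphism.ext (Bicategory.Strict.comp_id F.F)
  assoc F G H := StrictMorphism.ext (Bicategory.Strict.assoc F.F G.F H.F)

/-! ### Vector fields -/

/-- A vector field in the Hom-tangent category `[X | Y]`: a lax tangent 1-morphism `(F, β)` with a
tangent 2-morphism `u` from `(F, β)` to `(T, c) ∘ (F, β)` which is a section of `p_F`. -/
structure VectorField (X Y : Tangentad K) extends LaxMorphism X Y where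
  u : F ⟶ F ≫ Y.T
  comm : IsTangentTwoMorphism law (compLaw law Y.c) u
  sec : u ≫ F ◁ Y.p ≫ (ρ_ F).hom = 𝟙 F

/-- A morphism of vector fields: a tangent 2-morphism `φ` with `u' ∘ φ = T φ ∘ u`. -/
@[ext]
structure VectorFieldHom {X Y : Tangentad K} (V W : VectorField X Y) extends
    TangentTwoMorphism V.toLaxMorphism W.toLaxMorphism where
  related : V.u ≫ φ ▷ Y.T = φ ≫ W.u

/-- The category `VF [X | Y]` of vector fields in the Hom-tangent category `[X | Y]`. -/
instance instCategoryVectorField (X Y : Tangentad K) : Category (VectorField X Y) where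
  Hom V W := VectorFieldHom V W
  id V :=
    { toTangentTwoMorphism := TangentTwoMorphism.id V.toLaxMorphism
      related := by simp }
  comp f g :=
    { toTangentTwoMorphism := f.toTangentTwoMorphism.comp g.toTangentTwoMorphism
      related := by
        rw [TangentTwoMorphism.comp_φ, comp_whiskerRight, reassoc_of% f.related, g.related,
          Category.assoc] }
  id_comp f := VectorFieldHom.ext (Category.id_comp f.φ)
  comp_id f := VectorFieldHom.ext (Category.comp_id f.φ)
  assoc f g h := VectorFieldHom.ext (Category.assoc f.φ g.φ h.φ)

/-- The 2-morphism `u_H : G ∘ H ⟶ T (G ∘ H)` for `u : G ⟶ T G`. -/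
def pullField {X Y Z : K} {G : Y ⟶ Z} {T : Z ⟶ Z} (H : X ⟶ Y) (u : G ⟶ G ≫ T) :
    H ≫ G ⟶ (H ≫ G) ≫ T :=
  H ◁ u ≫ (α_ H G T).inv

/-- The vector field `u_H` on `(G, β) ∘ (H, γ)`, for a vector field `u` on `(G, β)`. -/
def VectorField.pull {X Y Z : Tangentad K} (H : LaxMorphism X Y) (V : VectorField Y Z) :
    VectorField X Z where
  toLaxMorphism := H.comp V.toLaxMorphism
  u := pullField H.F V.u
  comm := by
    have h := V.comm
    simp only [IsTangentTwoMorphism, LaxMorphism.comp, pullField] at h ⊢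
    calc
      _ = 𝟙 _ ⊗≫ H.law ▷ V.F ⊗≫ H.F ◁ (V.law ≫ V.u ▷ Z.T) ⊗≫ 𝟙 _ := by
        simp only [compLaw]
        bicategory
      _ = 𝟙 _ ⊗≫ (H.law ▷ V.F ≫ (H.F ≫ Y.T) ◁ V.u) ⊗≫ H.F ◁ compLaw V.law Z.c ⊗≫ 𝟙 _ := by
        rw [h]
        bicategory
      _ = _ := by
        rw [← whisker_exchange]
        simp only [compLaw]
        bicategory
  sec := by
    have h := V.sec
    simp only [LaxMorphism.comp, pullField]
    calc
      _ = H.F ◁ (V.u ≫ V.F ◁ Z.p ≫ (ρ_ V.F).hom) := by bicategory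
      _ = _ := by rw [h, whiskerLeft_id]

/-- The functor `Γ_V : [X | Y] ⥤ VF [X | Z]` induced by a vector field `V` in `[Y | Z]`. -/
def VectorField.Γ {Y Z : Tangentad K} (V : VectorField Y Z) (X : Tangentad K) :
    LaxMorphism X Y ⥤ VectorField X Z where
  obj H := VectorField.pull H V
  map {H H'} θ := VectorFieldHom.mk
    (TangentTwoMorphism.mk (F := (pull H V).toLaxMorphism) (G := (pull H' V).toLaxMorphism)
      (TangentTwoMorphism.φ θ ▷ V.F) (by
        have h := TangentTwoMorphism.comm θ
        simp only [IsTangentTwoMorphism, pull, LaxMorphism.comp] at h ⊢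
        set φ := TangentTwoMorphism.φ θ
        calc
          _ = 𝟙 _ ⊗≫ H.law ▷ V.F ⊗≫ (H.F ◁ V.law ≫ φ ▷ (V.F ≫ Z.T)) ⊗≫ 𝟙 _ := by
            simp only [compLaw]
            bicategory
          _ = 𝟙 _ ⊗≫ (H.law ≫ φ ▷ Y.T) ▷ V.F ⊗≫ H'.F ◁ V.law ⊗≫ 𝟙 _ := by
            rw [whisker_exchange]
            bicategory
          _ = _ := by
            rw [h]
            simp only [compLaw]
            bicategory))
    (by
      simp only [pull, LaxMorphism.comp, pullField]
      set φ := TangentTwoMorphism.φ θ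
      calc
        _ = (H.F ◁ V.u ≫ φ ▷ (V.F ≫ Z.T)) ⊗≫ 𝟙 _ := by bicategory
        _ = _ := by
          rw [whisker_exchange]
          bicategory)
  map_id H := VectorFieldHom.ext (id_whiskerRight H.F V.F)
  map_comp θ θ' := VectorFieldHom.ext
    (comp_whiskerRight (TangentTwoMorphism.φ θ) (TangentTwoMorphism.φ θ') V.F)

/-- A tangentad of vector fields of `Y`: a tangentad `VF`, a strict tangent morphism
`U : VF ⟶ Y` and a vector field `v` on `U` in `[VF | Y]` which is universal, i.e. for each tangentad
`X` the functor `Γ_v : [X | VF] ⥤ VF [X | Y]` is an isomorphism of categories. -/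
structure VectorFieldObject (Y : Tangentad K) where
  VF : Tangentad K
  U : StrictMorphism VF Y
  v : U.F ⟶ U.F ≫ Y.T
  comm : IsTangentTwoMorphism U.toLax.law (compLaw U.toLax.law Y.c) v
  sec : v ≫ U.F ◁ Y.p ≫ (ρ_ U.F).hom = 𝟙 U.F
  universal : ∀ X : Tangentad K, ∃ Λ : VectorField X Y ⥤ LaxMorphism X VF,
    (VectorField.Γ ⟨U.toLax, v, comm, sec⟩ X) ⋙ Λ = 𝟭 _ ∧
      Λ ⋙ (VectorField.Γ ⟨U.toLax, v, comm, sec⟩ X) = 𝟭 _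

/-- The vector field `v_H` on `G = U ∘ H` that corresponds to a 1-morphism `H` into the tangentad
of vector fields. -/
def VectorFieldObject.fieldOf {Y : Tangentad K} (V : VectorFieldObject Y) {A : K} {H : A ⟶ V.VF.X}
    {G : A ⟶ Y.X} (h : H ≫ V.U.F = G) : G ⟶ G ≫ Y.T :=
  eqToHom h.symm ≫ pullField H V.v ≫ eqToHom h ▷ Y.T

variable (K) in
/-- `K` admits the construction of vector fields. -/
def AdmitsVectorFields : Prop :=
  ∀ Y : Tangentad K, Nonempty (VectorFieldObject Y)

/-- `P`, with the projections `π i : P ⟶ E`, is the `n`-fold 2-pullback in `K` of `q : E ⟶ B` along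
itself (used for `0 < n` only). -/
structure IsTwoFibrePower {E B : K} (q : E ⟶ B) {n : ℕ} {P : K} (π : Fin n → (P ⟶ E)) :
    Prop where
  comm : ∀ i j, π i ≫ q = π j ≫ q
  existsUnique_lift : ∀ {A : K} (f : Fin n → (A ⟶ E)), (∀ i j, f i ≫ q = f j ≫ q) →
    ∃! h : A ⟶ P, ∀ i, h ≫ π i = f i
  /-- for 2-morphisms `θ i` whose whiskerings with `q` agree (up to the equalities `comm`) -/
  existsUnique_lift₂ : ∀ {A : K} (h h' : A ⟶ P) (θ : ∀ i, h ≫ π i ⟶ h' ≫ π i),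
    (∀ i j, (α_ h (π i) q).inv ≫ θ i ▷ q ≫ (α_ h' (π i) q).hom ≫ h' ◁ eqToHom (comm i j) =
      h ◁ eqToHom (comm i j) ≫ (α_ h (π j) q).inv ≫ θ j ▷ q ≫ (α_ h' (π j) q).hom) →
    ∃! Θ : h ⟶ h', ∀ i, Θ ▷ π i = θ i

variable (K) in
/-- All `n`-fold 2-pullbacks (`n ≥ 1`) of `U : VF(Y) ⟶ Y` along itself exist in `K`. -/
def AdmitsVectorFieldPowers : Prop :=
  ∀ (Y : Tangentad K) (V : VectorFieldObject Y) (n : ℕ), 0 < n →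
    ∃ (P : K) (π : Fin n → (P ⟶ V.VF.X)), IsTwoFibrePower V.U.F π

namespace VectorFieldObject

variable {Y : Tangentad K} (V : VectorFieldObject Y)

/-- `H : Y ⟶ VF(Y)` corresponds to the vector field `z` on the identity of `Y`. -/
def RepresentsZero (H : StrictMorphism Y V.VF) : Prop :=
  ∃ h : H.F ≫ V.U.F = 𝟙 Y.X, V.fieldOf h = Y.bundle.zero ≫ (λ_ Y.T).inv

/-- For `π₁ π₂ : P ⟶ VF(Y)` with `U ∘ π₁ = U ∘ π₂`, the morphism `H : P ⟶ VF(Y)` corresponds to the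
sum `v₁ + v₂` of the vector fields `v₁ v₂` corresponding to `π₁` and `π₂`. -/
def RepresentsSum {P : Tangentad K} (π₁ π₂ H : StrictMorphism P V.VF) : Prop :=
  ∃ (h₂ : π₂.F ≫ V.U.F = π₁.F ≫ V.U.F) (h : H.F ≫ V.U.F = π₁.F ≫ V.U.F),
    (Y.bundle.pre (π₁.F ≫ V.U.F)).IsSum (V.fieldOf rfl) (V.fieldOf h₂) (V.fieldOf h)

/-- `H : VF(Y) ⟶ VF(Y)` corresponds to the vector field `-v = n ∘ v` on `U`. -/
def RepresentsNeg (n : Y.T ⟶ Y.T) (H : StrictMorphism V.VF V.VF) : Prop :=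
  ∃ h : H.F ≫ V.U.F = V.U.F, V.fieldOf h = V.v ≫ V.U.F ◁ n

end VectorFieldObject

end Tangentads

open Tangentads

/-! The engine is the universal property of `v`, used as an isomorphism of categories. On
2-morphisms it says that a tangent 2-morphism between lax morphisms into the tangentad of vector
fields is determined by its whiskering with `U`, and that every tangent 2-morphism downstairs that
respects the fields lifts. On objects it gives honest equalities, which strict tangent morphisms
require. The lax endomorphism `(T, c)` upstairs represents the image of `v` under `(T, c)`
downstairs (`obj_tangentLax`), because `v` is a tangent 2-morphism and the flip is an involution.
Hence tangent 2-morphisms between lax endomorphisms of the base lift along `U` (`exists_isOver`).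

Negatives: inverses in the group bundle `𝐩_T` are unique and the flip is additive, so `n` is a
tangent 2-morphism (`isTangentTwoMorphism_negation`). It therefore lifts, and the equation of a
negation holds upstairs because its two sides are tangent 2-morphisms with the same image under `U`.

The 2-pullback: the tangent structure should be lifted componentwise from the factors, but this
needs `U` to carry the fibre powers `T_n` upstairs to those downstairs on the nose, whereas
strictness of `U` only supplies a comparison 2-morphism. The remedy is
`exists_isPointwisePower_isOver`. The fibre power `T_n` of the base is a lax endomorphism, so it
maps `v` to a vector field; the 1-morphism representing this field lies strictly over `T_n` and
turns out to be a fibre power of the projection upstairs. After replacing the chosen `T_2` upstairs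
by this one, which gives an isomorphic tangentad, every operation and axiom lifts to the 2-pullback,
since equations, sums and limits there are tested on the projections and over the base
(`exists_isFibrePower_tangentad`).

The operations: a lax morphism into the tangentad of vector fields is strict once its composite with
`U` is, because its law is itself a tangent 2-morphism (`exists_law_eq_eqToHom`). So zero, sums and
negatives of vector fields are represented by strict morphisms. Sums of strict morphisms correspond
to sums of the fields they represent (`isSum_iff`), and the group laws reduce to those of `𝐩`
whiskered with a 1-morphism. -/

namespace Tangentads

attribute [-instance] CategoryTheory.StrictBicategory.category

section

/-! ### Fibre powers and sums of generalized elements -/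

section Category

variable {C : Type u} [Category.{v} C]

namespace IsFibrePower

variable {E B : C} {q : E ⟶ B} {n : ℕ} {P P' : C} {π : Fin n → (P ⟶ E)} {π' : Fin n → (P' ⟶ E)}

theorem hom_ext (h : IsFibrePower q π) {A : C} {f g : A ⟶ P}
    (hfg : ∀ i, f ≫ π i = g ≫ π i) : f = g := by
  obtain ⟨_, _, hu⟩ := h.existsUnique_lift (fun i => g ≫ π i)
    (fun i j => by simp only [Category.assoc, h.comm i j])
  exact (hu f hfg).trans (hu g fun _ => rfl).symm

theorem exists_lift (h : IsFibrePower q π) {A : C} (f : Fin n → (A ⟶ E))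
    (hf : ∀ i j, f i ≫ q = f j ≫ q) : ∃ m : A ⟶ P, ∀ i, m ≫ π i = f i :=
  (h.existsUnique_lift f hf).exists

theorem of_iso (h : IsFibrePower q π) (e : P' ≅ P) (he : ∀ i, e.hom ≫ π i = π' i) :
    IsFibrePower q π' where
  comm i j := by simp only [← he, Category.assoc, h.comm i j]
  existsUnique_lift f hf := by
    obtain ⟨m, hm⟩ := h.exists_lift f hf
    refine ⟨m ≫ e.inv, fun i => by simp [← he, hm], fun k hk => ?_⟩
    rw [Iso.eq_comp_inv]
    refine h.hom_ext fun i => ?_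
    rw [Category.assoc, he, hk, hm]

theorem exists_iso (h : IsFibrePower q π) (h' : IsFibrePower q π') :
    ∃ e : P' ≅ P, ∀ i, e.hom ≫ π i = π' i := by
  obtain ⟨m, hm⟩ := h.exists_lift π' h'.comm
  obtain ⟨k, hk⟩ := h'.exists_lift π h.comm
  exact ⟨⟨m, k, h'.hom_ext fun i => by rw [Category.assoc, hk, hm, Category.id_comp],
    h.hom_ext fun i => by rw [Category.assoc, hm, hk, Category.id_comp]⟩, hm⟩

/-- In a strict 2-category composites such as `F ≫ 𝟙 _` and `F` are equal without being
definitionally so; this transports fibre powers along such equalities. -/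
theorem of_heq {E' B' : C} {q' : E' ⟶ B'} {π' : Fin n → (P' ⟶ E')} (h : IsFibrePower q π)
    (hE : E = E') (hB : B = B') (hP : P = P') (hq : q ≍ q') (hπ : ∀ i, π i ≍ π' i) :
    IsFibrePower q' π' := by
  subst hE hB hP
  obtain rfl := eq_of_heq hq
  obtain rfl : π = π' := funext fun i => eq_of_heq (hπ i)
  exact h

end IsFibrePower

namespace BundleData

variable {E B : C} {q : E ⟶ B} {b : BundleData q}

theorem exists_pair (hb : IsFibrePower q b.proj) {A : C} (x y : A ⟶ E) (h : x ≫ q = y ≫ q) :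
    ∃ m : A ⟶ b.pow2, m ≫ b.proj 0 = x ∧ m ≫ b.proj 1 = y := by
  obtain ⟨m, hm⟩ := hb.exists_lift ![x, y] (by
    intro i j
    fin_cases i <;> fin_cases j <;> simp [h])
  exact ⟨m, hm 0, hm 1⟩

theorem hom_ext_pair (hb : IsFibrePower q b.proj) {A : C} {f g : A ⟶ b.pow2}
    (h₀ : f ≫ b.proj 0 = g ≫ b.proj 0) (h₁ : f ≫ b.proj 1 = g ≫ b.proj 1) : f = g :=
  hb.hom_ext fun i => by
    fin_cases i
    exacts [h₀, h₁]

theorem exists_isSum (hb : IsFibrePower q b.proj) {A : C} (x y : A ⟶ E) (h : x ≫ q = y ≫ q) :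
    ∃ r, b.IsSum x y r := by
  obtain ⟨m, h₀, h₁⟩ := exists_pair hb x y h
  exact ⟨m ≫ b.add, m, h₀, h₁, rfl⟩

theorem isSum_proj (b : BundleData q) : b.IsSum (b.proj 0) (b.proj 1) b.add :=
  ⟨𝟙 _, by simp, by simp, by simp⟩

theorem IsSum.unique (hb : IsFibrePower q b.proj) {A : C} {x y r r' : A ⟶ E}
    (h : b.IsSum x y r) (h' : b.IsSum x y r') : r = r' := by
  obtain ⟨m, h₀, h₁, rfl⟩ := h
  obtain ⟨m', h₀', h₁', rfl⟩ := h'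
  rw [hom_ext_pair hb (h₀.trans h₀'.symm) (h₁.trans h₁'.symm)]

theorem IsSum.comp {A A' : C} {x y r : A ⟶ E} (h : b.IsSum x y r) (f : A' ⟶ A) :
    b.IsSum (f ≫ x) (f ≫ y) (f ≫ r) := by
  obtain ⟨m, h₀, h₁, h₂⟩ := h
  exact ⟨f ≫ m, by simp [h₀], by simp [h₁], by simp [h₂]⟩

theorem IsSum.proj_eq (hb : IsFibrePower q b.proj) {A : C} {x y r : A ⟶ E}
    (h : b.IsSum x y r) : x ≫ q = y ≫ q := by
  obtain ⟨m, rfl, rfl, -⟩ := h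
  simp only [Category.assoc, hb.comm 0 1]

theorem IsSum.proj_add (hb : b.add ≫ q = b.proj 0 ≫ q) {A : C} {x y r : A ⟶ E}
    (h : b.IsSum x y r) : r ≫ q = x ≫ q := by
  obtain ⟨m, rfl, rfl, rfl⟩ := h
  simp only [Category.assoc, hb]

theorem IsAdditiveMorphism.isSum {E' B' : C} {q' : E' ⟶ B'} {b' : BundleData q'} {f : B ⟶ B'}
    {g : E ⟶ E'} (hg : b.IsAdditiveMorphism b' f g) {A : C} {x y r : A ⟶ E}
    (h : b.IsSum x y r) : b'.IsSum (x ≫ g) (y ≫ g) (r ≫ g) := by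
  obtain ⟨k, hk, hk'⟩ := hg.add
  obtain ⟨m, rfl, rfl, rfl⟩ := h
  exact ⟨m ≫ k, by simp [hk], by simp [hk], by simp [hk']⟩

/-- The two projections are the universal pair of summands, so preservation of sums need only be
tested on them. All later additivity proofs pass through this reduction. -/
theorem IsAdditiveMorphism.of_isSum {E' B' : C} {q' : E' ⟶ B'} {b' : BundleData q'} {f : B ⟶ B'}
    {g : E ⟶ E'} (hp : g ≫ q' = q ≫ f) (hz : b.zero ≫ g = f ≫ b'.zero)
    (h : b'.IsSum (b.proj 0 ≫ g) (b.proj 1 ≫ g) (b.add ≫ g)) :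
    b.IsAdditiveMorphism b' f g := by
  obtain ⟨m, h₀, h₁, h₂⟩ := h
  refine ⟨hp, hz, m, fun i => ?_, h₂⟩
  fin_cases i
  exacts [h₀, h₁]

end BundleData

end Category

/-! ### Whiskering in strict bicategories, up to heterogeneous equality -/

variable {K : Type u} [Bicategory.{w, v} K]

theorem whiskerRight_heq {X Y Z : K} {S S' T T' : X ⟶ Y} {F F' : Y ⟶ Z} {σ : S ⟶ T}
    {σ' : S' ⟶ T'} (hS : S = S') (hT : T = T') (hF : F = F') (h : σ ≍ σ') :
    σ ▷ F ≍ σ' ▷ F' := by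
  subst hS hT hF
  rw [eq_of_heq h]

theorem whiskerLeft_heq {X Y Z : K} {S S' T T' : Y ⟶ Z} {F F' : X ⟶ Y} {σ : S ⟶ T}
    {σ' : S' ⟶ T'} (hS : S = S') (hT : T = T') (hF : F = F') (h : σ ≍ σ') :
    F ◁ σ ≍ F' ◁ σ' := by
  subst hS hT hF
  rw [eq_of_heq h]

namespace BundleData

variable {X Y Z : K} {E B : X ⟶ Y} {q : E ⟶ B} {b : BundleData q}

theorem IsSum.pre {A x y r} (h : b.IsSum (A := A) x y r) (F : Z ⟶ X) :
    (b.pre F).IsSum (F ◁ x) (F ◁ y) (F ◁ r) := by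
  obtain ⟨m, rfl, rfl, rfl⟩ := h
  exact ⟨F ◁ m, (whiskerLeft_comp ..).symm, (whiskerLeft_comp ..).symm,
    (whiskerLeft_comp ..).symm⟩

theorem IsSum.post {A x y r} (h : b.IsSum (A := A) x y r) (G : Y ⟶ Z) :
    (b.post G).IsSum (x ▷ G) (y ▷ G) (r ▷ G) := by
  obtain ⟨m, rfl, rfl, rfl⟩ := h
  exact ⟨m ▷ G, (comp_whiskerRight ..).symm, (comp_whiskerRight ..).symm,
    (comp_whiskerRight ..).symm⟩

theorem isNegation_isSum_pre {b : BundleData q} {n : E ⟶ E} (hn : b.IsNegation n) (F : Z ⟶ X)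
    {A : Z ⟶ Y} (x : A ⟶ F ≫ E) :
    (b.pre F).IsSum (x ≫ F ◁ n) x (x ≫ F ◁ q ≫ F ◁ b.zero) := by
  have h := (IsSum.pre hn F).comp x
  simpa using h

end BundleData

/-- `σ'` is the image of `σ` along `F` and `G`: the squares `S ≫ G = F ≫ S'` and `T ≫ G = F ≫ T'`
commute strictly, and `G σ = σ'_F`. -/
structure IsOver {X X' Y Y' : K} (F : X ⟶ Y) (G : X' ⟶ Y') {S T : X ⟶ X'} {S' T' : Y ⟶ Y'}
    (σ : S ⟶ T) (σ' : S' ⟶ T') : Prop where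
  src : S ≫ G = F ≫ S'
  tgt : T ≫ G = F ≫ T'
  heq : σ ▷ G ≍ F ◁ σ'

/-! ### Calculus of strictly commuting squares of 2-morphisms -/

namespace IsOver

variable {X X' Y Y' : K} {F : X ⟶ Y} {G : X' ⟶ Y'}
  {S T R : X ⟶ X'} {S' T' R' : Y ⟶ Y'} {σ : S ⟶ T} {σ' : S' ⟶ T'}

theorem eq (h : IsOver F G σ σ') :
    σ ▷ G = eqToHom h.src ≫ F ◁ σ' ≫ eqToHom h.tgt.symm :=
  (conj_eqToHom_iff_heq _ _ h.src h.tgt).2 h.heq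

theorem eq' (h : IsOver F G σ σ') :
    F ◁ σ' = eqToHom h.src.symm ≫ σ ▷ G ≫ eqToHom h.tgt :=
  (conj_eqToHom_iff_heq' _ _ h.src.symm h.tgt).2 h.heq.symm

theorem of_comm (hS : S ≫ G = F ≫ S') (hT : T ≫ G = F ≫ T')
    (h : eqToHom hS ≫ F ◁ σ' = σ ▷ G ≫ eqToHom hT) : IsOver F G σ σ' := by
  refine ⟨hS, hT, ?_⟩
  rw [← comp_eqToHom_heq_iff _ _ hT, ← h]
  exact eqToHom_comp_heq _ _

theorem comm (h : IsOver F G σ σ') :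
    eqToHom h.src ≫ F ◁ σ' = σ ▷ G ≫ eqToHom h.tgt := by
  rw [h.eq']
  simp

theorem comp (h : IsOver F G σ σ') {τ : T ⟶ R} {τ' : T' ⟶ R'} (h' : IsOver F G τ τ') :
    IsOver F G (σ ≫ τ) (σ' ≫ τ') := by
  refine ⟨h.src, h'.tgt, ?_⟩
  rw [comp_whiskerRight, whiskerLeft_comp]
  exact heq_comp h.src h.tgt h'.tgt h.heq h'.heq

theorem id (hS : S ≫ G = F ≫ S') : IsOver F G (𝟙 S) (𝟙 S') := by
  refine ⟨hS, hS, ?_⟩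
  rw [id_whiskerRight, whiskerLeft_id, hS]

theorem eqToHom (h : S = T) (h' : S' = T') (hS : S ≫ G = F ≫ S') :
    IsOver F G (CategoryTheory.eqToHom h) (CategoryTheory.eqToHom h') := by
  subst h h'
  exact id hS

end IsOver

section Strict

variable [Bicategory.Strict K]

theorem comp_whiskerLeft_heq {W X Y Z : K} (F : W ⟶ X) (G : X ⟶ Y) {S T : Y ⟶ Z} (σ : S ⟶ T) :
    (F ≫ G) ◁ σ ≍ F ◁ G ◁ σ := by
  simp [comp_whiskerLeft, Bicategory.Strict.associator_eqToIso]

theorem whiskerRight_comp_heq {W X Y Z : K} {S T : W ⟶ X} (σ : S ⟶ T) (F : X ⟶ Y) (G : Y ⟶ Z) :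
    σ ▷ (F ≫ G) ≍ σ ▷ F ▷ G := by
  simp [whiskerRight_comp, Bicategory.Strict.associator_eqToIso]

theorem whisker_assoc_heq {W X Y Z : K} (F : W ⟶ X) {S T : X ⟶ Y} (σ : S ⟶ T) (G : Y ⟶ Z) :
    (F ◁ σ) ▷ G ≍ F ◁ (σ ▷ G) := by
  simp [whisker_assoc, Bicategory.Strict.associator_eqToIso]

theorem id_whiskerLeft_heq {X Y : K} {S T : X ⟶ Y} (σ : S ⟶ T) : 𝟙 X ◁ σ ≍ σ := by
  simp [id_whiskerLeft, Bicategory.Strict.leftUnitor_eqToIso]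

theorem whiskerRight_id_heq {X Y : K} {S T : X ⟶ Y} (σ : S ⟶ T) : σ ▷ 𝟙 Y ≍ σ := by
  simp [whiskerRight_id, Bicategory.Strict.rightUnitor_eqToIso]

namespace IsOver

variable {X X' X'' Y Y' Y'' Z Z' : K} {F : X ⟶ Y} {G : X' ⟶ Y'} {H : X'' ⟶ Y''}
  {S T R : X ⟶ X'} {S' T' R' : Y ⟶ Y'} {σ : S ⟶ T} {σ' : S' ⟶ T'}

theorem whiskerLeft (h : IsOver F G σ σ') {A : Z ⟶ X} {A' : Z' ⟶ Y} {D : Z ⟶ Z'}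
    (hA : A ≫ F = D ≫ A') : IsOver D G (A ◁ σ) (A' ◁ σ') := by
  refine ⟨by rw [Bicategory.Strict.assoc, h.src, ← Bicategory.Strict.assoc, hA,
    Bicategory.Strict.assoc], by rw [Bicategory.Strict.assoc, h.tgt, ← Bicategory.Strict.assoc, hA,
    Bicategory.Strict.assoc], ?_⟩
  refine (whisker_assoc_heq _ _ _).trans <|
    (whiskerLeft_heq h.src h.tgt rfl h.heq).trans <|
    (comp_whiskerLeft_heq _ _ _).symm.trans <|
    (whiskerLeft_heq rfl rfl hA HEq.rfl).trans (comp_whiskerLeft_heq _ _ _)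

theorem whiskerRight (h : IsOver F G σ σ') {A : X' ⟶ X''} {A' : Y' ⟶ Y''}
    (hA : A ≫ H = G ≫ A') : IsOver F H (σ ▷ A) (σ' ▷ A') := by
  refine ⟨by rw [Bicategory.Strict.assoc, hA, ← Bicategory.Strict.assoc, h.src,
    Bicategory.Strict.assoc], by rw [Bicategory.Strict.assoc, hA, ← Bicategory.Strict.assoc, h.tgt,
    Bicategory.Strict.assoc], ?_⟩
  refine (whiskerRight_comp_heq _ _ _).symm.trans <|
    (whiskerRight_heq rfl rfl hA HEq.rfl).trans <|
    (whiskerRight_comp_heq _ _ _).trans <|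
    (whiskerRight_heq h.src h.tgt rfl h.heq).trans (whisker_assoc_heq _ _ _)

/-- Vertical pasting. -/
theorem paste (h : IsOver F G σ σ') {F' : Y ⟶ Z} {G' : Y' ⟶ Z'} {S'' T'' : Z ⟶ Z'}
    {σ'' : S'' ⟶ T''} (h' : IsOver F' G' σ' σ'') : IsOver (F ≫ F') (G ≫ G') σ σ'' := by
  refine ⟨by rw [← Bicategory.Strict.assoc, h.src, Bicategory.Strict.assoc, h'.src,
    Bicategory.Strict.assoc], by rw [← Bicategory.Strict.assoc, h.tgt, Bicategory.Strict.assoc,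
    h'.tgt, Bicategory.Strict.assoc], ?_⟩
  refine (whiskerRight_comp_heq _ _ _).trans <|
    (whiskerRight_heq h.src h.tgt rfl h.heq).trans <|
    (whisker_assoc_heq _ _ _).trans <|
    (whiskerLeft_heq h'.src h'.tgt rfl h'.heq).trans (comp_whiskerLeft_heq _ _ _).symm

theorem associator_hom {A : X ⟶ X'} {A' : Y ⟶ Y'} {B : X' ⟶ X''} {B' : Y' ⟶ Y''} {D : X'' ⟶ Z}
    {D' : Y'' ⟶ Z'} {I : Z ⟶ Z'} (hA : A ≫ G = F ≫ A') (hB : B ≫ H = G ≫ B')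
    (hD : D ≫ I = H ≫ D') : IsOver F I (α_ A B D).hom (α_ A' B' D').hom := by
  rw [Bicategory.Strict.associator_eqToIso, Bicategory.Strict.associator_eqToIso]
  refine eqToHom (Bicategory.Strict.assoc ..) (Bicategory.Strict.assoc ..) ?_
  rw [Bicategory.Strict.assoc, hD, Bicategory.Strict.assoc, ← Bicategory.Strict.assoc B, hB,
    Bicategory.Strict.assoc, ← Bicategory.Strict.assoc A, hA]
  simp only [Bicategory.Strict.assoc]

theorem associator_inv {A : X ⟶ X'} {A' : Y ⟶ Y'} {B : X' ⟶ X''} {B' : Y' ⟶ Y''} {D : X'' ⟶ Z}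
    {D' : Y'' ⟶ Z'} {I : Z ⟶ Z'} (hA : A ≫ G = F ≫ A') (hB : B ≫ H = G ≫ B')
    (hD : D ≫ I = H ≫ D') : IsOver F I (α_ A B D).inv (α_ A' B' D').inv := by
  rw [Bicategory.Strict.associator_eqToIso, Bicategory.Strict.associator_eqToIso]
  exact eqToHom (Bicategory.Strict.assoc ..).symm (Bicategory.Strict.assoc ..).symm
    (associator_hom hA hB hD).tgt

theorem leftUnitor_hom {A : X ⟶ X'} {A' : Y ⟶ Y'} (hA : A ≫ G = F ≫ A') :
    IsOver F G (λ_ A).hom (λ_ A').hom := by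
  rw [Bicategory.Strict.leftUnitor_eqToIso, Bicategory.Strict.leftUnitor_eqToIso]
  exact eqToHom (Bicategory.Strict.id_comp A) (Bicategory.Strict.id_comp A')
    (by simpa only [Bicategory.Strict.id_comp] using hA)

theorem leftUnitor_inv {A : X ⟶ X'} {A' : Y ⟶ Y'} (hA : A ≫ G = F ≫ A') :
    IsOver F G (λ_ A).inv (λ_ A').inv := by
  rw [Bicategory.Strict.leftUnitor_eqToIso, Bicategory.Strict.leftUnitor_eqToIso]
  exact eqToHom (Bicategory.Strict.id_comp A).symm (Bicategory.Strict.id_comp A').symm hA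

theorem rightUnitor_inv {A : X ⟶ X'} {A' : Y ⟶ Y'} (hA : A ≫ G = F ≫ A') :
    IsOver F G (ρ_ A).inv (ρ_ A').inv := by
  rw [Bicategory.Strict.rightUnitor_eqToIso, Bicategory.Strict.rightUnitor_eqToIso]
  exact eqToHom (Bicategory.Strict.comp_id A).symm (Bicategory.Strict.comp_id A').symm hA

end IsOver

end Strict

end

section

/-! ### Cancellation in abelian group bundles -/

/-- Adding `n ∘ y` on the right recovers `x` as `r + n y`, by associativity, so `x` depends on `y`
and `r` only. -/
theorem BundleData.IsAbelianGroupBundle.cancel {C : Type u} [Category.{v} C] {E B : C} {q : E ⟶ B}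
    {b : BundleData q} {n : E ⟶ E} (hb : b.IsAbelianGroupBundle n) {A : C} {x x' y r : A ⟶ E}
    (h : b.IsSum x y r) (h' : b.IsSum x' y r) : x = x' := by
  have ha := hb.isAdditiveBundle
  have hf := ha.isFibrePower
  have key : ∀ {x : A ⟶ E}, b.IsSum x y r → b.IsSum r (y ≫ n) x := by
    intro x h
    have h₀ := ha.add_comm _ _ _ (hb.isNegation.comp y)
    have h₁ := ha.add_comm _ _ _ (ha.zero_add.comp x)
    rw [Category.comp_id] at h₀ h₁
    rw [reassoc_of% h.proj_eq hf] at h₁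
    obtain ⟨t, ht⟩ := exists_isSum hf r (y ≫ n) (by
      rw [h.proj_add ha.add_proj, h.proj_eq hf, h₀.proj_eq hf])
    obtain rfl := (ha.add_assoc _ _ _ _ _ _ h h₀ ht).unique hf h₁
    exact ht
  have h₁ := ha.add_comm _ _ _ (key h)
  exact (key h).unique hf (key h')

/-! ### Pointwise fibre powers of the projection of a tangentad -/

variable {K : Type u} [Bicategory.{w, v} K]

/-- `N`, with the projections `π i`, is a pointwise `n`-fold pullback of `p` along itself, preserved
by all iterates of the tangent bundle 1-morphism. -/
structure IsPointwisePower {X : K} {T : X ⟶ X} (p : T ⟶ 𝟙 X) {n : ℕ} {N : X ⟶ X}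
    (π : Fin n → (N ⟶ T)) : Prop where
  isFibrePower : ∀ {Y : K} (F : Y ⟶ X) (k : ℕ),
    IsFibrePower ((F ◁ p) ▷ iter T k) (fun i => (F ◁ π i) ▷ iter T k)

/-- Tangent 2-morphisms are compatible with the squares of distributive laws. -/
theorem IsTangentTwoMorphism.sq {X Y : K} {T : X ⟶ X} {T' : Y ⟶ Y} {F G : X ⟶ Y}
    {a : T ≫ F ⟶ F ≫ T'} {b : T ≫ G ⟶ G ≫ T'} {φ : F ⟶ G} (h : IsTangentTwoMorphism a b φ) :
    IsTangentTwoMorphism (sqLaw a) (sqLaw b) φ := by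
  simp only [IsTangentTwoMorphism, sqLaw] at h ⊢
  calc
    _ = 𝟙 _ ⊗≫ T ◁ a ⊗≫ (a ≫ φ ▷ T') ▷ T' ⊗≫ 𝟙 _ := by bicategory
    _ = 𝟙 _ ⊗≫ T ◁ (a ≫ φ ▷ T') ⊗≫ b ▷ T' ⊗≫ 𝟙 _ := by
      nth_rw 1 [h]
      bicategory
    _ = _ := by
      rw [h]
      bicategory

theorem IsTangentTwoMorphism.comp {X Y : K} {T : X ⟶ X} {T' : Y ⟶ Y} {F G H : X ⟶ Y}
    {a : T ≫ F ⟶ F ≫ T'} {b : T ≫ G ⟶ G ≫ T'} {d : T ≫ H ⟶ H ≫ T'} {φ : F ⟶ G} {ψ : G ⟶ H}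
    (h : IsTangentTwoMorphism a b φ) (h' : IsTangentTwoMorphism b d ψ) :
    IsTangentTwoMorphism a d (φ ≫ ψ) := by
  simp only [IsTangentTwoMorphism] at *
  rw [comp_whiskerRight, reassoc_of% h, h', whiskerLeft_comp, Category.assoc]

/-- The tangent bundle 1-morphism, with the canonical flip as a lax distributive law. -/
def Tangentad.tangentLax (X : Tangentad K) : LaxMorphism X X where
  F := X.T
  law := X.c
  isLaxLaw :=
    { additive := X.flip_additive
      lift := by
        have h := X.lift_flip_flip
        have hc := X.flip_flip
        -- The axiom for `l` and `c` solved for `T l` by means of `c² = id`; the trailing flips then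
        -- cancel against those in `sqLaw`.
        have h2 : X.l ▷ X.T ≫ (α_ X.T X.T X.T).hom =
            X.c ≫ X.T ◁ X.l ≫ (α_ X.T X.T X.T).inv ≫ X.c ▷ X.T ≫ (α_ X.T X.T X.T).hom ≫
              X.T ◁ X.c := by
          rw [h, reassoc_of% hc]
        have hc' : X.T ◁ X.c ≫ X.T ◁ X.c = 𝟙 _ := by
          rw [← whiskerLeft_comp, hc, whiskerLeft_id]
        have hc'' : X.c ▷ X.T ≫ X.c ▷ X.T = 𝟙 _ := by
          rw [← comp_whiskerRight, hc, id_whiskerRight]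
        simp only [sqLaw]
        rw [reassoc_of% h2, reassoc_of% hc', Iso.hom_inv_id_assoc, reassoc_of% hc'',
          Iso.inv_hom_id, Category.comp_id]
      flip := by
        have h := congrArg (· ≫ (α_ X.T X.T X.T).hom) X.flip_braid
        simpa [sqLaw] using h }

namespace IsPointwisePower

variable {X : K} {T : X ⟶ X} {p : T ⟶ 𝟙 X} {n : ℕ} {N N' : X ⟶ X} {π : Fin n → (N ⟶ T)}
  {π' : Fin n → (N' ⟶ T)}

theorem of_iso (h : IsPointwisePower p π) (e : N' ≅ N) (he : ∀ i, e.hom ≫ π i = π' i) :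
    IsPointwisePower p π' where
  isFibrePower F k := (h.isFibrePower F k).of_iso (whiskerRightIso (whiskerLeftIso F e) _)
    fun i => by simp [← he]

end IsPointwisePower

theorem Tangentad.exists_pointwisePower (X : Tangentad K) (n : ℕ) (hn : 0 < n) :
    ∃ (N : X.X ⟶ X.X) (π : Fin n → (N ⟶ X.T)), IsPointwisePower X.p π := by
  obtain ⟨N, π, h⟩ := X.exists_fibrePower n hn
  exact ⟨N, π, ⟨h⟩⟩

theorem BundleData.IsSum.pre_whisker {X Y Z : K} {E B : X ⟶ Y} {q : E ⟶ B} {b : BundleData q}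
    {M N : Z ⟶ X} {A : Z ⟶ Y} {x y r : A ⟶ N ≫ E} (h : (b.pre N).IsSum x y r) (σ : N ⟶ M) :
    (b.pre M).IsSum (x ≫ σ ▷ E) (y ≫ σ ▷ E) (r ≫ σ ▷ E) := by
  obtain ⟨m, rfl, rfl, rfl⟩ := h
  have key (m : A ⟶ N ≫ b.pow2) (τ : b.pow2 ⟶ E) :
      (m ≫ σ ▷ b.pow2) ≫ M ◁ τ = (m ≫ N ◁ τ) ≫ σ ▷ E := by
    rw [Category.assoc, Category.assoc, whisker_exchange]
  exact ⟨(m : A ⟶ N ≫ b.pow2) ≫ σ ▷ b.pow2, key m _, key m _, key m _⟩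

section Strict

variable [Bicategory.Strict K]

namespace IsPointwisePower

variable {X : K} {T : X ⟶ X} {p : T ⟶ 𝟙 X} {n : ℕ} {N : X ⟶ X} {π : Fin n → (N ⟶ T)}

/-- This and the next lemmas are the cases `k = 0, 1, 2` of preservation by `iter T k`, with the
superfluous identities removed. -/
theorem pre (h : IsPointwisePower p π) {Y : K} (F : Y ⟶ X) :
    IsFibrePower (F ◁ p) (fun i => F ◁ π i) :=
  (h.isFibrePower F 0).of_heq (Bicategory.Strict.comp_id _) (Bicategory.Strict.comp_id _)
    (Bicategory.Strict.comp_id _) (whiskerRight_id_heq _) fun _ => whiskerRight_id_heq _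

theorem base (h : IsPointwisePower p π) : IsFibrePower p π :=
  (h.pre (𝟙 X)).of_heq (Bicategory.Strict.id_comp _) (Bicategory.Strict.id_comp _)
    (Bicategory.Strict.id_comp _) (id_whiskerLeft_heq _) fun _ => id_whiskerLeft_heq _

theorem post (h : IsPointwisePower p π) {Y : K} (F : Y ⟶ X) :
    IsFibrePower ((F ◁ p) ▷ T) (fun i => (F ◁ π i) ▷ T) := by
  have e : iter T 1 = T := Bicategory.Strict.id_comp _
  exact (h.isFibrePower F 1).of_heq (by rw [e]) (by rw [e]) (by rw [e])
    (whiskerRight_heq rfl rfl e HEq.rfl)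
    fun _ => whiskerRight_heq rfl rfl e HEq.rfl

theorem postT (h : IsPointwisePower p π) :
    IsFibrePower (p ▷ T) (fun i => π i ▷ T) :=
  (h.post (𝟙 X)).of_heq (by rw [Bicategory.Strict.id_comp]) (by rw [Bicategory.Strict.id_comp])
    (by rw [Bicategory.Strict.id_comp])
    (whiskerRight_heq (Bicategory.Strict.id_comp _) (Bicategory.Strict.id_comp _) rfl
      (id_whiskerLeft_heq _))
    fun _ => whiskerRight_heq (Bicategory.Strict.id_comp _) (Bicategory.Strict.id_comp _) rfl
      (id_whiskerLeft_heq _)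

theorem postTT (h : IsPointwisePower p π) :
    IsFibrePower (p ▷ (T ≫ T)) (fun i => π i ▷ (T ≫ T)) := by
  have e : iter T 2 = T ≫ T := congrArg (· ≫ T) (Bicategory.Strict.id_comp T)
  exact (h.isFibrePower (𝟙 X) 2).of_heq (by rw [e, Bicategory.Strict.id_comp])
    (by rw [e, Bicategory.Strict.id_comp]) (by rw [e, Bicategory.Strict.id_comp])
    (whiskerRight_heq (Bicategory.Strict.id_comp _) (Bicategory.Strict.id_comp _) e
      (id_whiskerLeft_heq _))
    fun _ => whiskerRight_heq (Bicategory.Strict.id_comp _) (Bicategory.Strict.id_comp _) e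
      (id_whiskerLeft_heq _)

end IsPointwisePower

/-! ### Pointwise additivity, the flip and negation in one tangentad -/

namespace Tangentad

variable (X : Tangentad K)

/-- A tangentad is only required to have some pointwise fibre power. Fibre powers are unique up to
isomorphism, so every one of them is pointwise, in particular the chosen `bundle.pow2`. -/
theorem isPointwisePower_of_isFibrePower {n : ℕ} (hn : 0 < n) {N : X.X ⟶ X.X}
    {π : Fin n → (N ⟶ X.T)} (h : IsFibrePower X.p π) : IsPointwisePower X.p π := by
  obtain ⟨M, ν, hν⟩ := X.exists_pointwisePower n hn
  obtain ⟨e, he⟩ := hν.base.exists_iso h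
  exact hν.of_iso e he

theorem isPointwisePower_proj : IsPointwisePower X.p X.bundle.proj :=
  X.isPointwisePower_of_isFibrePower two_pos X.isAdditiveBundle.isFibrePower

theorem isAdditiveBundle_pre {Y : K} (F : Y ⟶ X.X) :
    (X.bundle.pre F).IsAdditiveBundle where
  exists_fibrePower n hn := by
    obtain ⟨N, π, h⟩ := X.exists_pointwisePower n hn
    exact ⟨F ≫ N, _, h.pre F⟩
  isFibrePower := X.isPointwisePower_proj.pre F
  zero_proj := by
    have h := congrArg (F ◁ ·) X.isAdditiveBundle.zero_proj
    simpa [BundleData.pre] using h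
  add_proj := by
    have h := congrArg (F ◁ ·) X.isAdditiveBundle.add_proj
    simpa [BundleData.pre] using h
  add_assoc x y t xy yt r hxy hyt hr := by
    have hp := X.isPointwisePower_proj.pre F
    have hb := X.isAdditiveBundle
    -- Elements of `F ≫ T` need not be whiskered from `X`. Associativity is therefore applied to the
    -- universal triple on `T_3`, then whiskered with `F` and pulled back along the tuple `g = ⟨x,
    -- y, t⟩`.
    obtain ⟨N, π, h⟩ := X.exists_pointwisePower 3 (by decide)
    have hxy' := hxy.proj_eq hp
    have hyt' := hyt.proj_eq hp
    obtain ⟨g, hg⟩ := (h.pre F).exists_lift ![x, y, t] (by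
      intro i j
      fin_cases i <;> fin_cases j <;> simp [hxy', hyt'])
    obtain rfl : g ≫ F ◁ π 0 = x := hg 0
    obtain rfl : g ≫ F ◁ π 1 = y := hg 1
    obtain rfl : g ≫ F ◁ π 2 = t := hg 2
    obtain ⟨a, ha⟩ := BundleData.exists_isSum hb.isFibrePower (π 0) (π 1) (h.base.comm 0 1)
    obtain ⟨b, hb'⟩ := BundleData.exists_isSum hb.isFibrePower (π 1) (π 2) (h.base.comm 1 2)
    obtain ⟨s, hs⟩ := BundleData.exists_isSum hb.isFibrePower a (π 2) (by
      rw [ha.proj_add hb.add_proj, h.base.comm 0 2])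
    obtain rfl := ((ha.pre F).comp g).unique hp hxy
    obtain rfl := ((hb'.pre F).comp g).unique hp hyt
    obtain rfl := ((hs.pre F).comp g).unique hp hr
    exact ((hb.add_assoc _ _ _ _ _ _ ha hb' hs).pre F).comp g
  zero_add := by
    have h := X.isAdditiveBundle.zero_add.pre F
    simpa [BundleData.pre] using h
  add_comm x y r h := by
    obtain ⟨m, rfl, rfl, rfl⟩ := h
    exact ((X.isAdditiveBundle.add_comm _ _ _ X.bundle.isSum_proj).pre F).comp m

theorem isAbelianGroupBundle_pre {n : X.T ⟶ X.T} (hn : X.IsNegation n) {Y : K} (F : Y ⟶ X.X) :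
    (X.bundle.pre F).IsAbelianGroupBundle (F ◁ n) where
  isAdditiveBundle := X.isAdditiveBundle_pre F
  isNegation := by
    have h := BundleData.IsSum.pre hn F
    simpa [BundleData.pre, BundleData.IsNegation] using h

/-- As the canonical flip is an involution, it is additive in both directions. -/
theorem flip_additive_symm : (X.bundle.pre X.T).IsAdditiveMorphism (X.bundle.post X.T)
    ((ρ_ X.T).hom ≫ (λ_ X.T).inv) X.c := by
  have hc := X.flip_flip
  have h₁ := X.flip_additive.proj
  have h₀ := X.flip_additive.zero
  simp only [BundleData.pre, BundleData.post] at h₁ h₀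
  refine .of_isSum ?_ ?_ ?_
  · rw [← cancel_mono ((λ_ X.T).hom ≫ (ρ_ X.T).inv), Category.assoc, ← h₁, reassoc_of% hc]
    simp
  · have h₂ := congrArg (fun t => (ρ_ X.T).hom ≫ (λ_ X.T).inv ≫ t ≫ X.c) h₀
    simp only [Category.assoc, Iso.inv_hom_id_assoc, Iso.hom_inv_id_assoc] at h₂
    rw [hc, Category.comp_id] at h₂
    simpa [BundleData.pre, BundleData.post] using h₂.symm
  · have hp := X.isPointwisePower_proj
    have h₃ := (X.bundle.isSum_proj.pre X.T)
    have h₄ := h₃.proj_eq (hp.pre X.T)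
    -- The sum is formed in `T 𝐩` first. Applying the additive `c` turns it into the universal sum
    -- of `𝐩_T`, which identifies `r` because `c` is an involution.
    obtain ⟨r, hr⟩ := BundleData.exists_isSum (b := X.bundle.post X.T) hp.postT
      (X.T ◁ X.bundle.proj 0 ≫ X.c) (X.T ◁ X.bundle.proj 1 ≫ X.c) (by
        rw [← cancel_mono ((λ_ X.T).hom ≫ (ρ_ X.T).inv)]
        simp only [Category.assoc]
        rw [← h₁, reassoc_of% hc, h₄])
    have h₅ := X.flip_additive.isSum hr
    simp only [Category.assoc, hc, Category.comp_id] at h₅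
    have h₆ := h₅.unique (hp.pre X.T) h₃
    have h₇ : r = X.T ◁ X.bundle.add ≫ X.c := by
      rw [← h₆, Category.assoc, hc, Category.comp_id]
    exact h₇ ▸ hr

theorem isTangentTwoMorphism_p : IsTangentTwoMorphism X.c ((ρ_ X.T).hom ≫ (λ_ X.T).inv) X.p :=
  X.flip_additive_symm.proj

/-- Both `c ∘ T n` and `n_T ∘ c` are negatives of `c` in the group bundle `𝐩_T`: the first by
additivity of the flip, the second by precomposition. Cancellation makes them equal, and conjugation
with `c` gives the required form. -/
theorem isTangentTwoMorphism_negation {n : X.T ⟶ X.T} (hn : X.IsNegation n) :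
    IsTangentTwoMorphism X.c X.c n := by
  have hc := X.flip_flip
  have h₁ := X.flip_additive.proj
  have h₀ := X.flip_additive.zero
  simp only [BundleData.pre, BundleData.post] at h₁ h₀
  have hx := X.flip_additive.isSum (BundleData.IsSum.post hn X.T)
  have hy := (BundleData.IsSum.pre hn X.T).comp X.c
  simp only [id_whiskerRight, whiskerLeft_id, Category.id_comp, Category.comp_id,
    comp_whiskerRight, whiskerLeft_comp, Category.assoc] at hx hy
  rw [h₀] at hx
  rw [reassoc_of% h₁] at hy
  simp only [Category.assoc] at hx
  have h := (X.isAbelianGroupBundle_pre hn X.T).cancel hx hy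
  rw [IsTangentTwoMorphism]
  have h' := congrArg (fun t => X.c ≫ t ≫ X.c) h
  simpa [hc, reassoc_of% hc] using h'

/-- Pointwise fibre powers of the projection are lax tangent endomorphisms. -/
theorem exists_law_of_isPointwisePower {n : ℕ} {N : X.X ⟶ X.X} {π : Fin n → (N ⟶ X.T)}
    (h : IsPointwisePower X.p π) :
    ∃ M : LaxMorphism X X, ∃ e : M.F = N,
      ∀ i, IsTangentTwoMorphism M.law X.c (eqToHom e ≫ π i) := by
  have h₁ := X.flip_additive.proj
  have h₀ := X.flip_additive.zero
  have h₂ := X.flip_additive_symm.proj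
  simp only [BundleData.pre, BundleData.post] at h₁ h₀ h₂
  -- The law is forced by asking each `π i` to be a tangent 2-morphism; it exists because `T`
  -- preserves the fibre power.
  obtain ⟨a, ha⟩ := h.postT.exists_lift (fun i => X.T ◁ π i ≫ X.c) (fun i j => by
    rw [Category.assoc, Category.assoc, h₂, ← whiskerLeft_comp_assoc, h.base.comm i j,
      whiskerLeft_comp_assoc])
  have hl : IsLaxLaw X X X.T X.c := X.tangentLax.isLaxLaw
  -- Every axiom is tested on the projections, whiskered with `T` or `T²` where needed; there it
  -- becomes the same axiom for `(T, c)`.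
  have hlax : IsLaxLaw X X N a := by
    have hproj : a ≫ N ◁ X.p = X.p ▷ N ≫ (λ_ N).hom ≫ (ρ_ N).inv := by
      rw [← cancel_mono (ρ_ N).hom]
      refine h.base.hom_ext fun i => ?_
      have e₁ : (a ≫ N ◁ X.p ≫ (ρ_ N).hom) ≫ π i =
          (a ≫ π i ▷ X.T) ≫ X.T ◁ X.p ≫ (ρ_ X.T).hom := by
        simp only [Category.assoc, ← rightUnitor_naturality, whisker_exchange_assoc]
      simp only [Category.assoc] at e₁ ⊢
      rw [e₁, reassoc_of% (ha i), reassoc_of% h₁]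
      simp [whisker_exchange_assoc]
    refine ⟨.of_isSum hproj ?_ ?_, ?_, ?_⟩
    · refine h.postT.hom_ext fun i => ?_
      have e₁ : ((X.bundle.post N).zero ≫ a) ≫ π i ▷ X.T =
          𝟙 X.X ◁ π i ≫ X.bundle.zero ▷ X.T ≫ X.c := by
        simp only [BundleData.post, Category.assoc, ha, whisker_exchange_assoc]
      rw [e₁, h₀]
      simp only [BundleData.pre, Category.assoc, whisker_exchange]
      simp
    · have hp := X.isPointwisePower_proj
      obtain ⟨r, hr⟩ := BundleData.exists_isSum (b := X.bundle.pre N) (hp.pre N)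
        (X.bundle.proj 0 ▷ N ≫ a) (X.bundle.proj 1 ▷ N ≫ a) (by
          simp only [Category.assoc, hproj, ← comp_whiskerRight_assoc, hp.base.comm 0 1])
      obtain rfl : r = X.bundle.add ▷ N ≫ a := by
        refine h.postT.hom_ext fun i => ?_
        have h₃ := hr.pre_whisker (π i)
        have h₄ := (X.flip_additive.isSum (X.bundle.isSum_proj.post X.T)).comp
          (X.bundle.pow2 ◁ π i)
        simp only [Category.assoc, ha, ← whisker_exchange_assoc] at h₃ ⊢
        exact h₃.unique (hp.pre X.T) h₄
      exact hr
    · refine h.postTT.hom_ext fun i => ?_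
      have e := (IsTangentTwoMorphism.sq (ha i))
      simp only [IsTangentTwoMorphism] at e
      rw [Category.assoc, e, ← whisker_exchange_assoc, hl.lift,
        Category.assoc, whisker_exchange, reassoc_of% (ha i)]
    · refine h.postTT.hom_ext fun i => ?_
      have e := (IsTangentTwoMorphism.sq (ha i))
      simp only [IsTangentTwoMorphism] at e
      rw [Category.assoc, e, ← whisker_exchange_assoc, hl.flip,
        Category.assoc, whisker_exchange, reassoc_of% e]
  exact ⟨⟨N, a, hlax⟩, rfl, fun i => by
    simpa [IsTangentTwoMorphism] using ha i⟩

end Tangentad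

end Strict

end

section

variable {K : Type u} [Bicategory.{w, v} K]

/-! ### Calculus of tangent 2-morphisms -/

namespace IsTangentTwoMorphism

variable {X Y Z W : K} {T : X ⟶ X} {T' : Y ⟶ Y} {T'' : Z ⟶ Z} {T''' : W ⟶ W}

theorem id {F : X ⟶ Y} (a : T ≫ F ⟶ F ≫ T') : IsTangentTwoMorphism a a (𝟙 F) := by
  simp [IsTangentTwoMorphism]

theorem whiskerRight {F F' : X ⟶ Y} {G : Y ⟶ Z} {a : T ≫ F ⟶ F ≫ T'} {b : T ≫ F' ⟶ F' ≫ T'}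
    {φ : F ⟶ F'} (h : IsTangentTwoMorphism a b φ) (g : T' ≫ G ⟶ G ≫ T'') :
    IsTangentTwoMorphism (compLaw a g) (compLaw b g) (φ ▷ G) := by
  simp only [IsTangentTwoMorphism, compLaw] at h ⊢
  calc
    _ = 𝟙 _ ⊗≫ a ▷ G ⊗≫ (F ◁ g ≫ φ ▷ (G ≫ T'')) ⊗≫ 𝟙 _ := by bicategory
    _ = 𝟙 _ ⊗≫ (a ≫ φ ▷ T') ▷ G ⊗≫ F' ◁ g ⊗≫ 𝟙 _ := by
      rw [whisker_exchange]
      bicategory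
    _ = _ := by
      rw [h]
      bicategory

theorem whiskerLeft {F : X ⟶ Y} {G G' : Y ⟶ Z} {a : T' ≫ G ⟶ G ≫ T''} {b : T' ≫ G' ⟶ G' ≫ T''}
    {φ : G ⟶ G'} (f : T ≫ F ⟶ F ≫ T') (h : IsTangentTwoMorphism a b φ) :
    IsTangentTwoMorphism (compLaw f a) (compLaw f b) (F ◁ φ) := by
  simp only [IsTangentTwoMorphism, compLaw] at h ⊢
  calc
    _ = 𝟙 _ ⊗≫ f ▷ G ⊗≫ F ◁ (a ≫ φ ▷ T'') ⊗≫ 𝟙 _ := by bicategory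
    _ = 𝟙 _ ⊗≫ (f ▷ G ≫ (F ≫ T') ◁ φ) ⊗≫ F ◁ b ⊗≫ 𝟙 _ := by
      rw [h]
      bicategory
    _ = _ := by
      rw [← whisker_exchange]
      bicategory

theorem associator_hom {F : X ⟶ Y} {G : Y ⟶ Z} {H : Z ⟶ W} (f : T ≫ F ⟶ F ≫ T')
    (g : T' ≫ G ⟶ G ≫ T'') (h : T'' ≫ H ⟶ H ≫ T''') :
    IsTangentTwoMorphism (compLaw (compLaw f g) h) (compLaw f (compLaw g h)) (α_ F G H).hom := by
  simp only [IsTangentTwoMorphism, compLaw]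
  bicategory

theorem associator_inv {F : X ⟶ Y} {G : Y ⟶ Z} {H : Z ⟶ W} (f : T ≫ F ⟶ F ≫ T')
    (g : T' ≫ G ⟶ G ≫ T'') (h : T'' ≫ H ⟶ H ≫ T''') :
    IsTangentTwoMorphism (compLaw f (compLaw g h)) (compLaw (compLaw f g) h) (α_ F G H).inv := by
  simp only [IsTangentTwoMorphism, compLaw]
  bicategory

/-- Sums of tangent 2-morphisms are tangent 2-morphisms. -/
theorem of_isSum {S E B : X ⟶ Y} {q : E ⟶ B} {b : BundleData q} {s : T ≫ S ⟶ S ≫ T'}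
    {e : T ≫ E ⟶ E ≫ T'} {k : T ≫ b.pow2 ⟶ b.pow2 ≫ T'}
    (hp : IsFibrePower (q ▷ T') (b.post T').proj) (hk : ∀ i, IsTangentTwoMorphism k e (b.proj i))
    (hk' : IsTangentTwoMorphism k e b.add) {x y r : S ⟶ E} (hx : IsTangentTwoMorphism s e x)
    (hy : IsTangentTwoMorphism s e y) (h : b.IsSum x y r) : IsTangentTwoMorphism s e r := by
  simp only [IsTangentTwoMorphism] at *
  have h₁ := (h.post T').comp s
  obtain ⟨m, rfl, rfl, rfl⟩ := h
  have key (τ : b.pow2 ⟶ E) (hτ : k ≫ τ ▷ T' = T ◁ τ ≫ e) :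
      (T ◁ m ≫ k) ≫ τ ▷ T' = T ◁ (m ≫ τ) ≫ e := by
    rw [Category.assoc, hτ, whiskerLeft_comp, Category.assoc]
  rw [hx, hy] at h₁
  exact h₁.unique hp ⟨T ◁ m ≫ k, key _ (hk 0), key _ (hk 1), key _ hk'⟩

end IsTangentTwoMorphism

/-- The distributive law of a lax tangent morphism is itself a tangent 2-morphism. -/
theorem LaxMorphism.isTangentTwoMorphism_law {X Y : Tangentad K} (H : LaxMorphism X Y) :
    IsTangentTwoMorphism (X.tangentLax.comp H).law (H.comp Y.tangentLax).law H.law := by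
  have h := H.isLaxLaw.flip
  simp only [sqLaw] at h
  simp only [IsTangentTwoMorphism, LaxMorphism.comp, Tangentad.tangentLax, compLaw]
  rw [← cancel_epi (α_ X.T X.T H.F).hom, ← cancel_mono (α_ H.F Y.T Y.T).hom] at *
  simp only [Category.assoc, Iso.hom_inv_id_assoc, Iso.inv_hom_id, Category.comp_id] at h ⊢
  exact h

/-- The identity lax tangent morphism. -/
@[simps]
def Tangentad.idLax (X : Tangentad K) : LaxMorphism X X where
  F := 𝟙 X.X
  law := (ρ_ X.T).hom ≫ (λ_ X.T).inv
  isLaxLaw := isLaxLaw_id X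

/-- An isomorphism of categories is used through equalities of its objects. Such an equality is
obtained by checking that the `eqToHom` between the underlying 1-morphisms is a tangent 2-morphism.
-/
theorem LaxMorphism.eq_of_eqToHom {X Y : Tangentad K} {F G : LaxMorphism X Y} (h : F.F = G.F)
    (hc : IsTangentTwoMorphism F.law G.law (eqToHom h)) : F = G := by
  obtain ⟨F, a, ha⟩ := F
  obtain ⟨G, b, hb⟩ := G
  dsimp only at h hc
  subst h
  obtain rfl : a = b := by simpa [IsTangentTwoMorphism] using hc
  rfl

theorem VectorField.eq_of_eqToHom {X Y : Tangentad K} {V W : VectorField X Y} (h : V.F = W.F)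
    (hc : IsTangentTwoMorphism V.law W.law (eqToHom h))
    (hu : V.u ≫ eqToHom h ▷ Y.T = eqToHom h ≫ W.u) : V = W := by
  obtain ⟨F, u, hu₁, hu₂⟩ := V
  obtain ⟨G, u', hu₁', hu₂'⟩ := W
  obtain rfl := LaxMorphism.eq_of_eqToHom h hc
  obtain rfl : u = u' := by simpa using hu
  rfl

theorem LaxMorphism.eqToHom_φ {X Y : Tangentad K} {F G : LaxMorphism X Y} (h : F = G) :
    TangentTwoMorphism.φ (eqToHom h) = eqToHom (congrArg LaxMorphism.F h) := by
  subst h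
  rfl

/-! ### Transport of vector fields along lax tangent morphisms -/

namespace VectorField

variable {X Y Z : Tangentad K}

theorem eqToHom_φ {V W : VectorField X Y} (h : V = W) :
    (VectorFieldHom.toTangentTwoMorphism (eqToHom h)).φ =
      eqToHom (congrArg (fun V => V.F) h) := by
  subst h
  rfl

theorem comp_φ {V V' V'' : VectorField X Y} (f : V ⟶ V') (g : V' ⟶ V'') :
    (VectorFieldHom.toTangentTwoMorphism (f ≫ g)).φ =
      (VectorFieldHom.toTangentTwoMorphism f).φ ≫ (VectorFieldHom.toTangentTwoMorphism g).φ :=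
  rfl

/-- The image of a vector field on `F` under postcomposition with a lax tangent morphism `S`. -/
def map (V : VectorField X Y) (S : LaxMorphism Y Z) : VectorField X Z where
  toLaxMorphism := V.toLaxMorphism.comp S
  u := V.u ▷ S.F ≫ (α_ V.F Y.T S.F).hom ≫ V.F ◁ S.law ≫ (α_ V.F S.F Z.T).inv
  comm :=
    (V.comm.whiskerRight S.law).comp <| (IsTangentTwoMorphism.associator_hom _ _ _).comp <|
      (S.isTangentTwoMorphism_law.whiskerLeft V.law).comp
        (IsTangentTwoMorphism.associator_inv _ _ _)
  sec := by
    have h := V.sec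
    have h' := S.isLaxLaw.additive.proj
    calc
      (V.u ▷ S.F ≫ (α_ V.F Y.T S.F).hom ≫ V.F ◁ S.law ≫ (α_ V.F S.F Z.T).inv) ≫
          (V.F ≫ S.F) ◁ Z.p ≫ (ρ_ (V.F ≫ S.F)).hom =
          V.u ▷ S.F ⊗≫ V.F ◁ (S.law ≫ S.F ◁ Z.p) ⊗≫ 𝟙 _ := by bicategory
      _ = (V.u ≫ V.F ◁ Y.p ≫ (ρ_ V.F).hom) ▷ S.F := by
        rw [h']
        bicategory
      _ = 𝟙 (V.F ≫ S.F) := by rw [h, id_whiskerRight]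

/-- The image of a vector field is natural in tangent 2-morphisms. -/
def mapHom (V : VectorField X Y) {S S' : LaxMorphism Y Z} {φ : S.F ⟶ S'.F}
    (h : IsTangentTwoMorphism S.law S'.law φ) : V.map S ⟶ V.map S' :=
  VectorFieldHom.mk
    (TangentTwoMorphism.mk (F := (V.map S).toLaxMorphism) (G := (V.map S').toLaxMorphism)
      (V.F ◁ φ) (h.whiskerLeft V.law))
    (by
      simp only [IsTangentTwoMorphism] at h
      calc
        (V.u ▷ S.F ≫ (α_ V.F Y.T S.F).hom ≫ V.F ◁ S.law ≫ (α_ V.F S.F Z.T).inv) ≫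
            (V.F ◁ φ) ▷ Z.T = V.u ▷ S.F ⊗≫ V.F ◁ (S.law ≫ φ ▷ Z.T) ⊗≫ 𝟙 _ := by bicategory
        _ = (V.u ▷ S.F ≫ (V.F ≫ Y.T) ◁ φ) ⊗≫ V.F ◁ S'.law ⊗≫ 𝟙 _ := by
          rw [h]
          bicategory
        _ = V.F ◁ φ ≫ V.u ▷ S'.F ≫ (α_ V.F Y.T S'.F).hom ≫ V.F ◁ S'.law ≫
            (α_ V.F S'.F Z.T).inv := by
          rw [← whisker_exchange]
          bicategory)

end VectorField

theorem compLaw_eqToHom [Bicategory.Strict K] {X Y Z : K} {T : X ⟶ X} {T' : Y ⟶ Y} {T'' : Z ⟶ Z}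
    {G : X ⟶ Y} {H : Y ⟶ Z} (h : T ≫ G = G ≫ T') (h' : T' ≫ H = H ≫ T'') :
    compLaw (eqToHom h) (eqToHom h') = eqToHom (by
      rw [← Bicategory.Strict.assoc, h, Bicategory.Strict.assoc, h', Bicategory.Strict.assoc]) := by
  simp only [compLaw, Bicategory.Strict.associator_eqToIso, eqToHom_whiskerRight,
    whiskerLeft_eqToHom, eqToIso.hom, eqToIso.inv, eqToHom_trans]

/-! ### Consequences of the universal property of `v` -/

namespace VectorFieldObject

variable {X Y : Tangentad K} (V : VectorFieldObject Y)

/-- The universal vector field. -/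
def field : VectorField V.VF Y where
  toLaxMorphism := V.U.toLax
  u := V.v
  comm := V.comm
  sec := V.sec

instance : (V.field.Γ X).IsEquivalence := by
  obtain ⟨Λ, h, h'⟩ := V.universal X
  exact (CategoryTheory.Equivalence.mk (V.field.Γ X) Λ (eqToIso h.symm)
    (eqToIso h')).isEquivalence_functor

theorem obj_injective {H H' : LaxMorphism X V.VF}
    (h : (V.field.Γ X).obj H = (V.field.Γ X).obj H') : H = H' := by
  obtain ⟨Λ, hΛ, -⟩ := V.universal X
  exact (Functor.congr_obj hΛ H).symm.trans
    ((congrArg Λ.obj h).trans (Functor.congr_obj hΛ H'))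

theorem exists_obj (W : VectorField X Y) : ∃ H, (V.field.Γ X).obj H = W := by
  obtain ⟨Λ, -, hΛ⟩ := V.universal X
  exact ⟨Λ.obj W, Functor.congr_obj hΛ W⟩

theorem whisker_injective {H H' : LaxMorphism X V.VF} {φ φ' : H.F ⟶ H'.F}
    (hφ : IsTangentTwoMorphism H.law H'.law φ) (hφ' : IsTangentTwoMorphism H.law H'.law φ')
    (h : φ ▷ V.U.F = φ' ▷ V.U.F) : φ = φ' :=
  congrArg TangentTwoMorphism.φ ((V.field.Γ X).map_injective
    (a₁ := (TangentTwoMorphism.mk φ hφ : H ⟶ H')) (a₂ := (TangentTwoMorphism.mk φ' hφ' : H ⟶ H'))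
    (VectorFieldHom.ext h))

theorem exists_whisker {H H' : LaxMorphism X V.VF}
    (ψ : (V.field.Γ X).obj H ⟶ (V.field.Γ X).obj H') :
    ∃ φ : H.F ⟶ H'.F, IsTangentTwoMorphism H.law H'.law φ ∧
      φ ▷ V.U.F = (VectorFieldHom.toTangentTwoMorphism ψ).φ := by
  obtain ⟨f, rfl⟩ := (V.field.Γ X).map_surjective ψ
  exact ⟨TangentTwoMorphism.φ f, TangentTwoMorphism.comm f, rfl⟩

theorem fieldOf_rfl {A : K} (H : A ⟶ V.VF.X) :
    V.fieldOf (rfl : H ≫ V.U.F = H ≫ V.U.F) = pullField H V.v := by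
  simp [fieldOf]

/-- Compatibility of `v` with the laws compares `v_T` with `T v` through the flip `c_U`. As `c² =
id`, it can be read as saying that `v_T` is `c_U ∘ T v`, the image of `v` under `(T, c)`. -/
theorem obj_tangentLax :
    (V.field.Γ V.VF).obj V.VF.tangentLax = V.field.map Y.tangentLax := by
  have h := V.comm
  have hc : V.U.F ◁ Y.c ≫ V.U.F ◁ Y.c = 𝟙 _ := by
    rw [← whiskerLeft_comp, Y.flip_flip, whiskerLeft_id]
  simp only [IsTangentTwoMorphism, compLaw, StrictMorphism.toLax] at h
  have key : (V.VF.T ◁ V.v ≫ (α_ _ _ _).inv) ≫ eqToHom V.U.eq ▷ Y.T =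
      eqToHom V.U.eq ≫ V.v ▷ Y.T ≫ (α_ V.U.F Y.T Y.T).hom ≫ V.U.F ◁ Y.c ≫
        (α_ V.U.F Y.T Y.T).inv := by
    rw [reassoc_of% h]
    simp [reassoc_of% hc]
  exact VectorField.eq_of_eqToHom V.U.eq V.U.toLax.isTangentTwoMorphism_law key

section Strict

variable [Bicategory.Strict K]

/-- A lax tangent morphism into the tangentad of vector fields is strict if its composite with `U`
is strict. -/
theorem exists_law_eq_eqToHom {H : LaxMorphism X V.VF}
    (h : X.T ≫ (H.F ≫ V.U.F) = (H.F ≫ V.U.F) ≫ Y.T)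
    (hl : compLaw H.law V.U.toLax.law = eqToHom h) :
    ∃ e : X.T ≫ H.F = H.F ≫ V.VF.T, H.law = eqToHom e := by
  let f : X.tangentLax.comp H ⟶ H.comp V.VF.tangentLax :=
    TangentTwoMorphism.mk H.law H.isTangentTwoMorphism_law
  let g := (V.field.Γ X).map f
  have e₀ : (X.T ≫ H.F) ≫ V.U.F = (H.F ≫ V.VF.T) ≫ V.U.F := by
    rw [Bicategory.Strict.assoc, h, Bicategory.Strict.assoc, ← V.U.eq, Bicategory.Strict.assoc]
  have hφ : H.law ▷ V.U.F = eqToHom e₀ := by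
    simp only [compLaw, StrictMorphism.toLax, whiskerLeft_eqToHom,
      Bicategory.Strict.associator_eqToIso, eqToIso.hom, eqToIso.inv, eqToHom_trans] at hl
    rw [eqToHom_comp_iff, comp_eqToHom_iff] at hl
    rw [hl, eqToHom_trans, eqToHom_trans]
  have hg : (VectorFieldHom.toTangentTwoMorphism g).φ = eqToHom e₀ := hφ
  -- The law becomes an identity after whiskering with `U`, and a morphism of vector fields whose
  -- underlying 2-morphism is an identity forces source and target to coincide. Injectivity on
  -- objects then lifts this equality.
  have hΓ : (V.field.Γ X).obj (X.tangentLax.comp H) = (V.field.Γ X).obj (H.comp V.VF.tangentLax) :=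
    VectorField.eq_of_eqToHom e₀ (hg ▸ (VectorFieldHom.toTangentTwoMorphism g).comm)
      (hg ▸ VectorFieldHom.related g)
  have e := V.obj_injective hΓ
  refine ⟨congrArg LaxMorphism.F e, ?_⟩
  refine V.whisker_injective H.isTangentTwoMorphism_law ?_ ?_
  · have he := TangentTwoMorphism.comm (eqToHom e)
    rw [LaxMorphism.eqToHom_φ] at he
    exact he
  · exact hφ.trans (eqToHom_whiskerRight (congrArg LaxMorphism.F e) V.U.F).symm

/-- A vector field on a strict tangent morphism is represented by a strict tangent morphism. -/
theorem exists_strict (W : VectorField X Y) (h : X.T ≫ W.F = W.F ≫ Y.T)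
    (hl : W.law = eqToHom h) :
    ∃ (S : StrictMorphism X V.VF) (e : S.F ≫ V.U.F = W.F), V.fieldOf e = W.u := by
  obtain ⟨H, rfl⟩ := V.exists_obj W
  obtain ⟨e, he⟩ := V.exists_law_eq_eqToHom h hl
  refine ⟨⟨H.F, e, he ▸ H.isLaxLaw⟩, rfl, V.fieldOf_rfl H.F⟩

theorem strict_ext {S S' : StrictMorphism X V.VF} {G : X.X ⟶ Y.X} (e : S.F ≫ V.U.F = G)
    (e' : S'.F ≫ V.U.F = G) (h : V.fieldOf e = V.fieldOf e') : S = S' := by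
  subst e
  have : S.toLax = S'.toLax := by
    refine V.obj_injective (VectorField.eq_of_eqToHom e'.symm ?_ ?_)
    · have key : compLaw (eqToHom S.eq) (eqToHom V.U.eq) ≫ eqToHom e'.symm ▷ Y.T =
          X.T ◁ eqToHom e'.symm ≫ compLaw (eqToHom S'.eq) (eqToHom V.U.eq) := by
        simp only [compLaw_eqToHom, eqToHom_whiskerRight, whiskerLeft_eqToHom, eqToHom_trans]
      exact key
    · have key : pullField S.F V.v ≫ eqToHom e'.symm ▷ Y.T =
          eqToHom e'.symm ≫ pullField S'.F V.v := by
        rw [← fieldOf_rfl, h]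
        simp [fieldOf]
      exact key
  exact StrictMorphism.ext (congrArg LaxMorphism.F this)

end Strict

end VectorFieldObject

end

/-! ### Negatives and strict lifts of fibre powers upstairs -/

section

variable {K : Type u} [Bicategory.{w, v} K]

/-- Compatibility with the laws is an equation into `T' ∘ G`, so a jointly monic family `T' ψ i`
suffices to test it. This makes morphisms into fibre powers tangent when their components are. -/
theorem IsTangentTwoMorphism.of_comp {ι : Type*} {X Y : K} {T : X ⟶ X} {T' : Y ⟶ Y} {F G H : X ⟶ Y}
    {a : T ≫ F ⟶ F ≫ T'} {b : T ≫ G ⟶ G ≫ T'} {d : T ≫ H ⟶ H ≫ T'} {φ : F ⟶ G} {ψ : ι → (G ⟶ H)}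
    (hψ : ∀ i, IsTangentTwoMorphism b d (ψ i)) (h : ∀ i, IsTangentTwoMorphism a d (φ ≫ ψ i))
    (hmono : ∀ {A : X ⟶ Y} (f g : A ⟶ G ≫ T'), (∀ i, f ≫ ψ i ▷ T' = g ≫ ψ i ▷ T') → f = g) :
    IsTangentTwoMorphism a b φ := by
  refine hmono _ _ fun i => ?_
  have h₁ := hψ i
  have h₂ := h i
  simp only [IsTangentTwoMorphism] at h₁ h₂
  rw [Category.assoc, ← comp_whiskerRight, h₂, Category.assoc, h₁, whiskerLeft_comp,
    Category.assoc]

theorem VectorField.exists_hom_of_comp {ι : Type*} {X Y : Tangentad K} {V W W' : VectorField X Y}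
    (ψ : ι → (W ⟶ W')) (κ : ι → (V ⟶ W')) (f : V.F ⟶ W.F)
    (hf : ∀ i, f ≫ (VectorFieldHom.toTangentTwoMorphism (ψ i)).φ =
      (VectorFieldHom.toTangentTwoMorphism (κ i)).φ)
    (hmono : ∀ {A : X.X ⟶ Y.X} (a b : A ⟶ W.F ≫ Y.T),
      (∀ i, a ≫ (VectorFieldHom.toTangentTwoMorphism (ψ i)).φ ▷ Y.T =
        b ≫ (VectorFieldHom.toTangentTwoMorphism (ψ i)).φ ▷ Y.T) → a = b) :
    ∃ g : V ⟶ W, (VectorFieldHom.toTangentTwoMorphism g).φ = f := by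
  refine ⟨VectorFieldHom.mk (TangentTwoMorphism.mk f
    (.of_comp (fun i => (VectorFieldHom.toTangentTwoMorphism (ψ i)).comm) (fun i => ?_) hmono))
    (hmono _ _ fun i => ?_), rfl⟩
  · rw [hf]
    exact (VectorFieldHom.toTangentTwoMorphism (κ i)).comm
  · have h₁ := VectorFieldHom.related (ψ i)
    have h₂ := VectorFieldHom.related (κ i)
    rw [Category.assoc, ← comp_whiskerRight, hf, h₂, Category.assoc, h₁, reassoc_of% hf i]

/-- Lax tangent morphisms preserve sums. -/
theorem LaxMorphism.isSum {X Y : Tangentad K} (F : LaxMorphism X Y) {A : X.X ⟶ X.X}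
    {x y r : A ⟶ X.T} (h : X.bundle.IsSum x y r) :
    (Y.bundle.pre F.F).IsSum (x ▷ F.F ≫ F.law) (y ▷ F.F ≫ F.law) (r ▷ F.F ≫ F.law) :=
  F.isLaxLaw.additive.isSum (h.post F.F)

theorem Tangentad.isTangentTwoMorphism_zero (X : Tangentad K) [Bicategory.Strict K] :
    IsTangentTwoMorphism X.idLax.law X.c X.bundle.zero := by
  have h := X.flip_additive_symm.zero
  simp only [BundleData.pre, BundleData.post] at h
  simpa only [IsTangentTwoMorphism, Tangentad.idLax] using h.symm

theorem IsOver.whiskerRight_eq {X X' Y Y' : K} {F : X ⟶ Y} {G : X' ⟶ Y'} {S T : X ⟶ X'}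
    {S' T' : Y ⟶ Y'} {σ τ : S ⟶ T} {σ' : S' ⟶ T'} (h : IsOver F G σ σ') (h' : IsOver F G τ σ') :
    σ ▷ G = τ ▷ G := by
  rw [h.eq, h'.eq]

namespace VectorFieldObject

variable {X Y : Tangentad K} (V : VectorFieldObject Y)

theorem hom_ext_of_isOver {H H' : LaxMorphism V.VF V.VF} {φ φ' : H.F ⟶ H'.F}
    (hφ : IsTangentTwoMorphism H.law H'.law φ) (hφ' : IsTangentTwoMorphism H.law H'.law φ')
    {S S' : Y.X ⟶ Y.X} {σ : S ⟶ S'} (h : IsOver V.U.F V.U.F φ σ) (h' : IsOver V.U.F V.U.F φ' σ) :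
    φ = φ' :=
  V.whisker_injective hφ hφ' (h.whiskerRight_eq h')

/-- Tangent 2-morphisms between lax endomorphisms of the base lift along `U`. -/
theorem exists_isOver {L L' : LaxMorphism V.VF V.VF} {M M' : LaxMorphism Y Y}
    (e : (V.field.Γ V.VF).obj L = V.field.map M) (e' : (V.field.Γ V.VF).obj L' = V.field.map M')
    {σ : M.F ⟶ M'.F} (hσ : IsTangentTwoMorphism M.law M'.law σ) :
    ∃ ν : L.F ⟶ L'.F, IsTangentTwoMorphism L.law L'.law ν ∧ IsOver V.U.F V.U.F ν σ := by
  obtain ⟨ν, hν, h⟩ := V.exists_whisker (eqToHom e ≫ V.field.mapHom hσ ≫ eqToHom e'.symm)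
  refine ⟨ν, hν, congrArg (fun V => V.F) e, congrArg (fun V => V.F) e', ?_⟩
  rw [VectorField.comp_φ, VectorField.comp_φ, VectorField.eqToHom_φ, VectorField.eqToHom_φ] at h
  exact (conj_eqToHom_iff_heq _ _ _ (congrArg (fun V => V.F) e')).1 h

end VectorFieldObject

variable [Bicategory.Strict K]

namespace Tangentad

variable (X : Tangentad K)

theorem isTangentTwoMorphism_of_isSum {S : LaxMorphism X X} {x y r : S.F ⟶ X.T}
    (hx : IsTangentTwoMorphism S.law X.c x) (hy : IsTangentTwoMorphism S.law X.c y)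
    (h : X.bundle.IsSum x y r) : IsTangentTwoMorphism S.law X.c r := by
  obtain ⟨k, hk, hk'⟩ := X.flip_additive_symm.add
  exact IsTangentTwoMorphism.of_isSum (k := k) X.isPointwisePower_proj.postT hk hk' hx hy h

end Tangentad

theorem sqLaw_eqToHom {X Y : K} {T : X ⟶ X} {T' : Y ⟶ Y} {F : X ⟶ Y} (h : T ≫ F = F ≫ T') :
    sqLaw (eqToHom h) = eqToHom (by
      rw [Bicategory.Strict.assoc, h, ← Bicategory.Strict.assoc, h, Bicategory.Strict.assoc]) := by
  simp only [sqLaw, Bicategory.Strict.associator_eqToIso, eqToHom_whiskerRight,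
    whiskerLeft_eqToHom, eqToIso.hom, eqToIso.inv, eqToHom_trans]

namespace StrictMorphism

variable {X Y : Tangentad K} (F : StrictMorphism X Y)

theorem src_id : 𝟙 X.X ≫ F.F = F.F ≫ 𝟙 Y.X :=
  (Bicategory.Strict.id_comp _).trans (Bicategory.Strict.comp_id _).symm

theorem src_tt : (X.T ≫ X.T) ≫ F.F = F.F ≫ (Y.T ≫ Y.T) := by
  rw [Bicategory.Strict.assoc, F.eq, ← Bicategory.Strict.assoc, F.eq, Bicategory.Strict.assoc]

theorem isOver_p : IsOver F.F F.F X.p Y.p := by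
  refine .of_comm F.eq F.src_id ?_
  have h := F.isLaxLaw.additive.proj
  simpa only [Bicategory.Strict.leftUnitor_eqToIso, Bicategory.Strict.rightUnitor_eqToIso,
    eqToIso.hom, eqToIso.inv, eqToHom_trans] using h

theorem isOver_zero : IsOver F.F F.F X.bundle.zero Y.bundle.zero := by
  refine .of_comm F.src_id F.eq ?_
  have h := F.isLaxLaw.additive.zero
  simp only [BundleData.post, BundleData.pre] at h
  simpa only [Bicategory.Strict.leftUnitor_eqToIso, Bicategory.Strict.rightUnitor_eqToIso,
    eqToIso.hom, eqToIso.inv, eqToHom_trans] using h.symm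

theorem isOver_l : IsOver F.F F.F X.l Y.l := by
  refine .of_comm F.eq F.src_tt ?_
  rw [← sqLaw_eqToHom F.eq]
  exact F.isLaxLaw.lift.symm

theorem isOver_c : IsOver F.F F.F X.c Y.c := by
  refine .of_comm F.src_tt F.src_tt ?_
  rw [← sqLaw_eqToHom F.eq]
  exact F.isLaxLaw.flip.symm

end StrictMorphism

namespace VectorFieldObject

variable {X Y : Tangentad K} (V : VectorFieldObject Y)

/-- The candidate is the lift `θ` of the tangent 2-morphism `n`. Everything it must satisfy is an
equation between tangent 2-morphisms, hence holds as soon as it holds under `U`. -/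
theorem exists_negation {n : Y.T ⟶ Y.T} (hn : Y.IsNegation n) :
    ∃ m : V.VF.T ⟶ V.VF.T, V.VF.IsNegation m := by
  have e := V.obj_tangentLax
  obtain ⟨θ, hθ, hθU⟩ : ∃ θ : V.VF.T ⟶ V.VF.T, IsTangentTwoMorphism V.VF.c V.VF.c θ ∧
      IsOver V.U.F V.U.F θ n := V.exists_isOver e e (Y.isTangentTwoMorphism_negation hn)
  have hnp : n ≫ Y.p = Y.p := by
    simpa using hn.proj_eq Y.isAdditiveBundle.isFibrePower
  have hθp : θ ≫ V.VF.p = V.VF.p :=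
    V.hom_ext_of_isOver (H := V.VF.tangentLax) (H' := V.VF.idLax)
      (hθ.comp V.VF.isTangentTwoMorphism_p) V.VF.isTangentTwoMorphism_p
      (hθU.comp V.U.isOver_p) (hnp.symm ▸ V.U.isOver_p)
  obtain ⟨r, hr⟩ := BundleData.exists_isSum V.VF.isAdditiveBundle.isFibrePower θ (𝟙 _)
    (hθp.trans (Category.id_comp _).symm)
  -- The sum `θ + id` is a tangent 2-morphism, and `U` preserves sums, so it lies over `n + id = z ∘
  -- p`, exactly as `z ∘ p` upstairs does.
  obtain rfl : r = V.VF.p ≫ V.VF.bundle.zero := by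
    refine V.hom_ext_of_isOver (H := V.VF.tangentLax) (H' := V.VF.tangentLax)
      (V.VF.isTangentTwoMorphism_of_isSum (S := V.VF.tangentLax) hθ (IsTangentTwoMorphism.id _) hr)
      (V.VF.isTangentTwoMorphism_p.comp V.VF.isTangentTwoMorphism_zero)
      (.of_comm V.U.eq V.U.eq ?_) (V.U.isOver_p.comp V.U.isOver_zero)
    have h₁ := BundleData.isNegation_isSum_pre hn V.U.F (eqToHom V.U.eq)
    have h₂ := V.U.toLax.isSum hr
    simp only [StrictMorphism.toLax, id_whiskerRight, Category.id_comp] at h₂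
    rw [← hθU.comm] at h₂
    rw [whiskerLeft_comp]
    exact h₁.unique (Y.isPointwisePower_proj.pre V.U.F) h₂
  exact ⟨θ, hr⟩

/-- Pointwise fibre powers of the projection of the base tangentad lift strictly to the tangentad
of vector fields. -/
theorem exists_isPointwisePower_isOver {n : ℕ} (hn : 0 < n) {N : Y.X ⟶ Y.X}
    {π : Fin n → (N ⟶ Y.T)} (h : IsPointwisePower Y.p π) :
    ∃ (L : V.VF.X ⟶ V.VF.X) (ν : Fin n → (L ⟶ V.VF.T)),
      IsPointwisePower V.VF.p ν ∧ ∀ i, IsOver V.U.F V.U.F (ν i) (π i) := by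
  have eT := V.obj_tangentLax
  obtain ⟨M, rfl, hM⟩ := Y.exists_law_of_isPointwisePower h
  simp only [eqToHom_refl, Category.id_comp] at hM
  obtain ⟨N', ν', h'⟩ := V.VF.exists_pointwisePower n hn
  obtain ⟨M', rfl, hM'⟩ := V.VF.exists_law_of_isPointwisePower h'
  simp only [eqToHom_refl, Category.id_comp] at hM'
  -- `L` represents the image of `v` under `M`, so `U ∘ L = M ∘ U` on the nose. That `L` is a fibre
  -- power is proved by comparison with `M'`, a fibre power upstairs with no strict relation to `M`.
  obtain ⟨L, eL⟩ := V.exists_obj (V.field.map M)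
  have hl : ∀ i, ∃ ν : L.F ⟶ V.VF.T, IsTangentTwoMorphism L.law V.VF.c ν ∧
      IsOver V.U.F V.U.F ν (π i) := fun i => V.exists_isOver (M' := Y.tangentLax) eL eT (hM i)
  choose ν hν hνU using hl
  have hνp (i j : Fin n) : ν i ≫ V.VF.p = ν j ≫ V.VF.p :=
    V.hom_ext_of_isOver (H' := V.VF.idLax) ((hν i).comp V.VF.isTangentTwoMorphism_p)
      ((hν j).comp V.VF.isTangentTwoMorphism_p) ((hνU i).comp V.U.isOver_p)
      (h.base.comm j i ▸ (hνU j).comp V.U.isOver_p)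
  -- The comparison `L ⟶ M'`, from the universal property of `M'`; it is tangent because its
  -- components `ν i` are.
  obtain ⟨f, hf⟩ := h'.base.exists_lift ν hνp
  have hft : IsTangentTwoMorphism L.law M'.law f :=
    .of_comp hM' (fun i => (hf i).symm ▸ hν i) fun _ _ => h'.postT.hom_ext
  let κ (i : Fin n) : (V.field.Γ V.VF).obj M' ⟶ V.field.map Y.tangentLax :=
    (V.field.Γ V.VF).map (Y := V.VF.tangentLax) (TangentTwoMorphism.mk (ν' i) (hM' i)) ≫ eqToHom eT
  have hκ (i : Fin n) : (VectorFieldHom.toTangentTwoMorphism (κ i)).φ =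
      ν' i ▷ V.U.F ≫ eqToHom V.U.eq := by
    rw [VectorField.comp_φ, VectorField.eqToHom_φ]
    rfl
  -- The opposite comparison is built under `U`, where `M ∘ U` is a fibre power by pointwiseness. It
  -- respects the vector fields, since its components do and `T` preserves the fibre power, and so
  -- it lifts to `g`. That `f` and `g` are inverse is then checked under `U` or on projections.
  obtain ⟨g₀, hg₀⟩ := (h.pre V.U.F).exists_lift (fun i => ν' i ▷ V.U.F ≫ eqToHom V.U.eq) (by
    intro i j
    rw [Category.assoc, Category.assoc, V.U.isOver_p.comm, ← comp_whiskerRight_assoc,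
      h'.base.comm i j, comp_whiskerRight_assoc])
  obtain ⟨g₁, hg₁⟩ := VectorField.exists_hom_of_comp
    (fun i => V.field.mapHom (S' := Y.tangentLax) (hM i)) κ g₀
    (fun i => (hg₀ i).trans (hκ i).symm) fun _ _ => (h.post V.U.F).hom_ext
  obtain ⟨g, hg, hgU⟩ := V.exists_whisker (g₁ ≫ eqToHom eL.symm)
  have eLF : L.F ≫ V.U.F = V.U.F ≫ M.F := congrArg (fun V => V.F) eL
  replace hgU : g ▷ V.U.F = g₀ ≫ eqToHom eLF.symm := by
    rw [VectorField.comp_φ, VectorField.eqToHom_φ, hg₁] at hgU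
    exact hgU
  have hfg₀ : f ▷ V.U.F ≫ g₀ = eqToHom eLF := (h.pre V.U.F).hom_ext fun i => by
    rw [Category.assoc, hg₀, ← comp_whiskerRight_assoc, hf, ← (hνU i).comm]
  have hfg : f ≫ g = 𝟙 L.F := by
    refine V.whisker_injective (hft.comp hg) (IsTangentTwoMorphism.id _) ?_
    rw [comp_whiskerRight, hgU, reassoc_of% hfg₀]
    simp
  have hgν (i : Fin n) : g ≫ ν i = ν' i := by
    have key : (g ≫ ν i) ▷ V.U.F = ν' i ▷ V.U.F := by
      rw [comp_whiskerRight, hgU, (hνU i).eq, Category.assoc, eqToHom_trans_assoc, eqToHom_refl,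
        Category.id_comp, reassoc_of% (hg₀ i)]
      simp
    exact V.whisker_injective (H := M') (H' := V.VF.tangentLax) (hg.comp (hν i)) (hM' i) key
  have hgf : g ≫ f = 𝟙 M'.F := h'.base.hom_ext fun i => by
    rw [Category.assoc, hf, hgν, Category.id_comp]
  exact ⟨L.F, ν, h'.of_iso ⟨f, g, hfg, hgf⟩ hf, hνU⟩

end VectorFieldObject

end

section

/-! ### Structure over a strict family of 1-morphisms -/

variable {K : Type u} [Bicategory.{w, v} K]

namespace IsTwoFibrePower

variable {E B P : K} {q : E ⟶ B} {N : ℕ} {π : Fin N → (P ⟶ E)}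

theorem exists_lift (hP : IsTwoFibrePower q π) {A : K} (f : Fin N → (A ⟶ E))
    (hf : ∀ i j, f i ≫ q = f j ≫ q) : ∃ h : A ⟶ P, ∀ i, h ≫ π i = f i :=
  (hP.existsUnique_lift f hf).exists

/-- For a family `Θ' ▷ π i` the compatibility over the base is the interchange law, so the
uniqueness clause makes the projections jointly faithful. -/
theorem hom_ext₂ (hP : IsTwoFibrePower q π) {A : K} {h h' : A ⟶ P} {Θ Θ' : h ⟶ h'}
    (H : ∀ i, Θ ▷ π i = Θ' ▷ π i) : Θ = Θ' := by
  obtain ⟨_, _, hu⟩ := hP.existsUnique_lift₂ h h' (fun i => Θ' ▷ π i) (fun i j => by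
    have e (i) : (α_ h (π i) q).inv ≫ Θ' ▷ π i ▷ q ≫ (α_ h' (π i) q).hom = Θ' ▷ (π i ≫ q) := by
      simp
    have e' := whisker_exchange Θ' (eqToHom (hP.comm i j))
    rw [← e i, ← e j] at e'
    simpa only [Category.assoc] using e'.symm)
  exact (hu Θ H).trans (hu Θ' fun _ => rfl).symm

/-- Morphisms which are over the same family of morphisms are equal. -/
theorem eq_of_isOver (hP : IsTwoFibrePower q π) {A : K} {S T : A ⟶ P} {σ τ : S ⟶ T} {Y : Fin N → K}
    {F : ∀ i, A ⟶ Y i}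
    {S' T' : ∀ i, Y i ⟶ E} {σ' : ∀ i, S' i ⟶ T' i} (hσ : ∀ i, IsOver (F i) (π i) σ (σ' i))
    (hτ : ∀ i, IsOver (F i) (π i) τ (σ' i)) : σ = τ :=
  hP.hom_ext₂ fun i => (hσ i).whiskerRight_eq (hτ i)

/-- Compatible families of 2-morphisms into `R ≫ π i` lift to 2-morphisms into `R`, if
compatibility over the base can be tested on a jointly monic family. -/
theorem exists_lift_of_jointly_mono (hP : IsTwoFibrePower q π) {ι : Type*} {A : K} {S R : A ⟶ P}
    {Z : ι → (A ⟶ P)}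
    (ψ : ∀ k, R ⟶ Z k) (f : ∀ k, S ⟶ Z k) (m : ∀ i, S ≫ π i ⟶ R ≫ π i)
    (hm : ∀ i k, m i ≫ ψ k ▷ π i = f k ▷ π i)
    (hmono : ∀ j, ∀ {D : A ⟶ B} (a b : D ⟶ R ≫ (π j ≫ q)),
      (∀ k, a ≫ ψ k ▷ (π j ≫ q) = b ≫ ψ k ▷ (π j ≫ q)) → a = b) :
    ∃ Θ : S ⟶ R, (∀ i, Θ ▷ π i = m i) := by
  refine (hP.existsUnique_lift₂ S R m fun i j => hmono j _ _ fun k => ?_).exists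
  have e (i) : (α_ S (π i) q).inv ≫ m i ▷ q ≫ (α_ R (π i) q).hom ≫ ψ k ▷ (π i ≫ q) =
      f k ▷ (π i ≫ q) := by
    rw [whiskerRight_comp, Iso.hom_inv_id_assoc, ← comp_whiskerRight_assoc, hm]
    simp
  simp only [Category.assoc, whisker_exchange, e]
  rw [reassoc_of% e i]

/-- Lifts are formed under each `π j`. To glue they must agree over the base, and there the
whiskered projections of the fibre power are jointly monic by `h₂`; this is why both hypotheses are
needed. -/
theorem isFibrePower (hP : IsTwoFibrePower q π) {A : K} {E₀ B₀ P₀ : A ⟶ P} {p : E₀ ⟶ B₀} {n : ℕ}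
    {ψ : Fin n → (P₀ ⟶ E₀)}
    (h₁ : ∀ j, IsFibrePower (p ▷ π j) (fun i => ψ i ▷ π j))
    (h₂ : ∀ j, IsFibrePower (p ▷ (π j ≫ q)) (fun i => ψ i ▷ (π j ≫ q))) :
    IsFibrePower p ψ where
  comm i k := hP.hom_ext₂ fun j => by
    rw [comp_whiskerRight, comp_whiskerRight, (h₁ j).comm i k]
  existsUnique_lift {S} f hf := by
    choose m hm using fun j => (h₁ j).exists_lift (fun i => f i ▷ π j) (fun i k => by
      rw [← comp_whiskerRight, ← comp_whiskerRight, hf i k])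
    obtain ⟨Θ, hΘ⟩ := hP.exists_lift_of_jointly_mono ψ f m hm
      fun j _ _ _ => (h₂ j).hom_ext
    refine ⟨Θ, fun i => hP.hom_ext₂ fun j => by rw [comp_whiskerRight, hΘ, hm], fun Θ' hΘ' => ?_⟩
    refine hP.hom_ext₂ fun j => (h₁ j).hom_ext fun i => ?_
    rw [hΘ, hm, ← comp_whiskerRight, hΘ']

theorem isPullback (hP : IsTwoFibrePower q π) {A : K} {P₀ X₀ Y₀ Z₀ : A ⟶ P} {a : P₀ ⟶ X₀}
    {b : P₀ ⟶ Y₀} {f : X₀ ⟶ Z₀} {g : Y₀ ⟶ Z₀}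
    (h₁ : ∀ j, IsPullback (a ▷ π j) (b ▷ π j) (f ▷ π j) (g ▷ π j))
    (h₂ : ∀ j, IsPullback (a ▷ (π j ≫ q)) (b ▷ (π j ≫ q)) (f ▷ (π j ≫ q)) (g ▷ (π j ≫ q))) :
    IsPullback a b f g := by
  have w : a ≫ f = b ≫ g := hP.hom_ext₂ fun j => by
    rw [comp_whiskerRight, comp_whiskerRight, (h₁ j).w]
  have hl {S : A ⟶ P} (x : S ⟶ X₀) (y : S ⟶ Y₀) (hxy : x ≫ f = y ≫ g) :
      ∃ Θ : S ⟶ P₀, Θ ≫ a = x ∧ Θ ≫ b = y := by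
    have e (j) : x ▷ π j ≫ f ▷ π j = y ▷ π j ≫ g ▷ π j := by
      rw [← comp_whiskerRight, ← comp_whiskerRight, hxy]
    -- The jointly monic family consists of the two legs of the square, indexed by `Bool`.
    obtain ⟨Θ, hΘ⟩ := hP.exists_lift_of_jointly_mono (ι := Bool) (R := P₀) (S := S)
      (Z := fun k => Bool.rec X₀ Y₀ k) (fun k => Bool.rec a b k) (fun k => Bool.rec x y k)
      (fun j => (h₁ j).lift _ _ (e j)) (fun j k => by cases k <;> simp)
      (fun j _ s t hst => (h₂ j).hom_ext (hst false) (hst true))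
    exact ⟨Θ, hP.hom_ext₂ fun j => by simp [hΘ], hP.hom_ext₂ fun j => by simp [hΘ]⟩
  choose l hla hlb using @hl
  exact ⟨⟨w⟩, ⟨Limits.PullbackCone.IsLimit.mk w (fun s => l s.fst s.snd s.condition)
    (fun s => hla _ _ _) (fun s => hlb _ _ _) fun s m hma hmb => hP.hom_ext₂ fun j =>
      (h₁ j).hom_ext (by rw [← comp_whiskerRight, ← comp_whiskerRight, hma, hla])
        (by rw [← comp_whiskerRight, ← comp_whiskerRight, hmb, hlb])⟩⟩

end IsTwoFibrePower

variable [Bicategory.Strict K]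

namespace IsOver

variable {X X' Y Y' : K} {F : X ⟶ Y} {G : X' ⟶ Y'} {S T : X ⟶ X'} {S' T' : Y ⟶ Y'}
  {σ τ : S ⟶ T} {σ' : S' ⟶ T'}

/-- Absorbing `F` into the lower 2-morphism brings all comparisons into hom categories with one
common source, where sums and limits can be compared. -/
theorem toId (h : IsOver F G σ σ') : IsOver (𝟙 X) G σ (F ◁ σ') where
  src := h.src.trans (Bicategory.Strict.id_comp _).symm
  tgt := h.tgt.trans (Bicategory.Strict.id_comp _).symm
  heq := h.heq.trans (id_whiskerLeft_heq _).symm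

theorem ofId (hS : S ≫ G = F ≫ S') (hT : T ≫ G = F ≫ T') (h : IsOver (𝟙 X) G σ (F ◁ σ')) :
    IsOver F G σ σ' where
  src := hS
  tgt := hT
  heq := h.heq.trans (id_whiskerLeft_heq _)

variable {S'' T'' : X ⟶ Y'}

theorem id_src {σ'' : S'' ⟶ T''} (h : IsOver (𝟙 X) G σ σ'') : S ≫ G = S'' :=
  h.src.trans (Bicategory.Strict.id_comp _)

theorem id_tgt {σ'' : S'' ⟶ T''} (h : IsOver (𝟙 X) G σ σ'') : T ≫ G = T'' :=
  h.tgt.trans (Bicategory.Strict.id_comp _)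

theorem id_heq {σ'' : S'' ⟶ T''} (h : IsOver (𝟙 X) G σ σ'') : σ ▷ G ≍ σ'' :=
  h.heq.trans (id_whiskerLeft_heq _)

theorem of_id_heq {σ'' : S'' ⟶ T''} (hS : S ≫ G = S'') (hT : T ≫ G = T'') (h : σ ▷ G ≍ σ'') :
    IsOver (𝟙 X) G σ σ'' where
  src := hS.trans (Bicategory.Strict.id_comp _).symm
  tgt := hT.trans (Bicategory.Strict.id_comp _).symm
  heq := h.trans (id_whiskerLeft_heq _).symm

theorem exists_of_eq (σ : S ⟶ T) (hS : S ≫ G = S'') (hT : T ≫ G = T'') :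
    ∃ σ'' : S'' ⟶ T'', IsOver (𝟙 X) G σ σ'' := by
  subst hS hT
  exact ⟨σ ▷ G, of_id_heq rfl rfl HEq.rfl⟩

theorem id_unique {σ'' τ'' : S'' ⟶ T''} (h : IsOver (𝟙 X) G σ σ'')
    (h' : IsOver (𝟙 X) G σ τ'') : σ'' = τ'' :=
  eq_of_heq (h.id_heq.symm.trans h'.id_heq)

end IsOver

theorem IsFibrePower.of_isOver {X X' Y' : K} {G : X' ⟶ Y'} {E B P : X ⟶ X'} {E' B' P' : X ⟶ Y'}
    {q : E ⟶ B} {q' : E' ⟶ B'} {n : ℕ} {π : Fin n → (P ⟶ E)} {π' : Fin n → (P' ⟶ E')}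
    (h : IsFibrePower q' π') (hq : IsOver (𝟙 X) G q q') (hP : P ≫ G = P')
    (hπ : ∀ i, IsOver (𝟙 X) G (π i) (π' i)) : IsFibrePower (q ▷ G) (fun i => π i ▷ G) :=
  h.of_heq hq.id_src.symm hq.id_tgt.symm hP.symm hq.id_heq.symm fun i => (hπ i).id_heq.symm

theorem isPullback_of_isOver {X X' Y' : K} {G : X' ⟶ Y'} {P E E' B : X ⟶ X'}
    {P₁ E₁ E₁' B₁ : X ⟶ Y'} {a : P ⟶ E} {b : P ⟶ E'} {f : E ⟶ B} {g : E' ⟶ B} {a' : P₁ ⟶ E₁}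
    {b' : P₁ ⟶ E₁'} {f' : E₁ ⟶ B₁} {g' : E₁' ⟶ B₁} (h : IsPullback a' b' f' g')
    (ha : IsOver (𝟙 X) G a a') (hb : IsOver (𝟙 X) G b b') (hf : IsOver (𝟙 X) G f f')
    (hg : IsOver (𝟙 X) G g g') : IsPullback (a ▷ G) (b ▷ G) (f ▷ G) (g ▷ G) := by
  obtain rfl := ha.id_src
  obtain rfl := ha.id_tgt
  obtain rfl := hb.id_tgt
  obtain rfl := hf.id_tgt
  obtain rfl := eq_of_heq ha.id_heq
  obtain rfl := eq_of_heq hb.id_heq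
  obtain rfl := eq_of_heq hf.id_heq
  obtain rfl := eq_of_heq hg.id_heq
  exact h

/-- `b'` is the image of `b` along `F` and `G` (the zero morphisms are not compared). -/
structure IsBundleOver {X X' Y Y' : K} (F : X ⟶ Y) (G : X' ⟶ Y') {E B : X ⟶ X'} {E' B' : Y ⟶ Y'}
    {q : E ⟶ B} {q' : E' ⟶ B'} (b : BundleData q) (b' : BundleData q') : Prop where
  q : IsOver F G q q'
  proj : ∀ i, IsOver F G (b.proj i) (b'.proj i)
  add : IsOver F G b.add b'.add

namespace IsBundleOver

variable {X X' X'' Y Y' Y'' : K} {F : X ⟶ Y} {G : X' ⟶ Y'} {E B : X ⟶ X'} {E' B' : Y ⟶ Y'}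
  {q : E ⟶ B} {q' : E' ⟶ B'} {b : BundleData q} {b' : BundleData q'}

theorem toId (h : IsBundleOver F G b b') : IsBundleOver (𝟙 X) G b (b'.pre F) where
  q := h.q.toId
  proj i := (h.proj i).toId
  add := h.add.toId

theorem post (h : IsBundleOver F G b b') {H : X'' ⟶ Y''} {A : X' ⟶ X''} {A' : Y' ⟶ Y''}
    (hA : A ≫ H = G ≫ A') : IsBundleOver F H (b.post A) (b'.post A') where
  q := h.q.whiskerRight hA
  proj i := (h.proj i).whiskerRight hA
  add := h.add.whiskerRight hA

theorem pre (h : IsBundleOver F G b b') {H : X'' ⟶ Y''} {A : X'' ⟶ X} {A' : Y'' ⟶ Y}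
    (hA : A ≫ F = H ≫ A') : IsBundleOver H G (b.pre A) (b'.pre A') where
  q := h.q.whiskerLeft hA
  proj i := (h.proj i).whiskerLeft hA
  add := h.add.whiskerLeft hA

theorem isSum {E' B' : X ⟶ Y'} {q' : E' ⟶ B'} {b' : BundleData q'}
    (h : IsBundleOver (𝟙 X) G b b') {A : X ⟶ X'} {x y r : A ⟶ E} {A' : X ⟶ Y'} {x' y' r' : A' ⟶ E'}
    (hx : IsOver (𝟙 X) G x x') (hy : IsOver (𝟙 X) G y y') (hr : IsOver (𝟙 X) G r r')
    (hs : b.IsSum x y r) : b'.IsSum x' y' r' := by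
  obtain ⟨m, rfl, rfl, rfl⟩ := hs
  obtain ⟨m', hm⟩ := IsOver.exists_of_eq m hx.id_src (h.proj 0).id_src
  exact ⟨m', (hm.comp (h.proj 0)).id_unique hx, (hm.comp (h.proj 1)).id_unique hy,
    (hm.comp h.add).id_unique hr⟩

/-- The image of `r` is again a sum of the images of `x` and `y`, and sums in `b'.pre F` are unique.
-/
theorem isOver_of_isSum (h : IsBundleOver F G b b') (hb' : IsFibrePower (F ◁ q') (b'.pre F).proj)
    {A : X ⟶ X'} {x y r : A ⟶ E} {A' : Y ⟶ Y'} {x' y' r' : A' ⟶ E'} (hx : IsOver F G x x')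
    (hy : IsOver F G y y') (hs : b.IsSum x y r) (hs' : b'.IsSum x' y' r') : IsOver F G r r' := by
  obtain ⟨t, ht⟩ := IsOver.exists_of_eq r hx.src hx.tgt
  obtain rfl := (h.toId.isSum hx.toId hy.toId ht hs).unique hb' (hs'.pre F)
  exact .ofId hx.src hx.tgt ht

end IsBundleOver

namespace IsTwoFibrePower

variable {E B P : K} {q : E ⟶ B} {N : ℕ} {π : Fin N → (P ⟶ E)}

theorem hom_ext (hP : IsTwoFibrePower q π) {A : K} {h h' : A ⟶ P} (H : ∀ i, h ≫ π i = h' ≫ π i) :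
    h = h' := by
  obtain ⟨_, _, hu⟩ := hP.existsUnique_lift (fun i => h' ≫ π i)
    (fun i j => by rw [Bicategory.Strict.assoc, Bicategory.Strict.assoc, hP.comm i j])
  exact (hu h H).trans (hu h' fun _ => rfl).symm

theorem exists_lift₂ (hP : IsTwoFibrePower q π) {A : K} {h h' : A ⟶ P} {f f' : Fin N → (A ⟶ E)}
    (hf : ∀ i, h ≫ π i = f i) (hf' : ∀ i, h' ≫ π i = f' i) (θ : ∀ i, f i ⟶ f' i)
    (hθ : ∀ i j, θ i ▷ q ≍ θ j ▷ q) :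
    ∃ Θ : h ⟶ h', ∀ i, IsOver (𝟙 A) (π i) Θ (θ i) := by
  obtain rfl : (fun i => h ≫ π i) = f := funext hf
  obtain rfl : (fun i => h' ≫ π i) = f' := funext hf'
  obtain ⟨Θ, hΘ, -⟩ := hP.existsUnique_lift₂ h h' θ (fun i j => by
    have e (h : A ⟶ P) : (h ≫ π i) ≫ q = (h ≫ π j) ≫ q := by
      rw [Bicategory.Strict.assoc, Bicategory.Strict.assoc, hP.comm i j]
    have e' := (conj_eqToHom_iff_heq _ _ (e h) (e h')).2 (hθ i j)
    rw [e']
    simp [Bicategory.Strict.associator_eqToIso, whiskerLeft_eqToHom])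
  exact ⟨Θ, fun i => .of_id_heq rfl rfl (heq_of_eq (hΘ i))⟩

/-- The sum of `x` and `y` exists because their projections agree componentwise. Its components are
the prescribed sums, so joint faithfulness identifies it with `r`. -/
theorem isSum_of_isOver (hP : IsTwoFibrePower q π) {A : K} {E₀ B₀ : A ⟶ P} {p : E₀ ⟶ B₀}
    {b : BundleData p} (hb : IsFibrePower p b.proj) {E₁ B₁ : Fin N → (A ⟶ E)}
    {p' : ∀ i, E₁ i ⟶ B₁ i} {b' : ∀ i, BundleData (p' i)}
    (hb' : ∀ i, IsFibrePower (p' i) (b' i).proj)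
    (hbb' : ∀ i, IsBundleOver (𝟙 A) (π i) b (b' i)) {S : A ⟶ P} {x y r : S ⟶ E₀}
    {S' : Fin N → (A ⟶ E)} {x' y' r' : ∀ i, S' i ⟶ E₁ i} (hx : ∀ i, IsOver (𝟙 A) (π i) x (x' i))
    (hy : ∀ i, IsOver (𝟙 A) (π i) y (y' i)) (hr : ∀ i, IsOver (𝟙 A) (π i) r (r' i))
    (hs : ∀ i, (b' i).IsSum (x' i) (y' i) (r' i)) : b.IsSum x y r := by
  obtain ⟨t, ht⟩ := BundleData.exists_isSum hb x y (hP.eq_of_isOver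
    (fun i => (hx i).comp (hbb' i).q)
    (fun i => (hs i).proj_eq (hb' i) ▸ (hy i).comp (hbb' i).q))
  obtain rfl : r = t := hP.eq_of_isOver hr fun i => by
    obtain ⟨t', ht'⟩ := IsOver.exists_of_eq t (hr i).id_src (hr i).id_tgt
    obtain rfl := ((hbb' i).isSum (hx i) (hy i) ht' ht).unique (hb' i) (hs i)
    exact ht'
  exact ht

end IsTwoFibrePower

end

section

/-! ### The tangentad on a 2-fibre power -/

variable {K : Type u} [Bicategory.{w, v} K]

theorem BundleData.IsSum.of_hom {C : Type u} [Category.{v} C] {E B : C} {q : E ⟶ B}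
    {b b' : BundleData q} (hb : IsFibrePower q b.proj) (hb' : IsFibrePower q b'.proj)
    (i : b'.pow2 ⟶ b.pow2) (hi : ∀ j, i ≫ b.proj j = b'.proj j) (hi' : i ≫ b.add = b'.add) {A : C}
    {x y r : A ⟶ E} (h : b.IsSum x y r) : b'.IsSum x y r := by
  obtain ⟨t, m, h₀, h₁, h₂⟩ := exists_isSum hb' x y (h.proj_eq hb)
  have ht : b.IsSum x y t := ⟨m ≫ i, by simp [hi, h₀], by simp [hi, h₁], by simp [hi', h₂]⟩
  rw [h.unique hb ht]
  exact ⟨m, h₀, h₁, h₂⟩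

variable [Bicategory.Strict K]

theorem IsOver.castTgt {X X' Y' : K} {G : X' ⟶ Y'} {S T : X ⟶ X'} (σ : S ⟶ T) {T'' : X ⟶ Y'}
    (h : T ≫ G = T'') : IsOver (𝟙 X) G σ (σ ▷ G ≫ CategoryTheory.eqToHom h) :=
  .of_id_heq rfl h (comp_eqToHom_heq _ _).symm

theorem IsOver.refl {X Y : K} {S T : X ⟶ Y} (σ : S ⟶ T) : IsOver (𝟙 X) (𝟙 Y) σ σ where
  src := (Bicategory.Strict.comp_id _).trans (Bicategory.Strict.id_comp _).symm
  tgt := (Bicategory.Strict.comp_id _).trans (Bicategory.Strict.id_comp _).symm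
  heq := (whiskerRight_id_heq _).trans (id_whiskerLeft_heq _).symm

/-- A strict tangent morphism is a 1-morphism which strictly preserves the structure. -/
def StrictMorphism.ofIsOver {X Y : Tangentad K} (F : X.X ⟶ Y.X) (hp : IsOver F F X.p Y.p)
    (hz : IsOver F F X.bundle.zero Y.bundle.zero) (hl : IsOver F F X.l Y.l)
    (hc : IsOver F F X.c Y.c)
    (hs : (Y.bundle.pre F).IsSum (X.bundle.proj 0 ▷ F ≫ eqToHom hp.src)
      (X.bundle.proj 1 ▷ F ≫ eqToHom hp.src) (X.bundle.add ▷ F ≫ eqToHom hp.src)) :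
    StrictMorphism X Y where
  F := F
  eq := hp.src
  isLaxLaw :=
    { additive := by
        refine .of_isSum ?_ ?_ hs
        · simpa only [Bicategory.Strict.leftUnitor_eqToIso, Bicategory.Strict.rightUnitor_eqToIso,
            eqToIso.hom, eqToIso.inv, eqToHom_trans] using hp.comm
        · simpa only [BundleData.post, BundleData.pre, Bicategory.Strict.leftUnitor_eqToIso,
            Bicategory.Strict.rightUnitor_eqToIso, eqToIso.hom, eqToIso.inv, eqToHom_trans]
            using hz.comm.symm
      lift := by
        rw [sqLaw_eqToHom]
        exact hl.comm.symm
      flip := by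
        rw [sqLaw_eqToHom]
        exact hc.comm.symm }

namespace IsPointwisePower

variable {X : K} {T : X ⟶ X} {p : T ⟶ 𝟙 X} {n : ℕ} {N : X ⟶ X} {π : Fin n → (N ⟶ T)}

theorem whiskerLeft_whiskerRight (h : IsPointwisePower p π) {Y : K} (F : Y ⟶ X) :
    IsFibrePower (F ◁ (p ▷ T)) (fun i => F ◁ (π i ▷ T)) :=
  (h.post F).of_heq (Bicategory.Strict.assoc ..) (Bicategory.Strict.assoc ..)
    (Bicategory.Strict.assoc ..) (whisker_assoc_heq _ _ _) fun _ => whisker_assoc_heq _ _ _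

theorem whiskerLeft_whiskerLeft (h : IsPointwisePower p π) {Y : K} (F : Y ⟶ X) :
    IsFibrePower (F ◁ (T ◁ p)) (fun i => F ◁ (T ◁ π i)) :=
  (h.pre (F ≫ T)).of_heq (Bicategory.Strict.assoc ..) (Bicategory.Strict.assoc ..)
    (Bicategory.Strict.assoc ..) (comp_whiskerLeft_heq _ _ _) fun _ => comp_whiskerLeft_heq _ _ _

/-- Since `G` commutes with the iterates of the endomorphisms, the image under `G` is the fibre
power downstairs taken at `F ≫ G`. -/
theorem isFibrePower_whiskerRight {X' : K} {T' : X' ⟶ X'} {p' : T' ⟶ 𝟙 X'} {N' : X' ⟶ X'}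
    {π' : Fin n → (N' ⟶ T')} (h : IsPointwisePower p' π') {G : X ⟶ X'} (hp : IsOver G G p p')
    (hN : N ≫ G = G ≫ N') (hπ : ∀ i, IsOver G G (π i) (π' i)) {Y : K} (F : Y ⟶ X) (k : ℕ) :
    IsFibrePower (((F ◁ p) ▷ iter T k) ▷ G) (fun i => ((F ◁ π i) ▷ iter T k) ▷ G) := by
  have hT : iter T k ≫ G = G ≫ iter T' k := by
    induction k with
    | zero => exact (Bicategory.Strict.id_comp _).trans (Bicategory.Strict.comp_id _).symm
    | succ k ih =>
      rw [iter, iter, Bicategory.Strict.assoc, hp.src, ← Bicategory.Strict.assoc, ih,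
        Bicategory.Strict.assoc]
  have hF : F ≫ G = 𝟙 Y ≫ (F ≫ G) := (Bicategory.Strict.id_comp _).symm
  refine (h.isFibrePower (F ≫ G) k).of_isOver ((hp.whiskerLeft hF).whiskerRight hT) ?_
    fun i => ((hπ i).whiskerLeft hF).whiskerRight hT
  rw [Bicategory.Strict.assoc, hT, ← Bicategory.Strict.assoc, Bicategory.Strict.assoc F, hN,
    Bicategory.Strict.assoc F G]

end IsPointwisePower

namespace Tangentad

/-- The same tangentad, with another choice of the 2-fold pullback of the projection. -/
def withPow2 (X : Tangentad K) {L : X.X ⟶ X.X} {ν : Fin 2 → (L ⟶ X.T)} (hν : IsFibrePower X.p ν)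
    (i : L ≅ X.bundle.pow2) (hi : ∀ j, i.hom ≫ X.bundle.proj j = ν j) : Tangentad K where
  X := X.X
  T := X.T
  p := X.p
  bundle := ⟨L, ν, X.bundle.zero, i.hom ≫ X.bundle.add⟩
  l := X.l
  c := X.c
  exists_fibrePower := X.exists_fibrePower
  isAdditiveBundle := by
    have hb := X.isAdditiveBundle
    have h {A : X.X ⟶ X.X} {x y r : A ⟶ X.T} :
        BundleData.IsSum (q := X.p) ⟨L, ν, X.bundle.zero, i.hom ≫ X.bundle.add⟩ x y r ↔
          X.bundle.IsSum x y r :=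
      ⟨.of_hom (b := ⟨L, ν, X.bundle.zero, i.hom ≫ X.bundle.add⟩) hν hb.isFibrePower i.inv
        (fun j => by simp [← hi]) (by simp), .of_hom hb.isFibrePower hν i.hom hi rfl⟩
    exact
      { exists_fibrePower := hb.exists_fibrePower
        isFibrePower := hν
        zero_proj := hb.zero_proj
        add_proj := by
          dsimp only
          rw [Category.assoc, hb.add_proj, reassoc_of% hi]
        add_assoc x y t xy yt r h₁ h₂ h₃ :=
          h.2 (hb.add_assoc x y t xy yt r (h.1 h₁) (h.1 h₂) (h.1 h₃))
        zero_add := h.2 hb.zero_add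
        add_comm x y r h₁ := h.2 (hb.add_comm x y r (h.1 h₁)) }
  lift_additive := by
    have hp := X.isPointwisePower_proj
    have hν' := X.isPointwisePower_of_isFibrePower two_pos hν
    refine .of_isSum X.lift_additive.proj X.lift_additive.zero ?_
    refine .of_hom (b := X.bundle.post X.T) hp.postT hν'.postT (i.hom ▷ X.T)
      (fun j => ((comp_whiskerRight ..).symm.trans (congrArg (· ▷ X.T) (hi j))))
      (comp_whiskerRight ..).symm ?_
    have h := (X.lift_additive.isSum X.bundle.isSum_proj).comp i.hom
    rw [reassoc_of% hi, reassoc_of% hi] at h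
    rwa [Category.assoc]
  flip_additive := by
    have hp := X.isPointwisePower_proj
    have hν' := X.isPointwisePower_of_isFibrePower two_pos hν
    refine .of_isSum X.flip_additive.proj X.flip_additive.zero ?_
    refine .of_hom (b := X.bundle.pre X.T) (hp.pre _) (hν'.pre _) (X.T ◁ i.hom)
      (fun j => ((whiskerLeft_comp ..).symm.trans (congrArg (X.T ◁ ·) (hi j))))
      (whiskerLeft_comp ..).symm ?_
    have h := (X.flip_additive.isSum (X.bundle.isSum_proj.post X.T)).comp (i.hom ▷ X.T)
    simp only [← comp_whiskerRight_assoc, hi] at h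
    exact h
  lift_coassoc := X.lift_coassoc
  lift_flip := X.lift_flip
  lift_flip_flip := X.lift_flip_flip
  flip_flip := X.flip_flip
  flip_braid := X.flip_braid
  lift_universal := by
    obtain ⟨μ, hμ, hμ'⟩ := X.lift_universal
    have hp := X.isPointwisePower_proj
    have hν' := X.isPointwisePower_of_isFibrePower two_pos hν
    refine ⟨i.hom ≫ μ, ?_, fun {Y} F => ?_⟩
    · refine .of_hom (b := X.bundle.post X.T) hp.postT hν'.postT (i.hom ▷ X.T)
        (fun j => ((comp_whiskerRight ..).symm.trans (congrArg (· ▷ X.T) (hi j))))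
        (comp_whiskerRight ..).symm ?_
      have h := hμ.comp i.hom
      rwa [reassoc_of% hi, reassoc_of% hi] at h
    · refine (hμ' F).of_iso (whiskerLeftIso F i).symm (Iso.refl _) (Iso.refl _) (Iso.refl _) ?_ ?_
        ?_ ?_
      · simp
      · simp [← hi]
      · simp
      · simp

section

variable (X : Tangentad K) {L : X.X ⟶ X.X} {ν : Fin 2 → (L ⟶ X.T)} (hν : IsFibrePower X.p ν)
  (i : L ≅ X.bundle.pow2) (hi : ∀ j, i.hom ≫ X.bundle.proj j = ν j)

/-- The comparison of `X.withPow2` with `X`. -/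
def withPow2To : StrictMorphism (X.withPow2 hν i hi) X :=
  .ofIsOver (𝟙 X.X) (.refl X.p) (.refl X.bundle.zero) (.refl X.l) (.refl X.c) (by
    have h := ((X.bundle.isSum_proj.comp i.hom).pre (𝟙 X.X)).comp
      (eqToHom ((Bicategory.Strict.comp_id L).trans (Bicategory.Strict.id_comp L).symm))
    have e (σ : L ⟶ X.T) := (IsOver.refl σ).comm
    rw [e, e, e, hi, hi] at h
    exact h)

/-- The comparison of `X` with `X.withPow2`. -/
def toWithPow2 : StrictMorphism X (X.withPow2 hν i hi) :=
  .ofIsOver (𝟙 X.X) (.refl X.p) (.refl X.bundle.zero) (.refl X.l) (.refl X.c) (by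
    have h₀ : BundleData.IsSum (q := X.p) ⟨L, ν, X.bundle.zero, i.hom ≫ X.bundle.add⟩
        (X.bundle.proj 0) (X.bundle.proj 1) X.bundle.add :=
      ⟨i.inv, by simp [← hi], by simp [← hi], by simp⟩
    have h := (h₀.pre (𝟙 X.X)).comp
      (eqToHom ((Bicategory.Strict.comp_id _).trans (Bicategory.Strict.id_comp _).symm))
    have e (σ : X.bundle.pow2 ⟶ X.T) := (IsOver.refl σ).comm
    rw [e, e, e] at h
    exact h)

end

end Tangentad

end

/-! ### Lifting the tangent structure to a 2-fibre power -/

section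

variable {K : Type u} [Bicategory.{w, v} K]

/-- The structure 2-morphisms of a tangentad on `P`, lying over those of `E` along a family of
1-morphisms `π j : P ⟶ E`. -/
structure TangentLift (E : Tangentad K) {P : K} {N : ℕ} (π : Fin N → (P ⟶ E.X)) where
  T : P ⟶ P
  p : T ⟶ 𝟙 P
  bundle : BundleData p
  l : T ⟶ T ≫ T
  c : T ≫ T ⟶ T ≫ T
  isBundleOver : ∀ j, IsBundleOver (π j) (π j) bundle E.bundle
  zero_over : ∀ j, IsOver (π j) (π j) bundle.zero E.bundle.zero
  l_over : ∀ j, IsOver (π j) (π j) l E.l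
  c_over : ∀ j, IsOver (π j) (π j) c E.c

theorem TangentLift.eq {E : Tangentad K} {P : K} {N : ℕ} {π : Fin N → (P ⟶ E.X)}
    (D : TangentLift E π) (j : Fin N) : D.T ≫ π j = π j ≫ E.T :=
  (D.isBundleOver j).q.src

variable [Bicategory.Strict K]

namespace IsTwoFibrePower

variable {E B P : K} {q : E ⟶ B} {N : ℕ} {π : Fin N → (P ⟶ E)}

theorem exists_lift_endo (hP : IsTwoFibrePower q π) {S : E ⟶ E} {R : B ⟶ B}
    (h : S ≫ q = q ≫ R) : ∃ S' : P ⟶ P, ∀ j, S' ≫ π j = π j ≫ S :=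
  hP.exists_lift _ fun i j => by
    rw [Bicategory.Strict.assoc, Bicategory.Strict.assoc, h, ← Bicategory.Strict.assoc,
      ← Bicategory.Strict.assoc, hP.comm i j]

/-- The components `π j ◁ σ` agree over the base because `q` carries each of them to `σ'` whiskered
with `π j ≫ q`, which does not depend on `j`. -/
theorem exists_lift_isOver (hP : IsTwoFibrePower q π) {S T : E ⟶ E} {S' T' : B ⟶ B} {σ : S ⟶ T}
    {σ' : S' ⟶ T'} (h : IsOver q q σ σ') {S₀ T₀ : P ⟶ P} (hS : ∀ j, S₀ ≫ π j = π j ≫ S)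
    (hT : ∀ j, T₀ ≫ π j = π j ≫ T) : ∃ σ₀ : S₀ ⟶ T₀, ∀ j, IsOver (π j) (π j) σ₀ σ := by
  obtain ⟨Θ, hΘ⟩ := hP.exists_lift₂ hS hT (fun j => π j ◁ σ) fun i j => by
    have e (i) := (h.whiskerLeft (A := π i) (Bicategory.Strict.id_comp (π i ≫ q)).symm).id_heq
    exact (e i).trans ((whiskerLeft_heq rfl rfl (hP.comm i j) HEq.rfl).trans (e j).symm)
  exact ⟨Θ, fun j => .ofId (hS j) (hT j) (hΘ j)⟩

theorem isSum_of_isOver' (hP : IsTwoFibrePower q π) {A Y : K} {F : ∀ _ : Fin N, A ⟶ Y}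
    {E₀ B₀ : A ⟶ P} {p : E₀ ⟶ B₀} {b : BundleData p} (hb : IsFibrePower p b.proj) {E₁ B₁ : Y ⟶ E}
    {p' : E₁ ⟶ B₁} {b' : BundleData p'} (hb' : ∀ i, IsFibrePower (F i ◁ p') (b'.pre (F i)).proj)
    (hbb' : ∀ i, IsBundleOver (F i) (π i) b b') {S : A ⟶ P} {x y r : S ⟶ E₀} {S' : Y ⟶ E}
    {x' y' r' : S' ⟶ E₁} (hx : ∀ i, IsOver (F i) (π i) x x') (hy : ∀ i, IsOver (F i) (π i) y y')
    (hr : ∀ i, IsOver (F i) (π i) r r') (hs : b'.IsSum x' y' r') : b.IsSum x y r :=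
  hP.isSum_of_isOver hb hb' (fun i => (hbb' i).toId) (fun i => (hx i).toId)
    (fun i => (hy i).toId) (fun i => (hr i).toId) fun i => hs.pre (F i)

/-- This is how an induced 1-morphism into the 2-fibre power inherits strict preservation of
structure from its components. -/
theorem isOver_lift (hP : IsTwoFibrePower q π) {A : K} {h : A ⟶ P} {f : Fin N → (A ⟶ E)}
    (hh : ∀ j, h ≫ π j = f j) {S T : A ⟶ A} {σ : S ⟶ T} {S' T' : P ⟶ P} {σ' : S' ⟶ T'}
    {S'' T'' : E ⟶ E} {σ'' : S'' ⟶ T''} (hσ : ∀ j, IsOver (f j) (f j) σ σ'')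
    (hσ' : ∀ j, IsOver (π j) (π j) σ' σ'') : IsOver h h σ σ' := by
  obtain rfl : (fun j => h ≫ π j) = f := funext hh
  have hS : S ≫ h = h ≫ S' := hP.hom_ext fun j => by
    rw [Bicategory.Strict.assoc, (hσ j).src, Bicategory.Strict.assoc, Bicategory.Strict.assoc,
      (hσ' j).src, ← Bicategory.Strict.assoc]
  have hT : T ≫ h = h ≫ T' := hP.hom_ext fun j => by
    rw [Bicategory.Strict.assoc, (hσ j).tgt, Bicategory.Strict.assoc, Bicategory.Strict.assoc,
      (hσ' j).tgt,
      ← Bicategory.Strict.assoc]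
  refine .of_comm hS hT (hP.hom_ext₂ fun j => eq_of_heq ?_)
  rw [comp_whiskerRight, comp_whiskerRight, eqToHom_whiskerRight, eqToHom_whiskerRight]
  refine (eqToHom_comp_heq _ _).trans (HEq.trans ?_ (comp_eqToHom_heq _ _).symm)
  exact ((hσ' j).whiskerLeft (Bicategory.Strict.id_comp _).symm).id_heq.trans
    ((hσ j).heq.symm.trans (whiskerRight_comp_heq _ _ _))

end IsTwoFibrePower

/-- Every pointwise fibre power of the projection of `B` lifts strictly along `U`. -/
def LiftsPowers {E B : Tangentad K} (U : StrictMorphism E B) : Prop :=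
  ∀ n : ℕ, 0 < n → ∃ (L : E.X ⟶ E.X) (ν : Fin n → (L ⟶ E.T)) (M : B.X ⟶ B.X)
    (μ : Fin n → (M ⟶ B.T)), IsPointwisePower E.p ν ∧ IsPointwisePower B.p μ ∧
      ∀ i, IsOver U.F U.F (ν i) (μ i)

namespace StrictMorphism

variable {E B : Tangentad K} (U : StrictMorphism E B)

/-- If `U` strictly preserves the 2-fold pullback of the projection, it strictly preserves the
sum. -/
theorem isBundleOver (h : ∀ i, IsOver U.F U.F (E.bundle.proj i) (B.bundle.proj i)) :
    IsBundleOver U.F U.F E.bundle B.bundle where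
  q := U.isOver_p
  proj := h
  add := by
    refine .of_comm (h 0).src U.eq ?_
    have h₁ := (B.bundle.isSum_proj.pre U.F).comp (eqToHom (h 0).src)
    have h₂ := U.toLax.isSum E.bundle.isSum_proj
    rw [(h 0).comm, (h 1).comm] at h₁
    exact h₁.unique (B.isPointwisePower_proj.pre U.F) h₂

end StrictMorphism

namespace TangentLift

variable {E B : Tangentad K} {U : StrictMorphism E B} {P : K} {N : ℕ} {π : Fin N → (P ⟶ E.X)}

theorem nonempty (hU : IsBundleOver U.F U.F E.bundle B.bundle)
    (hP : IsTwoFibrePower U.F π) : Nonempty (TangentLift E π) := by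
  have hid (j) : 𝟙 P ≫ π j = π j ≫ 𝟙 E.X :=
    (Bicategory.Strict.id_comp _).trans (Bicategory.Strict.comp_id _).symm
  obtain ⟨T, hT⟩ := hP.exists_lift_endo U.eq
  have hTT (j) : (T ≫ T) ≫ π j = π j ≫ (E.T ≫ E.T) := by
    rw [Bicategory.Strict.assoc, hT, ← Bicategory.Strict.assoc, hT, Bicategory.Strict.assoc]
  obtain ⟨L, hL⟩ := hP.exists_lift_endo (hU.proj 0).src
  obtain ⟨p, hp⟩ := hP.exists_lift_isOver hU.q hT hid
  obtain ⟨z, hz⟩ := hP.exists_lift_isOver U.isOver_zero hid hT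
  choose pr hpr using fun i => hP.exists_lift_isOver (hU.proj i) hL hT
  obtain ⟨s, hs⟩ := hP.exists_lift_isOver hU.add hL hT
  obtain ⟨l, hl⟩ := hP.exists_lift_isOver U.isOver_l hT hTT
  obtain ⟨c, hc⟩ := hP.exists_lift_isOver U.isOver_c hTT hTT
  exact ⟨⟨T, p, ⟨L, pr, z, s⟩, l, c, fun j => ⟨hp j, fun i => hpr i j, hs j⟩, hz, hl, hc⟩⟩

section

variable (D : TangentLift E π)

theorem isPointwisePower (hP : IsTwoFibrePower U.F π) {n : ℕ} {L : E.X ⟶ E.X}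
    {ν : Fin n → (L ⟶ E.T)} {M : B.X ⟶ B.X} {μ : Fin n → (M ⟶ B.T)}
    (hν : IsPointwisePower E.p ν) (hμ : IsPointwisePower B.p μ) (hLM : L ≫ U.F = U.F ≫ M)
    (hνμ : ∀ i, IsOver U.F U.F (ν i) (μ i)) {L₀ : P ⟶ P} (hL : ∀ j, L₀ ≫ π j = π j ≫ L)
    {ψ : Fin n → (L₀ ⟶ D.T)} (hψ : ∀ i j, IsOver (π j) (π j) (ψ i) (ν i)) :
    IsPointwisePower D.p ψ where
  isFibrePower F k := by
    refine hP.isFibrePower (fun j => ?_) (fun j => ?_)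
    · exact hν.isFibrePower_whiskerRight (D.isBundleOver j).q (hL j) (fun i => hψ i j) F k
    · refine hμ.isFibrePower_whiskerRight ((D.isBundleOver j).q.paste U.isOver_p) ?_
        (fun i => (hψ i j).paste (hνμ i)) F k
      rw [← Bicategory.Strict.assoc, hL, Bicategory.Strict.assoc, hLM, Bicategory.Strict.assoc]

theorem isPointwisePower_proj (hP : IsTwoFibrePower U.F π)
    (hU : IsBundleOver U.F U.F E.bundle B.bundle) :
    IsPointwisePower D.p D.bundle.proj :=
  D.isPointwisePower hP E.isPointwisePower_proj B.isPointwisePower_proj (hU.proj 0).src hU.proj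
    (fun j => ((D.isBundleOver j).proj 0).src) fun i j => (D.isBundleOver j).proj i

theorem isAdditiveBundle (hP : IsTwoFibrePower U.F π)
    (hU : IsBundleOver U.F U.F E.bundle B.bundle) (hcr : LiftsPowers U) :
    D.bundle.IsAdditiveBundle where
  exists_fibrePower n hn := by
    obtain ⟨L, ν, M, μ, hν, hμ, hνμ⟩ := hcr n hn
    obtain ⟨L₀, hL⟩ := hP.exists_lift_endo (hνμ ⟨0, hn⟩).src
    choose ψ hψ using fun i => hP.exists_lift_isOver (hνμ i) hL D.eq
    exact ⟨L₀, ψ, (D.isPointwisePower hP hν hμ (hνμ ⟨0, hn⟩).src hνμ hL hψ).base⟩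
  isFibrePower := (D.isPointwisePower_proj hP hU).base
  zero_proj := hP.eq_of_isOver (fun j => (D.zero_over j).comp (D.isBundleOver j).q) fun j => by
    rw [E.isAdditiveBundle.zero_proj]
    exact .id (D.isBundleOver j).q.tgt
  add_proj := hP.eq_of_isOver (fun j => (D.isBundleOver j).add.comp (D.isBundleOver j).q)
    fun j => by
      rw [E.isAdditiveBundle.add_proj]
      exact ((D.isBundleOver j).proj 0).comp (D.isBundleOver j).q
  add_assoc {A} x y t xy yt r hxy hyt hr := by
    have ho (j) (x : A ⟶ D.T) := IsOver.castTgt x (D.eq j)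
    have hb := (D.isPointwisePower_proj hP hU).base
    have hs (j) {x y r : A ⟶ D.T} (h : D.bundle.IsSum x y r) :=
      (D.isBundleOver j).toId.isSum (ho j x) (ho j y) (ho j r) h
    exact hP.isSum_of_isOver hb (fun j => E.isPointwisePower_proj.pre (π j))
      (fun j => (D.isBundleOver j).toId) (fun j => ho j x) (fun j => ho j yt) (fun j => ho j r)
      fun j => (E.isAdditiveBundle_pre (π j)).add_assoc _ _ _ _ _ _ (hs j hxy) (hs j hyt) (hs j hr)
  zero_add := hP.isSum_of_isOver' (D.isPointwisePower_proj hP hU).base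
    (fun j => E.isPointwisePower_proj.pre (π j)) D.isBundleOver
    (fun j => (D.isBundleOver j).q.comp (D.zero_over j)) (fun j => .id (D.eq j))
    (fun j => .id (D.eq j)) E.isAdditiveBundle.zero_add
  add_comm {A} x y r h := by
    have ho (j) (x : A ⟶ D.T) := IsOver.castTgt x (D.eq j)
    exact hP.isSum_of_isOver (D.isPointwisePower_proj hP hU).base
      (fun j => E.isPointwisePower_proj.pre (π j))
      (fun j => (D.isBundleOver j).toId) (fun j => ho j y) (fun j => ho j x) (fun j => ho j r)
      fun j => (E.isAdditiveBundle_pre (π j)).add_comm _ _ _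
        ((D.isBundleOver j).toId.isSum (ho j x) (ho j y) (ho j r) h)

theorem lift_additive (hP : IsTwoFibrePower U.F π)
    (hU : IsBundleOver U.F U.F E.bundle B.bundle) :
    D.bundle.IsAdditiveMorphism (D.bundle.post D.T)
    (D.bundle.zero ≫ (λ_ D.T).inv) D.l := by
  refine .of_isSum ?_ ?_ ?_
  · refine hP.eq_of_isOver (fun j => (D.l_over j).comp
      ((D.isBundleOver j).q.whiskerRight (D.eq j))) fun j => ?_
    rw [E.lift_additive.proj]
    exact (D.isBundleOver j).q.comp ((D.zero_over j).comp (.leftUnitor_inv (D.eq j)))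
  · refine hP.eq_of_isOver (fun j => (D.zero_over j).comp (D.l_over j)) fun j => ?_
    rw [E.lift_additive.zero]
    exact ((D.zero_over j).comp (.leftUnitor_inv (D.eq j))).comp
      ((D.zero_over j).whiskerRight (D.eq j))
  · exact hP.isSum_of_isOver' (D.isPointwisePower_proj hP hU).postT
      (fun j => E.isPointwisePower_proj.whiskerLeft_whiskerRight (π j))
      (fun j => (D.isBundleOver j).post (D.eq j))
      (fun j => ((D.isBundleOver j).proj 0).comp (D.l_over j))
      (fun j => ((D.isBundleOver j).proj 1).comp (D.l_over j))
      (fun j => (D.isBundleOver j).add.comp (D.l_over j))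
      (E.lift_additive.isSum E.bundle.isSum_proj)

theorem flip_additive (hP : IsTwoFibrePower U.F π)
    (hU : IsBundleOver U.F U.F E.bundle B.bundle) :
    (D.bundle.post D.T).IsAdditiveMorphism (D.bundle.pre D.T)
    ((λ_ D.T).hom ≫ (ρ_ D.T).inv) D.c := by
  refine .of_isSum ?_ ?_ ?_
  · refine hP.eq_of_isOver (fun j => (D.c_over j).comp
      ((D.isBundleOver j).q.whiskerLeft (D.eq j))) fun j => ?_
    rw [E.flip_additive.proj]
    exact ((D.isBundleOver j).q.whiskerRight (D.eq j)).comp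
      ((IsOver.leftUnitor_hom (D.eq j)).comp (.rightUnitor_inv (D.eq j)))
  · refine hP.eq_of_isOver (fun j => ((D.zero_over j).whiskerRight (D.eq j)).comp (D.c_over j))
      fun j => ?_
    have h := E.flip_additive.zero
    simp only [BundleData.post, BundleData.pre] at h
    rw [h]
    exact ((IsOver.leftUnitor_hom (D.eq j)).comp (.rightUnitor_inv (D.eq j))).comp
      ((D.zero_over j).whiskerLeft (D.eq j))
  · exact hP.isSum_of_isOver' ((D.isPointwisePower_proj hP hU).pre D.T)
      (fun j => E.isPointwisePower_proj.whiskerLeft_whiskerLeft (π j))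
      (fun j => (D.isBundleOver j).pre (D.eq j))
      (fun j => (((D.isBundleOver j).proj 0).whiskerRight (D.eq j)).comp (D.c_over j))
      (fun j => (((D.isBundleOver j).proj 1).whiskerRight (D.eq j)).comp (D.c_over j))
      (fun j => ((D.isBundleOver j).add.whiskerRight (D.eq j)).comp (D.c_over j))
      (E.flip_additive.isSum (E.bundle.isSum_proj.post E.T))

theorem lift_universal (hP : IsTwoFibrePower U.F π)
    (hU : IsBundleOver U.F U.F E.bundle B.bundle) :
    ∃ μ : D.bundle.pow2 ⟶ D.T ≫ D.T,
    (D.bundle.post D.T).IsSum (D.bundle.proj 0 ≫ D.l)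
      (D.bundle.proj 1 ≫ (ρ_ D.T).inv ≫ D.T ◁ D.bundle.zero) μ ∧
    ∀ {Y : K} (F : Y ⟶ P), IsPullback (F ◁ μ) (F ◁ (D.bundle.proj 0 ≫ D.p)) (F ◁ (D.p ▷ D.T))
      (F ◁ (D.bundle.zero ≫ (λ_ D.T).inv)) := by
  obtain ⟨μ, hμ, hμ'⟩ := E.lift_universal
  obtain ⟨m, hm, hm'⟩ := B.lift_universal
  have hx := (hU.proj 0).comp U.isOver_l
  have hy := (hU.proj 1).comp
    ((IsOver.rightUnitor_inv U.eq).comp (U.isOver_zero.whiskerLeft U.eq))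
  -- Both 2-morphisms are sums of corresponding elements, so uniqueness of sums places one over the
  -- other; only then can `μ` be lifted to `P`.
  have hμm : IsOver U.F U.F μ m := (hU.post U.eq).isOver_of_isSum
    (B.isPointwisePower_proj.whiskerLeft_whiskerRight U.F) hx hy hμ hm
  have hL (j) : D.bundle.pow2 ≫ π j = π j ≫ E.bundle.pow2 := ((D.isBundleOver j).proj 0).src
  obtain ⟨μ₀, hμ₀⟩ := hP.exists_lift_isOver hμm hL (fun j => (D.l_over j).tgt)
  refine ⟨μ₀, hP.isSum_of_isOver' (D.isPointwisePower_proj hP hU).postT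
      (fun j => E.isPointwisePower_proj.whiskerLeft_whiskerRight (π j))
      (fun j => (D.isBundleOver j).post (D.eq j))
      (fun j => ((D.isBundleOver j).proj 0).comp (D.l_over j))
      (fun j => ((D.isBundleOver j).proj 1).comp
        ((IsOver.rightUnitor_inv (D.eq j)).comp ((D.zero_over j).whiskerLeft (D.eq j))))
      hμ₀ hμ, fun {Y} F => ?_⟩
  have h₁ (j) := ((D.isBundleOver j).proj 0).comp (D.isBundleOver j).q
  have h₂ (j) := (D.isBundleOver j).q.whiskerRight (D.eq j)
  have h₃ (j) := (D.zero_over j).comp (IsOver.leftUnitor_inv (D.eq j))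
  have e (j) : F ≫ π j = 𝟙 Y ≫ (F ≫ π j) := (Bicategory.Strict.id_comp _).symm
  have e' (j) : F ≫ (π j ≫ U.F) = 𝟙 Y ≫ (F ≫ (π j ≫ U.F)) := (Bicategory.Strict.id_comp _).symm
  refine hP.isPullback (fun j => ?_) (fun j => ?_)
  · exact isPullback_of_isOver (hμ' (F ≫ π j)) ((hμ₀ j).whiskerLeft (e j))
      ((h₁ j).whiskerLeft (e j)) ((h₂ j).whiskerLeft (e j)) ((h₃ j).whiskerLeft (e j))
  · exact isPullback_of_isOver (hm' (F ≫ (π j ≫ U.F))) (((hμ₀ j).paste hμm).whiskerLeft (e' j))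
      (((h₁ j).paste ((hU.proj 0).comp hU.q)).whiskerLeft (e' j))
      (((h₂ j).paste (hU.q.whiskerRight U.eq)).whiskerLeft (e' j))
      (((h₃ j).paste (U.isOver_zero.comp (.leftUnitor_inv U.eq))).whiskerLeft (e' j))

end

/-- The tangentad on a 2-fibre power of a strict tangent morphism. -/
def toTangentad (D : TangentLift E π) (hP : IsTwoFibrePower U.F π)
    (hU : IsBundleOver U.F U.F E.bundle B.bundle) (hcr : LiftsPowers U) : Tangentad K where
  X := P
  T := D.T
  p := D.p
  bundle := D.bundle
  l := D.l
  c := D.c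
  exists_fibrePower n hn := by
    obtain ⟨L, ν, M, μ, hν, hμ, hνμ⟩ := hcr n hn
    obtain ⟨L₀, hL⟩ := hP.exists_lift_endo (hνμ ⟨0, hn⟩).src
    choose ψ hψ using fun i => hP.exists_lift_isOver (hνμ i) hL D.eq
    exact ⟨L₀, ψ, (D.isPointwisePower hP hν hμ (hνμ ⟨0, hn⟩).src hνμ hL hψ).isFibrePower⟩
  isAdditiveBundle := D.isAdditiveBundle hP hU hcr
  lift_additive := D.lift_additive hP hU
  flip_additive := D.flip_additive hP hU
  -- For this and the remaining equations, both sides lie over the same 2-morphism of `E` along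
  -- every projection.
  lift_coassoc := hP.eq_of_isOver
    (fun j => (D.l_over j).comp (((D.l_over j).whiskerRight (D.eq j)).comp
      (.associator_hom (D.eq j) (D.eq j) (D.eq j)))) fun j => by
    rw [E.lift_coassoc]
    exact (D.l_over j).comp ((D.l_over j).whiskerLeft (D.eq j))
  lift_flip := hP.eq_of_isOver (fun j => (D.l_over j).comp (D.c_over j)) fun j => by
    rw [E.lift_flip]
    exact D.l_over j
  lift_flip_flip := hP.eq_of_isOver
    (fun j => ((D.l_over j).whiskerLeft (D.eq j)).comp <|
      (IsOver.associator_inv (D.eq j) (D.eq j) (D.eq j)).comp <|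
      ((D.c_over j).whiskerRight (D.eq j)).comp <|
      (IsOver.associator_hom (D.eq j) (D.eq j) (D.eq j)).comp
      ((D.c_over j).whiskerLeft (D.eq j))) fun j => by
    rw [E.lift_flip_flip]
    exact (D.c_over j).comp <| ((D.l_over j).whiskerRight (D.eq j)).comp
      (.associator_hom (D.eq j) (D.eq j) (D.eq j))
  flip_flip := hP.eq_of_isOver (fun j => (D.c_over j).comp (D.c_over j)) fun j => by
    rw [E.flip_flip]
    exact .id (D.c_over j).src
  flip_braid := hP.eq_of_isOver
    (fun j => ((D.c_over j).whiskerRight (D.eq j)).comp <|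
      (IsOver.associator_hom (D.eq j) (D.eq j) (D.eq j)).comp <|
      ((D.c_over j).whiskerLeft (D.eq j)).comp <|
      (IsOver.associator_inv (D.eq j) (D.eq j) (D.eq j)).comp
      ((D.c_over j).whiskerRight (D.eq j))) fun j => by
    rw [E.flip_braid]
    exact (IsOver.associator_hom (D.eq j) (D.eq j) (D.eq j)).comp <|
      ((D.c_over j).whiskerLeft (D.eq j)).comp <|
      (IsOver.associator_inv (D.eq j) (D.eq j) (D.eq j)).comp <|
      ((D.c_over j).whiskerRight (D.eq j)).comp <|
      (IsOver.associator_hom (D.eq j) (D.eq j) (D.eq j)).comp <|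
      ((D.c_over j).whiskerLeft (D.eq j)).comp
      (.associator_inv (D.eq j) (D.eq j) (D.eq j))
  lift_universal := D.lift_universal hP hU

/-- The projections of the tangentad on a 2-fibre power. -/
def toStrict (D : TangentLift E π) (hP : IsTwoFibrePower U.F π)
    (hU : IsBundleOver U.F U.F E.bundle B.bundle) (hcr : LiftsPowers U) (j : Fin N) :
    StrictMorphism (D.toTangentad hP hU hcr) E :=
  .ofIsOver (π j) (D.isBundleOver j).q (D.zero_over j) (D.l_over j) (D.c_over j)
    ((D.isBundleOver j).toId.isSum (.castTgt _ _) (.castTgt _ _) (.castTgt _ _)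
      D.bundle.isSum_proj)

end TangentLift

/-- 2-fibre powers of strict tangent morphisms which lift fibre powers are fibre powers of
tangentads. -/
theorem exists_isFibrePower_tangentad {E B : Tangentad K} (U : E ⟶ B)
    (hU : IsBundleOver (StrictMorphism.F U) (StrictMorphism.F U) E.bundle B.bundle)
    (hcr : LiftsPowers U) {P : K} {N : ℕ} {π : Fin N → (P ⟶ E.X)}
    (hP : IsTwoFibrePower (StrictMorphism.F U) π) :
    ∃ (Q : Tangentad K) (ρ : Fin N → (Q ⟶ E)),
      IsTwoFibrePower (StrictMorphism.F U) (fun i => StrictMorphism.F (ρ i)) ∧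
        IsFibrePower U ρ := by
  obtain ⟨D⟩ := TangentLift.nonempty hU hP
  refine ⟨D.toTangentad hP hU hcr, D.toStrict hP hU hcr, hP,
    fun i j => StrictMorphism.ext (hP.comm i j), fun {A} f hf => ?_⟩
  obtain ⟨h, hh⟩ := hP.exists_lift (fun i => StrictMorphism.F (f i))
    fun i j => congrArg StrictMorphism.F (hf i j)
  have hp := hP.isOver_lift hh (fun j => StrictMorphism.isOver_p (f j))
    fun j => (D.isBundleOver j).q
  -- Preservation of sums by `h` is tested on components, where it is preservation of sums by the
  -- strict morphisms `f j`.
  have hs : (D.bundle.pre h).IsSum (A.bundle.proj 0 ▷ h ≫ eqToHom hp.src)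
      (A.bundle.proj 1 ▷ h ≫ eqToHom hp.src) (A.bundle.add ▷ h ≫ eqToHom hp.src) := by
    have ho (j) (σ : A.bundle.pow2 ⟶ A.T) : IsOver (𝟙 A.X) (π j) (σ ▷ h ≫ eqToHom hp.src)
        (σ ▷ StrictMorphism.F (f j) ≫ eqToHom (StrictMorphism.eq (f j))) := by
      refine .of_id_heq ?_ ?_ ?_
      · rw [Bicategory.Strict.assoc, hh]
      · rw [Bicategory.Strict.assoc, D.eq, ← Bicategory.Strict.assoc, hh]
      · rw [comp_whiskerRight, eqToHom_whiskerRight]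
        refine (comp_eqToHom_heq _ _).trans (HEq.trans ?_ (comp_eqToHom_heq _ _).symm)
        exact (whiskerRight_comp_heq _ _ _).symm.trans
          (whiskerRight_heq rfl rfl (hh j) HEq.rfl)
    refine hP.isSum_of_isOver ((D.isPointwisePower_proj hP hU).pre h)
      (fun j => E.isPointwisePower_proj.pre (StrictMorphism.F (f j)))
      (fun j => ((D.isBundleOver j).pre (H := 𝟙 A.X) (A' := StrictMorphism.F (f j)) ?_))
      (fun j => ho j _) (fun j => ho j _) (fun j => ho j _)
      fun j => (StrictMorphism.toLax (f j)).isSum A.bundle.isSum_proj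
    rw [hh, Bicategory.Strict.id_comp]
  refine ⟨StrictMorphism.ofIsOver (Y := D.toTangentad hP hU hcr) h hp
    (hP.isOver_lift hh (fun j => StrictMorphism.isOver_zero (f j)) D.zero_over)
    (hP.isOver_lift hh (fun j => StrictMorphism.isOver_l (f j)) D.l_over)
    (hP.isOver_lift hh (fun j => StrictMorphism.isOver_c (f j)) D.c_over) hs,
    fun j => StrictMorphism.ext (hh j), fun H hH => StrictMorphism.ext (hP.hom_ext fun j => ?_)⟩
  exact (congrArg StrictMorphism.F (hH j)).trans (hh j).symm

end

section

/-! ### The abelian group bundle of vector fields -/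

theorem IsFibrePower.comp_iso {C : Type u} [Category.{v} C] {E E' B : C} {q : E ⟶ B} (e : E' ≅ E)
    {n : ℕ} {P : C} {π : Fin n → (P ⟶ E')} (h : IsFibrePower (e.hom ≫ q) π) :
    IsFibrePower q (fun i => π i ≫ e.hom) where
  comm i j := by simpa using h.comm i j
  existsUnique_lift f hf := by
    obtain ⟨m, hm⟩ := h.exists_lift (fun i => f i ≫ e.inv) fun i j => by simpa using hf i j
    refine ⟨m, fun i => by simp [reassoc_of% hm i], fun k hk => h.hom_ext fun i => ?_⟩
    rw [hm, ← hk i, Category.assoc, Category.assoc, e.hom_inv_id, Category.comp_id]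

variable {K : Type u} [Bicategory.{w, v} K]

theorem VectorFieldObject.fieldOf_sec {Y : Tangentad K} (V : VectorFieldObject Y) {A : K}
    {H : A ⟶ V.VF.X} {G : A ⟶ Y.X} (h : H ≫ V.U.F = G) :
    V.fieldOf h ≫ G ◁ Y.p ≫ (ρ_ G).hom = 𝟙 G := by
  subst h
  rw [V.fieldOf_rfl]
  calc
    _ = H ◁ (V.v ≫ V.U.F ◁ Y.p ≫ (ρ_ V.U.F).hom) := by
      simp only [pullField]
      bicategory
    _ = _ := by rw [V.sec, whiskerLeft_id]

variable [Bicategory.Strict K]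

/-- The choice of the 2-fold pullback of the projection does not matter. -/
def Tangentad.withPow2Iso (X : Tangentad K) {L : X.X ⟶ X.X} {ν : Fin 2 → (L ⟶ X.T)}
    (hν : IsFibrePower X.p ν) (i : L ≅ X.bundle.pow2) (hi : ∀ j, i.hom ≫ X.bundle.proj j = ν j) :
    X.withPow2 hν i hi ≅ X where
  hom := X.withPow2To hν i hi
  inv := X.toWithPow2 hν i hi
  hom_inv_id := StrictMorphism.ext (Bicategory.Strict.id_comp (𝟙 X.X))
  inv_hom_id := StrictMorphism.ext (Bicategory.Strict.id_comp (𝟙 X.X))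

theorem BundleData.IsSum.pre_comp {X Y Z Z' : K} {E B : X ⟶ Y} {q : E ⟶ B} {b : BundleData q}
    {F : Z' ⟶ Z} {G : Z ⟶ X} {G' : Z' ⟶ X} {S : Z ⟶ Y} {S' : Z' ⟶ Y} {x y r : S ⟶ G ≫ E}
    {x' y' r' : S' ⟶ G' ≫ E} (h : (b.pre G).IsSum x y r) (hG : F ≫ G = G') (hS : F ≫ S = S')
    (hx : x' ≍ F ◁ x) (hy : y' ≍ F ◁ y) (hr : r' ≍ F ◁ r) : (b.pre G').IsSum x' y' r' := by
  subst hG hS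
  obtain ⟨m, rfl, rfl, rfl⟩ := h
  have key {m : S ⟶ G ≫ b.pow2} {τ : b.pow2 ⟶ E} {t : F ≫ S ⟶ (F ≫ G) ≫ E}
      (ht : t ≍ F ◁ (m ≫ G ◁ τ)) : (F ◁ m ≫ (α_ F G b.pow2).inv) ≫ (F ≫ G) ◁ τ = t := by
    refine eq_of_heq (HEq.trans ?_ ht.symm)
    rw [whiskerLeft_comp, Category.assoc, comp_whiskerLeft, Iso.inv_hom_id_assoc,
      Bicategory.Strict.associator_eqToIso, ← Category.assoc]
    exact comp_eqToHom_heq _ (Bicategory.Strict.assoc ..).symm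
  exact ⟨F ◁ m ≫ (α_ F G b.pow2).inv, key hx, key hy, key hr⟩

namespace VectorFieldObject

variable {X Y : Tangentad K} (V : VectorFieldObject Y)

/-- The chosen `T_2` upstairs need not lie strictly over the chosen one downstairs. It is exchanged
for the strict lift `L`; the change of tangentad `e` has an identity as underlying 1-morphism, so
the fibre power found for `e.hom ≫ U` is also one for `U`. -/
theorem exists_isFibrePower {n : ℕ} {P : K} {π : Fin n → (P ⟶ V.VF.X)}
    (hP : IsTwoFibrePower V.U.F π) :
    ∃ (Q : Tangentad K) (ρ : Fin n → (Q ⟶ V.VF)),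
      IsTwoFibrePower V.U.F (fun i => StrictMorphism.F (ρ i)) ∧
        IsFibrePower (C := Tangentad K) (E := V.VF) (B := Y) V.U ρ := by
  obtain ⟨L, ν, hν, hνU⟩ := V.exists_isPointwisePower_isOver two_pos Y.isPointwisePower_proj
  obtain ⟨i, hi⟩ := V.VF.isAdditiveBundle.isFibrePower.exists_iso hν.base
  let e : V.VF.withPow2 hν.base i hi ≅ V.VF := V.VF.withPow2Iso hν.base i hi
  let U : V.VF ⟶ Y := V.U
  have hF : StrictMorphism.F (e.hom ≫ U) = V.U.F := Bicategory.Strict.id_comp V.U.F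
  have hU : IsBundleOver (StrictMorphism.F (e.hom ≫ U)) (StrictMorphism.F (e.hom ≫ U))
      (V.VF.withPow2 hν.base i hi).bundle Y.bundle :=
    StrictMorphism.isBundleOver _ fun j => by
      rw [hF]
      exact hνU j
  have hcr : LiftsPowers (e.hom ≫ U) := fun n hn => by
    obtain ⟨M, μ, hμ⟩ := Y.exists_pointwisePower n hn
    obtain ⟨L, ν, hν, hνμ⟩ := V.exists_isPointwisePower_isOver hn hμ
    refine ⟨L, ν, M, μ, hν, hμ, fun i => ?_⟩
    rw [hF]
    exact hνμ i
  obtain ⟨Q, ρ, hρ, hρ'⟩ := exists_isFibrePower_tangentad (e.hom ≫ U) hU hcr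
    (hF.symm ▸ hP : IsTwoFibrePower _ π)
  refine ⟨Q, fun j => ρ j ≫ e.hom, ?_, hρ'.comp_iso e⟩
  have hρF : (fun j => StrictMorphism.F (ρ j ≫ e.hom)) = fun j => StrictMorphism.F (ρ j) :=
    funext fun j => Bicategory.Strict.comp_id _
  rw [hF] at hρ
  exact hρF.symm ▸ hρ

/-- The vector field corresponding to a strict tangent morphism is a tangent 2-morphism. -/
theorem fieldOf_isTangentTwoMorphism {H : StrictMorphism X V.VF} {G : StrictMorphism X Y}
    (h : H.F ≫ V.U.F = G.F) :
    IsTangentTwoMorphism (eqToHom G.eq) (compLaw (eqToHom G.eq) Y.c) (V.fieldOf h) := by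
  obtain ⟨G, hG, hG'⟩ := G
  dsimp only at h
  subst h
  rw [V.fieldOf_rfl]
  have h := ((V.field.Γ X).obj H.toLax).comm
  have hl : ((V.field.Γ X).obj H.toLax).law = eqToHom hG := compLaw_eqToHom H.eq V.U.eq
  rw [hl] at h
  exact h

/-- By strictness the represented field is plain whiskering of `v`, which makes its behaviour under
precomposition immediate. -/
theorem fieldOf_heq {A : K} {H : A ⟶ V.VF.X} {G : A ⟶ Y.X} (h : H ≫ V.U.F = G) :
    V.fieldOf h ≍ H ◁ V.v := by
  subst h
  rw [V.fieldOf_rfl, pullField, Bicategory.Strict.associator_eqToIso]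
  exact comp_eqToHom_heq _ (Bicategory.Strict.assoc ..).symm

theorem fieldOf_self : V.fieldOf (Bicategory.Strict.id_comp V.U.F) = V.v :=
  eq_of_heq ((V.fieldOf_heq _).trans (id_whiskerLeft_heq _))

theorem fieldOf_comp_heq {A A' : K} (F : A' ⟶ A) {H : A ⟶ V.VF.X} {G : A ⟶ Y.X}
    (h : H ≫ V.U.F = G) {G' : A' ⟶ Y.X} (h' : (F ≫ H) ≫ V.U.F = G') :
    V.fieldOf h' ≍ F ◁ V.fieldOf h := by
  refine (V.fieldOf_heq h').trans ((comp_whiskerLeft_heq _ _ _).trans ?_)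
  subst h
  exact whiskerLeft_heq rfl (Bicategory.Strict.assoc ..).symm rfl (V.fieldOf_heq rfl).symm

/-- The zero vector field on `U`. -/
theorem fieldOf_comp_zero {z : Y ⟶ V.VF} (hz : V.RepresentsZero z) :
    ∃ e : (V.U.F ≫ StrictMorphism.F z) ≫ V.U.F = V.U.F,
      V.fieldOf e = V.v ≫ V.U.F ◁ Y.p ≫ V.U.F ◁ Y.bundle.zero := by
  obtain ⟨h, hz⟩ := hz
  have e : (V.U.F ≫ StrictMorphism.F z) ≫ V.U.F = V.U.F := by
    rw [Bicategory.Strict.assoc, h, Bicategory.Strict.comp_id]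
  refine ⟨e, eq_of_heq ((V.fieldOf_comp_heq V.U.F h e).trans ?_)⟩
  have hv : V.v ≫ V.U.F ◁ Y.p = (ρ_ V.U.F).inv := by
    rw [← cancel_mono (ρ_ V.U.F).hom, Category.assoc, Iso.inv_hom_id]
    exact V.sec
  rw [hz, reassoc_of% hv, Bicategory.Strict.leftUnitor_eqToIso,
    Bicategory.Strict.rightUnitor_eqToIso, whiskerLeft_comp]
  simp [whiskerLeft_eqToHom]

/-- Vector fields on strict tangent morphisms are represented by strict tangent morphisms. -/
theorem exists_strict_of_field (G : StrictMorphism X Y) (u : G.F ⟶ G.F ≫ Y.T)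
    (hu : IsTangentTwoMorphism (eqToHom G.eq) (compLaw (eqToHom G.eq) Y.c) u)
    (hs : u ≫ G.F ◁ Y.p ≫ (ρ_ G.F).hom = 𝟙 G.F) :
    ∃ (S : StrictMorphism X V.VF) (e : S.F ≫ V.U.F = G.F), V.fieldOf e = u :=
  V.exists_strict ⟨G.toLax, u, hu, hs⟩ G.eq rfl

theorem exists_representsZero : ∃ H : StrictMorphism Y V.VF, V.RepresentsZero H := by
  have hl : eqToHom (StrictMorphism.eq (𝟙 Y)) = Y.idLax.law := by
    simp [Bicategory.Strict.leftUnitor_eqToIso, Bicategory.Strict.rightUnitor_eqToIso]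
  refine V.exists_strict_of_field (𝟙 Y) (Y.bundle.zero ≫ (λ_ Y.T).inv) ?_ ?_
  · rw [hl]
    refine Y.isTangentTwoMorphism_zero.comp ?_
    simp only [IsTangentTwoMorphism, compLaw, Tangentad.idLax]
    bicategory
  · have h := Y.isAdditiveBundle.zero_proj
    calc
      _ = Y.bundle.zero ≫ Y.p := by
        change (Y.bundle.zero ≫ (λ_ Y.T).inv) ≫ 𝟙 Y.X ◁ Y.p ≫ (ρ_ (𝟙 Y.X)).hom = _
        simp
      _ = _ := h

theorem exists_representsNeg {n : Y.T ⟶ Y.T} (hn : Y.IsNegation n) :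
    ∃ H : StrictMorphism V.VF V.VF, V.RepresentsNeg n H := by
  have hnp : n ≫ Y.p = Y.p := by
    simpa using hn.proj_eq Y.isAdditiveBundle.isFibrePower
  refine V.exists_strict_of_field V.U (V.v ≫ V.U.F ◁ n) (V.comm.comp
    ((Y.isTangentTwoMorphism_negation hn).whiskerLeft _)) ?_
  rw [Category.assoc, ← whiskerLeft_comp_assoc, hnp]
  exact V.sec

theorem exists_representsSum {P : Tangentad K} (π₁ π₂ : StrictMorphism P V.VF)
    (h : π₂.F ≫ V.U.F = π₁.F ≫ V.U.F) :
    ∃ H : StrictMorphism P V.VF, V.RepresentsSum π₁ π₂ H := by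
  let P' : P ⟶ V.VF := π₁
  let U : V.VF ⟶ Y := V.U
  let G : StrictMorphism P Y := P' ≫ U
  have h₁ : π₁.F ≫ V.U.F = G.F := rfl
  have h₂ : π₂.F ≫ V.U.F = G.F := h
  have hp := Y.isPointwisePower_proj
  have hsec {H : P.X ⟶ V.VF.X} (h : H ≫ V.U.F = G.F) : V.fieldOf h ≫ G.F ◁ Y.p = (ρ_ G.F).inv := by
    rw [← cancel_mono (ρ_ G.F).hom, Category.assoc, Iso.inv_hom_id]
    exact V.fieldOf_sec h
  obtain ⟨u, hu⟩ := BundleData.exists_isSum (b := Y.bundle.pre G.F) (hp.pre G.F)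
    (V.fieldOf h₁) (V.fieldOf h₂)
    ((hsec h₁).trans (hsec h₂).symm)
  -- Additivity of the flip supplies a law `k` on `T_2` for which the projections and the addition
  -- are tangent; hence the sum `u` of two tangent fields is tangent.
  obtain ⟨k, hk, hk'⟩ := Y.flip_additive_symm.add
  obtain ⟨S, e, rfl⟩ := V.exists_strict_of_field G u
    (IsTangentTwoMorphism.of_isSum (b := Y.bundle.pre G.F) (k := compLaw (eqToHom G.eq) k)
      (hp.post G.F) (fun i => IsTangentTwoMorphism.whiskerLeft _ (hk i))
      (IsTangentTwoMorphism.whiskerLeft _ hk') (V.fieldOf_isTangentTwoMorphism h₁)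
      (V.fieldOf_isTangentTwoMorphism h₂) hu) (by
      have h := hu.proj_add (Y.isAdditiveBundle_pre G.F).add_proj
      rw [hsec h₁] at h
      rw [reassoc_of% h, Iso.inv_hom_id])
  exact ⟨S, h₂, e, hu⟩

/-- Sums in the bundle of vector fields are sums of vector fields. -/
theorem isSum_iff {b : BundleData (C := Tangentad K) (E := V.VF) (B := Y) V.U}
    (hb : IsFibrePower (C := Tangentad K) (E := V.VF) (B := Y) V.U b.proj)
    (hs : V.RepresentsSum (b.proj 0) (b.proj 1) b.add) {A : Tangentad K} {x y r : A ⟶ V.VF}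
    {G : A.X ⟶ Y.X} (hx : StrictMorphism.F x ≫ V.U.F = G) (hy : StrictMorphism.F y ≫ V.U.F = G)
    (hr : StrictMorphism.F r ≫ V.U.F = G) :
    b.IsSum x y r ↔ (Y.bundle.pre G).IsSum (V.fieldOf hx) (V.fieldOf hy) (V.fieldOf hr) := by
  obtain ⟨h₁, h₂, hs⟩ := hs
  have key {x y r : A ⟶ V.VF} {hx : StrictMorphism.F x ≫ V.U.F = G}
      {hy : StrictMorphism.F y ≫ V.U.F = G} {hr : StrictMorphism.F r ≫ V.U.F = G}
      (h : b.IsSum x y r) :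
      (Y.bundle.pre G).IsSum (V.fieldOf hx) (V.fieldOf hy) (V.fieldOf hr) := by
    obtain ⟨m, rfl, rfl, rfl⟩ := h
    have hG := (Bicategory.Strict.assoc ..).symm.trans hx
    exact hs.pre_comp hG hG (V.fieldOf_comp_heq (StrictMorphism.F m) rfl hx)
      (V.fieldOf_comp_heq (StrictMorphism.F m) h₁ hy)
      (V.fieldOf_comp_heq (StrictMorphism.F m) h₂ hr)
  refine ⟨key, fun h => ?_⟩
  -- For the converse, the sum `t` formed among strict morphisms represents the same field as `r` by
  -- the direction already proved, and a strict morphism is determined by its field.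
  obtain ⟨t, ht⟩ := BundleData.exists_isSum hb x y (StrictMorphism.ext (hx.trans hy.symm))
  have htG : StrictMorphism.F t ≫ V.U.F = G :=
    (congrArg StrictMorphism.F (ht.proj_add (StrictMorphism.ext h₂))).trans hx
  obtain rfl : r = t := V.strict_ext hr htG
    (h.unique (Y.isPointwisePower_proj.pre G) (key (hr := htG) ht))
  exact ht

theorem isAdditiveBundle {b : BundleData (C := Tangentad K) (E := V.VF) (B := Y) V.U}
    (he : ∀ n : ℕ, 0 < n → ∃ (P : K) (π : Fin n → (P ⟶ V.VF.X)), IsTwoFibrePower V.U.F π)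
    (hb : IsFibrePower (C := Tangentad K) (E := V.VF) (B := Y) V.U b.proj)
    (hz : V.RepresentsZero b.zero) (hs : V.RepresentsSum (b.proj 0) (b.proj 1) b.add) :
    b.IsAdditiveBundle where
  exists_fibrePower n hn := by
    obtain ⟨P, π, hP⟩ := he n hn
    obtain ⟨Q, ρ, -, hρ⟩ := V.exists_isFibrePower hP
    exact ⟨Q, ρ, hρ⟩
  isFibrePower := hb
  zero_proj := by
    obtain ⟨h, -⟩ := hz
    exact StrictMorphism.ext h
  add_proj := by
    obtain ⟨-, h, -⟩ := hs
    exact StrictMorphism.ext h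
  add_assoc {A} x y t xy yt r hxy hyt hr := by
    have hp : b.add ≫ V.U = b.proj 0 ≫ V.U := by
      obtain ⟨-, h, -⟩ := hs
      exact StrictMorphism.ext h
    have ey := congrArg StrictMorphism.F (hxy.proj_eq hb).symm
    have exy := congrArg StrictMorphism.F (hxy.proj_add hp)
    have et := (congrArg StrictMorphism.F (hyt.proj_eq hb).symm).trans ey
    have eyt := (congrArg StrictMorphism.F (hyt.proj_add hp)).trans ey
    have er := (congrArg StrictMorphism.F (hr.proj_add hp)).trans exy
    exact (V.isSum_iff hb hs rfl eyt er).2 <| (Y.isAdditiveBundle_pre _).add_assoc _ _ _ _ _ _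
      ((V.isSum_iff hb hs rfl ey exy).1 hxy) ((V.isSum_iff hb hs ey et eyt).1 hyt)
      ((V.isSum_iff hb hs exy et er).1 hr)
  zero_add := by
    obtain ⟨e, h⟩ := V.fieldOf_comp_zero hz
    have e' := Bicategory.Strict.id_comp V.U.F
    refine (V.isSum_iff hb hs e e' e').2 ?_
    rw [h, V.fieldOf_self]
    -- The zero field on `U` is `z ∘ p ∘ v`, so the unit law is that of `𝐩` whiskered with `U` and
    -- evaluated at `v`.
    have h' := (Y.isAdditiveBundle.zero_add.pre V.U.F).comp V.v
    rwa [whiskerLeft_id, Category.comp_id, whiskerLeft_comp] at h'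
  add_comm {A} x y r h := by
    have hp : b.add ≫ V.U = b.proj 0 ≫ V.U := by
      obtain ⟨-, h, -⟩ := hs
      exact StrictMorphism.ext h
    have ey := congrArg StrictMorphism.F (h.proj_eq hb).symm
    have er := congrArg StrictMorphism.F (h.proj_add hp)
    exact (V.isSum_iff hb hs ey rfl er).2 <| (Y.isAdditiveBundle_pre _).add_comm _ _ _
      ((V.isSum_iff hb hs rfl ey er).1 h)

theorem isNegation {b : BundleData (C := Tangentad K) (E := V.VF) (B := Y) V.U}
    (hb : IsFibrePower (C := Tangentad K) (E := V.VF) (B := Y) V.U b.proj)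
    (hz : V.RepresentsZero b.zero) (hs : V.RepresentsSum (b.proj 0) (b.proj 1) b.add)
    {n : Y.T ⟶ Y.T} (hn : Y.IsNegation n) {neg : V.VF ⟶ V.VF} (hneg : V.RepresentsNeg n neg) :
    b.IsNegation neg := by
  obtain ⟨e, h⟩ := V.fieldOf_comp_zero hz
  obtain ⟨e'', h''⟩ := hneg
  refine (V.isSum_iff hb hs e'' (Bicategory.Strict.id_comp V.U.F) e).2 ?_
  rw [h, h'', V.fieldOf_self]
  exact BundleData.isNegation_isSum_pre hn V.U.F V.v

end VectorFieldObject

end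

end Tangentads

open Tangentads
theorem mainTheorem5 {K : Type u} [Bicategory.{w, v} K] [Bicategory.Strict K]
    (hK : AdmitsVectorFields K) (hP : AdmitsVectorFieldPowers K)
    (Y : Tangentad K) (n : Y.T ⟶ Y.T) (hn : Y.IsNegation n) (V : VectorFieldObject Y) :
    (∃ m : V.VF.T ⟶ V.VF.T, V.VF.IsNegation m) ∧
    ∃ (b : BundleData (C := Tangentad K) (E := V.VF) (B := Y) V.U) (neg : V.VF ⟶ V.VF),
      IsTwoFibrePower V.U.F (fun i => (b.proj i).F) ∧
      V.RepresentsZero b.zero ∧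
      V.RepresentsSum (b.proj 0) (b.proj 1) b.add ∧
      V.RepresentsNeg n neg ∧
      b.IsAbelianGroupBundle neg := by
  refine ⟨V.exists_negation hn, ?_⟩
  obtain ⟨P, π, h⟩ := hP Y V 2 two_pos
  obtain ⟨Q, ρ, hρ, hb⟩ := V.exists_isFibrePower h
  obtain ⟨zero, hz⟩ := V.exists_representsZero
  obtain ⟨add, hs⟩ := V.exists_representsSum (ρ 0) (ρ 1) (hρ.comm 1 0)
  obtain ⟨neg, hneg⟩ := V.exists_representsNeg hn
  exact ⟨⟨Q, ρ, zero, add⟩, neg, hρ, hz, hs, hneg, V.isAdditiveBundle (hP Y V) hb hz hs,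
    V.isNegation hb hz hs hn hneg⟩
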